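/- Let $G$ be a finite group, $p$ a prime and $k$ a field of characteristic $p$. All modules are finitely generated. A $kG$-module $M$ is a \emph{$p$-permutation module} if for every $p$-subgroup $P\le G$ the restriction of $M$ to $P$ is a permutation module, i.e. has a $k$-basis permuted by $P$. For a subgroup $P\le G$ and a $kG$-module $M$, the \emph{Brauer construction} of $M$ at $P$ is the $k[N_G(P)/P]$-module \[ M(P) = M^P\Big/\sum_{Q<P}\operatorname{tr}_Q^P(M^Q),\qquad \operatorname{tr}_Q^P(m)=\sum_{x\in[P/Q]}x\cdot m, \] where $M^Q$ denotes the $Q$-fixed points of $M$, the sum runs over the proper subgroups $Q$ of $P$, and $[P/Q]$ is a set of representatives of the cosets $xQ$ in $P$; it is an additive functor of $M$. For a chain complex $C$ of $kG$-modules, $C(P)$ denotes the chain complex of $k[N_G(P)/P]$-modules obtained by applying this functor degreewise. Let $C$ be a bounded ($\mathbb{Z}$-graded) chain complex of $p$-permutation $kG$-modules. Let $C^*=\operatorname{Hom}_k(C,k[0])$ be the dual complex, and let $k[0]$ be the trivial $kG$-module $k$ concentrated in degree $0$. Say that $C$ is \emph{endotrivial} if $C^*\otimes_k C$, with diagonal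 $G$-action, is homotopy equivalent to $k[0]$ as a complex of $kG$-modules. \textbf{Theorem.} $C$ is endotrivial if and only if for every $p$-subgroup $P\le G$ (including $P=1$) there is exactly one $i\in\mathbb{Z}$ with $H_i(C(P))\neq 0$, and for this $i$ one has $\dim_k H_i(C(P))=1$. -/

import Mathlib

open CategoryTheory MonoidalCategory

universe u v

noncomputable section

/-- The Koszul signs for `ℤ`-indexed chain complexes: the differential of `C ⊗ D` is
`c_i ⊗ id + (-1)^i id ⊗ d_j` on `C_i ⊗ D_j`. -/
instance tensorSignsDownInt : ComplexShape.TensorSigns (ComplexShape.down ℤ) where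
  ε' := MonoidHom.mk' (fun i : Multiplicative ℤ => Int.negOnePow i.toAdd)
    (fun a b => Int.negOnePow_add a.toAdd b.toAdd)
  rel_add p q r hpq := by
    simp only [ComplexShape.down_Rel] at *
    omega
  add_rel p q r hpq := by
    simp only [ComplexShape.down_Rel] at *
    omega
  ε'_succ p q hpq := by
    simp only [ComplexShape.down_Rel] at hpq
    subst hpq
    show Int.negOnePow q = - Int.negOnePow (q + 1)
    rw [Int.negOnePow_succ, neg_neg]

/-- A representation is a permutation module (on a finite set) if it has a finite basis that is
permuted by the group. -/
def Representation.IsPermutationModule {k H V : Type*} [Field k] [Group H] [AddCommGroup V]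
    [Module k V] (ρ : Representation k H V) : Prop :=
  ∃ (X : Type) (_ : Finite X) (_ : MulAction H X) (b : Module.Basis X k V),
    ∀ (h : H) (x : X), ρ h (b x) = b (h • x)

namespace Rep

variable {k : Type u} [Field k] {G : Type v} [Group G]

/-- A (finitely generated) `p`-permutation `kG`-module: its restriction to every `p`-subgroup
of `G` is a permutation module. -/
def IsPPermutation (p : ℕ) (M : Rep.{u} k G) : Prop :=
  Module.Finite k M.V ∧
    ∀ P : Subgroup G, IsPGroup p P → Representation.IsPermutationModule (M.ρ.comp P.subtype)

/-! ### The dual of a chain complex -/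

/-- The contragredient `M* = Hom_k(M, k)`, with `(g • f)(m) = f(g⁻¹ m)`. -/
abbrev dualObj (M : Rep.{u} k G) : Rep.{u} k G := Rep.of M.ρ.dual

/-- Precomposition with a morphism `M ⟶ N` of `kG`-modules, as a morphism `N* ⟶ M*`. -/
def dualMap {M N : Rep.{u} k G} (f : M ⟶ N) : dualObj N ⟶ dualObj M :=
  Rep.ofHom ⟨Module.Dual.transpose (R := k) f.hom.toLinearMap, fun g => by
    ext φ m
    exact congrArg φ (Rep.hom_comm_apply f g⁻¹ m).symm⟩

/-- The dual complex `C* = Hom_k(C, k[0])`: `(C*)_n = (C_{-n})*`, and the differential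
`(C*)_n ⟶ (C*)_{n-1}` is `(-1)^(n+1)` times precomposition with `C_{-n+1} ⟶ C_{-n}`. -/
def dualComplex (C : ChainComplex (Rep.{u} k G) ℤ) : ChainComplex (Rep.{u} k G) ℤ where
  X n := dualObj (C.X (-n))
  d i j := (i + 1).negOnePow • dualMap (C.d (-j) (-i))
  shape i j hij := by
    have h : C.d (-j) (-i) = 0 := C.shape _ _ (fun h => hij (by
      simp only [ComplexShape.down_Rel] at *
      omega))
    rw [h]
    have h0 : dualMap (0 : C.X (-j) ⟶ C.X (-i)) = 0 := by
      ext φ m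
      exact map_zero φ
    rw [h0, smul_zero]
  d_comp_d' i j l _ _ := by
    rw [Linear.units_smul_comp, Linear.comp_units_smul]
    have h0 : dualMap (C.d (-j) (-i)) ≫ dualMap (C.d (-l) (-j)) = 0 := by
      ext φ m
      have := congrArg (fun f => φ (f.hom m)) (C.d_comp_d (-l) (-j) (-i))
      exact this.trans (map_zero φ)
    rw [h0, smul_zero, smul_zero]

/-- A chain complex is bounded if all its terms outside a finite range of degrees vanish. -/
def IsBoundedComplex (C : ChainComplex (Rep.{u} k G) ℤ) : Prop :=
  ∃ a b : ℤ, ∀ i : ℤ, (i < a ∨ b < i) → Limits.IsZero (C.X i)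

/-- `C` is endotrivial: `C* ⊗ C` (tensor product of chain complexes over `k`, with diagonal
`G`-action) is homotopy equivalent, as a complex of `kG`-modules, to the trivial module `k`
concentrated in degree `0`. -/
def IsEndotrivial (C : ChainComplex (Rep.{u} k G) ℤ) : Prop :=
  Nonempty (HomotopyEquiv (HomologicalComplex.tensorObj (dualComplex C) C)
    ((HomologicalComplex.single (Rep.{u} k G) (ComplexShape.down ℤ) 0).obj
      (Rep.trivial k G k)))

/-! ### The Brauer construction -/

section Brauer

/-- The subspace `M^Q` of `Q`-fixed points of a `kG`-module `M`. -/
abbrev fixedPoints (M : Rep.{u} k G) (Q : Subgroup G) : Submodule k M.V :=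
  Representation.invariants (M.ρ.comp Q.subtype)

theorem mem_fixedPoints {M : Rep.{u} k G} {Q : Subgroup G} {m : M.V} :
    m ∈ fixedPoints M Q ↔ ∀ g ∈ Q, M.ρ g m = m :=
  ⟨fun h g hg => h ⟨g, hg⟩, fun h g => h g.1 g.2⟩

/-- If `m` is fixed by `Q`, then `n • m` is fixed by `nQn⁻¹`. -/
theorem rho_mem_fixedPoints_conj {M : Rep.{u} k G} {Q : Subgroup G} {m : M.V}
    (hm : m ∈ fixedPoints M Q) (n : G) :
    M.ρ n m ∈ fixedPoints M (Q.map (MulAut.conj n).toMonoidHom) := by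
  rw [mem_fixedPoints]
  rintro _ ⟨q, hq, rfl⟩
  have : (MulAut.conj n).toMonoidHom q * n = n * q := by simp
  rw [← Module.End.mul_apply, ← map_mul, this, map_mul, Module.End.mul_apply,
    mem_fixedPoints.1 hm q hq]

/-- On `Q`-fixed points, the action of `x ∈ P` depends only on the coset `xQ`. -/
theorem rho_out_apply {M : Rep.{u} k G} {Q P : Subgroup G} {m : M.V}
    (hm : m ∈ fixedPoints M Q) (x : P) :
    M.ρ ((QuotientGroup.mk x : P ⧸ Q.subgroupOf P).out : P) m = M.ρ x m := by
  obtain ⟨q, hq⟩ := QuotientGroup.mk_out_eq_mul (Q.subgroupOf P) x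
  rw [hq, Subgroup.coe_mul, map_mul, Module.End.mul_apply]
  exact congrArg (M.ρ x) (mem_fixedPoints.1 hm _ q.2)

/-- The normalizer `N_G(P)`. -/
abbrev nrm (P : Subgroup G) : Subgroup G := Subgroup.normalizer (P : Set G)

theorem rho_mem_fixedPoints (M : Rep.{u} k G) (P : Subgroup G) (n : nrm P) :
    fixedPoints M P ≤ (fixedPoints M P).comap ((M.ρ.comp (nrm P).subtype) n) := by
  intro m hm
  rw [Submodule.mem_comap, mem_fixedPoints]
  intro g hg
  change M.ρ g (M.ρ n m) = M.ρ n m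
  have h : g * (n : G) = n * ((n : G)⁻¹ * g * n) := by group
  rw [← Module.End.mul_apply, ← map_mul, h, map_mul, Module.End.mul_apply,
    mem_fixedPoints.1 hm _ ((Subgroup.mem_normalizer_iff''.1 n.2 g).1 hg)]

/-- The action of `N_G(P)` on `M^P`. -/
abbrev fixedPointsRho (M : Rep.{u} k G) (P : Subgroup G) :
    Representation k (nrm P) (fixedPoints M P) :=
  Representation.subrepresentation (M.ρ.comp (nrm P).subtype) _ (rho_mem_fixedPoints M P)

variable [Finite G]

/-- The sum `∑_{x ∈ [P/Q]} x • m`. -/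
def traceSum (M : Rep.{u} k G) (Q P : Subgroup G) : M.V →ₗ[k] M.V :=
  letI := Fintype.ofFinite (P ⧸ Q.subgroupOf P)
  ∑ x : P ⧸ Q.subgroupOf P, M.ρ (x.out : P)

theorem traceSum_apply (M : Rep.{u} k G) (Q P : Subgroup G) [Fintype (P ⧸ Q.subgroupOf P)]
    (m : M.V) :
    traceSum M Q P m = ∑ x : P ⧸ Q.subgroupOf P, M.ρ (x.out : P) m := by
  rw [traceSum, LinearMap.sum_apply]
  congr!

/-- If `n` normalizes `P`, then `n • tr_Q^P(m) = tr_{nQn⁻¹}^P(n • m)`. -/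
theorem rho_traceSum {M : Rep.{u} k G} {Q P : Subgroup G} {m : M.V} (hm : m ∈ fixedPoints M Q)
    {n : G} (hn : n ∈ Subgroup.normalizer (P : Set G)) :
    M.ρ n (traceSum M Q P m) = traceSum M (Q.map (MulAut.conj n).toMonoidHom) P (M.ρ n m) := by
  let _ := Fintype.ofFinite (P ⧸ Q.subgroupOf P)
  set Q' := Q.map (MulAut.conj n).toMonoidHom with hQ'
  let _ := Fintype.ofFinite (P ⧸ Q'.subgroupOf P)
  have hm' : M.ρ n m ∈ fixedPoints M Q' := rho_mem_fixedPoints_conj hm n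
  let c : P ≃ P :=
    { toFun := fun x => ⟨n * x * n⁻¹, (Subgroup.mem_normalizer_iff.1 hn x).1 x.2⟩
      invFun := fun x => ⟨n⁻¹ * x * n, (Subgroup.mem_normalizer_iff''.1 hn x).1 x.2⟩
      left_inv := fun x => by ext; simp [mul_assoc]
      right_inv := fun x => by ext; simp [mul_assoc] }
  let e : P ⧸ Q.subgroupOf P ≃ P ⧸ Q'.subgroupOf P := Quotient.congr c (fun a b => by
    change QuotientGroup.leftRel _ a b ↔ QuotientGroup.leftRel _ (c a) (c b)
    rw [← Quotient.eq, ← Quotient.eq]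
    change (QuotientGroup.mk a : P ⧸ Q.subgroupOf P) = QuotientGroup.mk b ↔
      (QuotientGroup.mk (c a) : P ⧸ Q'.subgroupOf P) = QuotientGroup.mk (c b)
    rw [QuotientGroup.eq, QuotientGroup.eq, Subgroup.mem_subgroupOf, Subgroup.mem_subgroupOf]
    have : ((c a)⁻¹ * c b : P) = (MulAut.conj n).toMonoidHom (a⁻¹ * b : P).1 := by
      simp [c, mul_assoc]
    rw [this, hQ', Subgroup.mem_map_iff_mem (MulAut.conj n).injective])
  rw [traceSum_apply, traceSum_apply, map_sum, ← Equiv.sum_comp e]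
  refine Finset.sum_congr rfl fun x _ => ?_
  have he : e x = QuotientGroup.mk (c x.out) := by
    conv_lhs => rw [← Quotient.out_eq x]
    rfl
  rw [he, rho_out_apply hm']
  change _ = M.ρ (n * (x.out : P) * n⁻¹) (M.ρ n m)
  rw [← Module.End.mul_apply, ← map_mul, ← Module.End.mul_apply, ← map_mul]
  simp

theorem traceSum_mem {M : Rep.{u} k G} {Q P : Subgroup G} {m : M.V}
    (hm : m ∈ fixedPoints M Q) : traceSum M Q P m ∈ fixedPoints M P := by
  let _ := Fintype.ofFinite (P ⧸ Q.subgroupOf P)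
  rw [mem_fixedPoints]
  intro g hg
  rw [traceSum_apply, map_sum, ← Equiv.sum_comp (MulAction.toPerm (⟨g, hg⟩ : P))
    (fun x : P ⧸ Q.subgroupOf P => M.ρ (x.out : P) m)]
  refine Finset.sum_congr rfl fun x _ => ?_
  have he : MulAction.toPerm (⟨g, hg⟩ : P) x =
      (QuotientGroup.mk (⟨g, hg⟩ * x.out) : P ⧸ Q.subgroupOf P) := by
    conv_lhs => rw [← Quotient.out_eq x]
    rfl
  rw [he, rho_out_apply hm, Subgroup.coe_mul, map_mul, Module.End.mul_apply]

/-- The trace map `tr_Q^P : M^Q ⟶ M^P`, `m ↦ ∑_{x ∈ [P/Q]} x • m`. -/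
def trace (M : Rep.{u} k G) (Q P : Subgroup G) : fixedPoints M Q →ₗ[k] fixedPoints M P :=
  ((traceSum M Q P).comp (fixedPoints M Q).subtype).codRestrict _ fun m => traceSum_mem m.2

/-- The subspace `∑_{Q < P} tr_Q^P(M^Q)` of `M^P`. -/
def properTraces (M : Rep.{u} k G) (P : Subgroup G) : Submodule k (fixedPoints M P) :=
  ⨆ (Q : Subgroup G) (_ : Q < P), LinearMap.range (trace M Q P)

theorem properTraces_le_comap (M : Rep.{u} k G) (P : Subgroup G) (n : nrm P) :
    properTraces M P ≤ (properTraces M P).comap (fixedPointsRho M P n) := by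
  refine iSup₂_le fun Q hQ => ?_
  rintro _ ⟨m, rfl⟩
  rw [Submodule.mem_comap]
  have hm' := rho_mem_fixedPoints_conj m.2 (n : G)
  have hlt : Q.map (MulAut.conj (n : G)).toMonoidHom < P := by
    have h1 : P.map (MulAut.conj (n : G)).toMonoidHom = P :=
      Subgroup.mem_normalizer_iff_map_conj_eq.1 n.2
    conv_rhs => rw [← h1]
    exact (Subgroup.map_lt_map_iff_of_injective (MulAut.conj (n : G)).injective).2 hQ
  refine Submodule.mem_iSup_of_mem _ (Submodule.mem_iSup_of_mem hlt ⟨⟨_, hm'⟩, ?_⟩)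
  ext
  exact (rho_traceSum m.2 n.2).symm

/-- The `kN_G(P)`-module `M^P / ∑_{Q < P} tr_Q^P(M^Q)`. -/
abbrev brauerRho (M : Rep.{u} k G) (P : Subgroup G) :
    Representation k (nrm P) (fixedPoints M P ⧸ properTraces M P) :=
  (fixedPointsRho M P).quotient _ (properTraces_le_comap M P)

instance brauerRho_isTrivial (M : Rep.{u} k G) (P : Subgroup G) :
    Representation.IsTrivial ((brauerRho M P).comp (P.subgroupOf (nrm P)).subtype) where
  out g := by
    ext m
    refine congrArg (Submodule.Quotient.mk (p := properTraces M P)) (Subtype.ext ?_)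
    exact mem_fixedPoints.1 m.2 _ g.2

/-- The Brauer construction `M(P) = M^P / ∑_{Q < P} tr_Q^P(M^Q)`, a `k[N_G(P)/P]`-module. -/
abbrev brauerObj (M : Rep.{u} k G) (P : Subgroup G) : Rep.{u} k (nrm P ⧸ P.subgroupOf (nrm P)) :=
  Rep.of ((brauerRho M P).ofQuotient (P.subgroupOf (nrm P)))

/-- A morphism of `kG`-modules restricted to `P`-fixed points. -/
def fixedPointsMap {M N : Rep.{u} k G} (f : M ⟶ N) (P : Subgroup G) :
    fixedPoints M P →ₗ[k] fixedPoints N P :=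
  f.hom.toLinearMap.restrict fun m hm => mem_fixedPoints.2 fun g hg =>
    (Rep.hom_comm_apply f g m).symm.trans (congrArg f.hom (mem_fixedPoints.1 hm g hg))

theorem properTraces_le_comap_map {M N : Rep.{u} k G} (f : M ⟶ N) (P : Subgroup G) :
    properTraces M P ≤ (properTraces N P).comap (fixedPointsMap f P) := by
  refine iSup₂_le fun Q hQ => ?_
  rintro _ ⟨m, rfl⟩
  rw [Submodule.mem_comap]
  refine Submodule.mem_iSup_of_mem Q (Submodule.mem_iSup_of_mem hQ ⟨fixedPointsMap f Q m, ?_⟩)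
  ext
  let _ := Fintype.ofFinite (P ⧸ Q.subgroupOf P)
  change traceSum N Q P (f.hom m) = f.hom (traceSum M Q P m)
  rw [traceSum_apply, traceSum_apply, map_sum]
  exact Finset.sum_congr rfl fun x _ => (Rep.hom_comm_apply f _ _).symm

/-- The Brauer construction as a functor from `kG`-modules to `k[N_G(P)/P]`-modules. -/
def brauer (P : Subgroup G) : Rep.{u} k G ⥤ Rep.{u} k (nrm P ⧸ P.subgroupOf (nrm P)) where
  obj M := brauerObj M P
  map {M N} f := Rep.ofHom
    ⟨(properTraces M P).mapQ (properTraces N P) (fixedPointsMap f P)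
        (properTraces_le_comap_map f P), fun g => by
      induction g using QuotientGroup.induction_on with
      | H n =>
        ext m
        refine congrArg (Submodule.Quotient.mk (p := properTraces N P)) (Subtype.ext ?_)
        exact Rep.hom_comm_apply f (n : G) m.1⟩
  map_id M := by
    ext m
    rfl
  map_comp f g := by
    ext m
    rfl

instance brauer_additive (P : Subgroup G) : (brauer (k := k) P).Additive where
  map_add {M N f g} := by
    ext m
    obtain ⟨m, rfl⟩ := Submodule.Quotient.mk_surjective _ m
    rfl

/-- The Brauer construction `C(P)` of a chain complex, applied degreewise. -/
def brauerComplex (C : ChainComplex (Rep.{u} k G) ℤ) (P : Subgroup G) :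
    ChainComplex (Rep.{u} k (nrm P ⧸ P.subgroupOf (nrm P))) ℤ :=
  ((brauer P).mapHomologicalComplex (ComplexShape.down ℤ)).obj C

end Brauer

end Rep
end

/-! Fix a `p`-subgroup `Q`. The maps that are sums of proper relative traces to `Q` form an ideal,
`traceIdeal`, in the `Q`-linear maps, compatible with duals and tensor products. In characteristic
`p`, proper traces vanish on modules with trivial action (`traces_eq_bot`), so invariant linear
forms do not see this ideal. Modulo it, a `p`-permutation module is its Brauer construction with
trivial action (`exists_brauer_splitting`): the projection onto an orbit of non-fixed basis vectors
is a trace from a stabilizer. Hence homotopies on `C(Q)` lift to `Q`-linear homotopies on `C` up to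
proper traces (`lift_homotopy_sub_mem`), and `(C* ⊗ C)(Q)` never has to be computed. Complexes are
handled through their total modules `V` with differential and grading projections; `C* ⊗ C` becomes
`V* ⊗ V`.

Suppose that every `C(Q)` has a line as homology. Evaluation on `V* ⊗ V`, and coevaluation at the
grading automorphism, are chain maps whose composite is the supertrace `t` of the identity. Over
`Q`, contracting `C(Q)` onto its homology makes the identity of `V` homotopic to a map of rank one
modulo proper traces. This yields `t = ±1` in `k` and shows that the idempotent `e = 1 - t • coev ∘
ev` is `Q`-homotopic to a sum of proper traces (`exists_evCompl_homotopy`). If `e` is also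
null-homotopic over all proper subgroups of `Q`, it is null-homotopic over `Q` (`isNullOn_of_lt`):
homotopies over proper subgroups are transferred to `Q` by traces, and boundedness lets the homotopy
be built degree by degree. Induction over `p`-subgroups reaches a Sylow subgroup, and averaging
reaches `G` (`isNullOn_top`). Thus `C* ⊗ C` retracts onto `k` up to homotopy.

Conversely, a homotopy equivalence provides an invariant cycle `α` and an invariant cocycle `β` with
`β α = 1` such that the identity of `V* ⊗ V` is homotopic to `β ⊗ α`. If `C(Q)` were contractible,
the identity of `V` would be homotopic to a sum of proper traces, forcing `β α = 0`
(`cocycle_apply_eq_zero`). If `C(Q)` had two independent classes, their duality pairing would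
contradict the rank one factorization in `pairing_eq`. So the total homology of `C(Q)` is a line. -/

noncomputable section

/-! ### Relative traces and the ideal of maps that are sums of proper traces -/

namespace Rep

variable {k : Type u} [Field k] {G : Type v} [Group G]

/-- A `k`-linear map between `kG`-modules that commutes with the action of the subgroup `Q`. -/
def IsLinearOn (Q : Subgroup G) (M N : Rep.{u} k G) (f : M.V →ₗ[k] N.V) : Prop :=
  ∀ g ∈ Q, ∀ m, f (M.ρ g m) = N.ρ g (f m)

/-- The `kG`-module `Hom_k(M, N)`. -/
abbrev homRep (M N : Rep.{u} k G) : Rep.{u} k G := Rep.of (Representation.linHom M.ρ N.ρ)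

/-- This lets the trace formalism for modules be applied to maps, regarded as elements of `homRep M
N`. -/
theorem isLinearOn_iff_mem_fixedPoints {Q : Subgroup G} {M N : Rep.{u} k G}
    {f : M.V →ₗ[k] N.V} : IsLinearOn Q M N f ↔ f ∈ fixedPoints (homRep M N) Q := by
  rw [mem_fixedPoints]
  constructor
  · intro h g hg
    ext m
    change N.ρ g (f (M.ρ g⁻¹ m)) = f m
    rw [← h g hg, M.ρ.self_inv_apply]
  · intro h g hg m
    have := LinearMap.congr_fun (h g hg) (M.ρ g m)
    change N.ρ g (f (M.ρ g⁻¹ (M.ρ g m))) = f (M.ρ g m) at this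
    rw [← this, M.ρ.inv_self_apply]

namespace IsLinearOn

variable {Q : Subgroup G} {L M N : Rep.{u} k G}

theorem mono {R : Subgroup G} (hRQ : R ≤ Q) {f : M.V →ₗ[k] N.V} (hf : IsLinearOn Q M N f) :
    IsLinearOn R M N f := fun g hg => hf g (hRQ hg)

theorem comp {g : M.V →ₗ[k] N.V} {f : L.V →ₗ[k] M.V} (hg : IsLinearOn Q M N g)
    (hf : IsLinearOn Q L M f) : IsLinearOn Q L N (g ∘ₗ f) := fun x hx m => by
  simp only [LinearMap.comp_apply]
  rw [hf x hx, hg x hx]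

theorem add {f g : M.V →ₗ[k] N.V} (hf : IsLinearOn Q M N f) (hg : IsLinearOn Q M N g) :
    IsLinearOn Q M N (f + g) := fun x hx m => by
  simp only [LinearMap.add_apply, map_add]
  rw [hf x hx, hg x hx]

theorem sub {f g : M.V →ₗ[k] N.V} (hf : IsLinearOn Q M N f) (hg : IsLinearOn Q M N g) :
    IsLinearOn Q M N (f - g) := fun x hx m => by
  simp only [LinearMap.sub_apply, map_sub]
  rw [hf x hx, hg x hx]

theorem smul (c : k) {f : M.V →ₗ[k] N.V} (hf : IsLinearOn Q M N f) :
    IsLinearOn Q M N (c • f) := fun x hx m => by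
  simp only [LinearMap.smul_apply, map_smul]
  rw [hf x hx]

theorem sum {ι : Type*} (s : Finset ι) {f : ι → M.V →ₗ[k] N.V}
    (hf : ∀ i ∈ s, IsLinearOn Q M N (f i)) : IsLinearOn Q M N (∑ i ∈ s, f i) :=
  fun x hx m => by
    simp only [LinearMap.sum_apply, map_sum]
    exact Finset.sum_congr rfl fun i hi => hf i hi x hx m

protected theorem id : IsLinearOn Q M M LinearMap.id := fun _ _ _ => rfl

protected theorem zero : IsLinearOn Q M N 0 := fun x _ m => by simp

theorem of_hom (f : M ⟶ N) : IsLinearOn Q M N f.hom.toLinearMap :=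
  fun g _ m => hom_comm_apply f g m

theorem tensor {M' N' : Rep.{u} k G} {f : M.V →ₗ[k] N.V} {f' : M'.V →ₗ[k] N'.V}
    (hf : IsLinearOn Q M N f) (hf' : IsLinearOn Q M' N' f') :
    IsLinearOn Q (M ⊗ M') (N ⊗ N') (TensorProduct.map f f') := fun g hg m => by
  induction m using TensorProduct.induction_on with
  | zero => simp
  | add x y hx hy => simp only [map_add, hx, hy]
  | tmul x y =>
    change TensorProduct.map f f' (TensorProduct.tmul k (M.ρ g x) (M'.ρ g y)) =
      TensorProduct.tmul k (N.ρ g (f x)) (N'.ρ g (f' y))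
    rw [TensorProduct.map_tmul, hf g hg, hf' g hg]

theorem dual {f : M.V →ₗ[k] N.V} (hf : IsLinearOn Q M N f) :
    IsLinearOn Q (dualObj N) (dualObj M) (Module.Dual.transpose (R := k) f) :=
  fun g hg φ => by
    ext m
    change φ (N.ρ g⁻¹ (f m)) = φ (f (M.ρ g⁻¹ m))
    rw [hf _ (inv_mem hg)]

end IsLinearOn

theorem IsLinearOn.map_mem_fixedPoints {M N : Rep.{u} k G} {Q : Subgroup G}
    {f : M.V →ₗ[k] N.V} (hf : IsLinearOn Q M N f) {m : M.V} (hm : m ∈ fixedPoints M Q) :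
    f m ∈ fixedPoints N Q :=
  mem_fixedPoints.2 fun g hg => by rw [← hf g hg, mem_fixedPoints.1 hm g hg]

section

variable {Q : Subgroup G} {L M N : Rep.{u} k G}

theorem isLinearOn_postcomp {g : M.V →ₗ[k] N.V} (hg : IsLinearOn Q M N g) :
    IsLinearOn Q (homRep L M) (homRep L N) (LinearMap.llcomp k L.V M.V N.V g) :=
  fun x hx f => by
    ext m
    change g (M.ρ x (f (L.ρ x⁻¹ m))) = N.ρ x (g (f (L.ρ x⁻¹ m)))
    rw [hg x hx]

theorem isLinearOn_precomp {f : L.V →ₗ[k] M.V} (hf : IsLinearOn Q L M f) :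
    IsLinearOn Q (homRep M N) (homRep L N) (LinearMap.lcomp k N.V f) :=
  fun x hx g => by
    ext m
    change N.ρ x (g (M.ρ x⁻¹ (f m))) = N.ρ x (g (f (L.ρ x⁻¹ m)))
    rw [hf _ (inv_mem hx)]

end

variable [Finite G]

/-- The subspace `∑_{R < Q} tr_R^Q(M^R)` of `M`. -/
def traces (M : Rep.{u} k G) (Q : Subgroup G) : Submodule k M.V :=
  ⨆ (R : Subgroup G) (_ : R < Q), (fixedPoints M R).map (traceSum M R Q)

theorem traceSum_mem_traces {M : Rep.{u} k G} {R Q : Subgroup G} (hRQ : R < Q) {m : M.V}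
    (hm : m ∈ fixedPoints M R) : traceSum M R Q m ∈ traces M Q :=
  Submodule.mem_iSup_of_mem R (Submodule.mem_iSup_of_mem hRQ ⟨m, hm, rfl⟩)

theorem traces_le_iff {M : Rep.{u} k G} {Q : Subgroup G} {W : Submodule k M.V} :
    traces M Q ≤ W ↔ ∀ R < Q, ∀ m ∈ fixedPoints M R, traceSum M R Q m ∈ W := by
  simp only [traces, iSup₂_le_iff, Submodule.map_le_iff_le_comap]
  rfl

theorem map_properTraces (M : Rep.{u} k G) (Q : Subgroup G) :
    (properTraces M Q).map (fixedPoints M Q).subtype = traces M Q := by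
  simp only [properTraces, traces, Submodule.map_iSup]
  refine iSup_congr fun R => iSup_congr fun _ => ?_
  rw [← LinearMap.range_comp]
  ext x
  constructor
  · rintro ⟨y, rfl⟩
    exact ⟨y.1, y.2, rfl⟩
  · rintro ⟨y, hy, rfl⟩
    exact ⟨⟨y, hy⟩, rfl⟩

theorem mem_properTraces_iff {M : Rep.{u} k G} {Q : Subgroup G} {m : fixedPoints M Q} :
    m ∈ properTraces M Q ↔ (m : M.V) ∈ traces M Q := by
  rw [← map_properTraces]
  constructor
  · exact fun h => ⟨m, h, rfl⟩
  · rintro ⟨x, hx, h⟩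
    rwa [← Subtype.ext h]

theorem traces_le_fixedPoints (M : Rep.{u} k G) (Q : Subgroup G) :
    traces M Q ≤ fixedPoints M Q := by
  rw [← map_properTraces]
  exact Submodule.map_subtype_le _ _

theorem map_traceSum {M N : Rep.{u} k G} {R Q : Subgroup G} {f : M.V →ₗ[k] N.V}
    (hf : IsLinearOn Q M N f) (m : M.V) :
    f (traceSum M R Q m) = traceSum N R Q (f m) := by
  let _ := Fintype.ofFinite (Q ⧸ R.subgroupOf Q)
  rw [traceSum_apply, traceSum_apply, map_sum]
  exact Finset.sum_congr rfl fun x _ => hf _ x.out.2 m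

/-- Relative traces commute with `Q`-linear maps. The ideal properties below come from applying this
to composition, tensoring, transposition and evaluation, seen as `Q`-linear maps between
Hom-modules. -/
theorem IsLinearOn.map_mem_traces {M N : Rep.{u} k G} {Q : Subgroup G}
    {f : M.V →ₗ[k] N.V} (hf : IsLinearOn Q M N f) {m : M.V} (hm : m ∈ traces M Q) :
    f m ∈ traces N Q := by
  suffices traces M Q ≤ (traces N Q).comap f from this hm
  rw [traces_le_iff]
  intro R hR m hm
  rw [Submodule.mem_comap, map_traceSum hf]
  exact traceSum_mem_traces hR ((hf.mono hR.le).map_mem_fixedPoints hm)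

theorem traceSum_of_mem_fixedPoints {M : Rep.{u} k G} {R Q : Subgroup G} {m : M.V}
    (hm : m ∈ fixedPoints M Q) : traceSum M R Q m = ((R.relIndex Q : ℕ) : k) • m := by
  let _ := Fintype.ofFinite (Q ⧸ R.subgroupOf Q)
  rw [traceSum_apply, Finset.sum_congr rfl fun x _ => mem_fixedPoints.1 hm _ x.out.2,
    Finset.sum_const, Finset.card_univ, ← Nat.cast_smul_eq_nsmul k, Subgroup.relIndex,
    Subgroup.index, Nat.card_eq_fintype_card]

/-- On `Q`-fixed vectors the trace is multiplication by the index of `R` in `Q`, a positive power of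
`p`. -/
theorem traceSum_eq_zero_of_mem_fixedPoints {p : ℕ} [Fact p.Prime] [CharP k p]
    {M : Rep.{u} k G} {R Q : Subgroup G} (hQ : IsPGroup p Q) (hRQ : R < Q) {m : M.V}
    (hm : m ∈ fixedPoints M Q) : traceSum M R Q m = 0 := by
  rw [traceSum_of_mem_fixedPoints hm]
  obtain ⟨n, hn⟩ := (hQ.index (R.subgroupOf Q))
  have hn0 : n ≠ 0 := by
    rintro rfl
    rw [pow_zero, Subgroup.index_eq_one, Subgroup.subgroupOf_eq_top] at hn
    exact hRQ.not_ge hn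
  rw [Subgroup.relIndex, hn, Nat.cast_pow, CharP.cast_eq_zero, zero_pow hn0, zero_smul]

/-- If `Q` acts trivially on `M`, then all proper traces vanish. -/
theorem traces_eq_bot {p : ℕ} [Fact p.Prime] [CharP k p] {M : Rep.{u} k G} {Q : Subgroup G}
    (hQ : IsPGroup p Q) (hM : ∀ g ∈ Q, ∀ m, M.ρ g m = m) : traces M Q = ⊥ := by
  rw [eq_bot_iff, traces_le_iff]
  intro R hR m _
  rw [Submodule.mem_bot]
  exact traceSum_eq_zero_of_mem_fixedPoints hQ hR (mem_fixedPoints.2 fun g hg => hM g hg m)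

/-- The `k`-linear maps `M → N` that are sums of proper traces to `Q`. -/
abbrev traceIdeal (Q : Subgroup G) (M N : Rep.{u} k G) : Submodule k (M.V →ₗ[k] N.V) :=
  traces (homRep M N) Q

section traceIdeal

variable {Q : Subgroup G} {L M N : Rep.{u} k G}

theorem isLinearOn_of_mem_traceIdeal {f : M.V →ₗ[k] N.V} (hf : f ∈ traceIdeal Q M N) :
    IsLinearOn Q M N f :=
  isLinearOn_iff_mem_fixedPoints.2 (traces_le_fixedPoints _ _ hf)

theorem comp_mem_traceIdeal_right {g : M.V →ₗ[k] N.V} (hg : IsLinearOn Q M N g)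
    {f : L.V →ₗ[k] M.V} (hf : f ∈ traceIdeal Q L M) : g ∘ₗ f ∈ traceIdeal Q L N :=
  (isLinearOn_postcomp hg).map_mem_traces hf

theorem comp_mem_traceIdeal_left {g : M.V →ₗ[k] N.V} (hg : g ∈ traceIdeal Q M N)
    {f : L.V →ₗ[k] M.V} (hf : IsLinearOn Q L M f) : g ∘ₗ f ∈ traceIdeal Q L N :=
  (isLinearOn_precomp hf).map_mem_traces hg

/-- Evaluation at a `Q`-fixed vector is a `Q`-linear map from `homRep M N` to `N`. -/
theorem apply_mem_traces {f : M.V →ₗ[k] N.V} (hf : f ∈ traceIdeal Q M N) {m : M.V}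
    (hm : m ∈ fixedPoints M Q) : f m ∈ traces N Q := by
  refine IsLinearOn.map_mem_traces (M := homRep M N) (N := N)
    (f := LinearMap.applyₗ (R := k) (M₂ := N.V) m) (fun g hg f => ?_) hf
  change N.ρ g (f (M.ρ g⁻¹ m)) = N.ρ g (f m)
  rw [mem_fixedPoints.1 hm _ (inv_mem hg)]

theorem map_mem_traceIdeal_right {M' N' : Rep.{u} k G} {f : M.V →ₗ[k] N.V}
    (hf : IsLinearOn Q M N f) {t : M'.V →ₗ[k] N'.V} (ht : t ∈ traceIdeal Q M' N') :
    TensorProduct.map f t ∈ traceIdeal Q (M ⊗ M') (N ⊗ N') := by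
  refine IsLinearOn.map_mem_traces (M := homRep M' N') (N := homRep (M ⊗ M') (N ⊗ N'))
    (f := TensorProduct.mapBilinear (.id k) M.V M'.V N.V N'.V f) (fun g hg t => ?_) ht
  refine TensorProduct.ext' fun x y => ?_
  change TensorProduct.tmul k (f x) (N'.ρ g (t (M'.ρ g⁻¹ y))) =
    TensorProduct.tmul k (N.ρ g (f (M.ρ g⁻¹ x))) (N'.ρ g (t (M'.ρ g⁻¹ y)))
  rw [← hf g hg, M.ρ.self_inv_apply]

theorem map_mem_traceIdeal_left {M' N' : Rep.{u} k G} {t : M.V →ₗ[k] N.V}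
    (ht : t ∈ traceIdeal Q M N) {f : M'.V →ₗ[k] N'.V} (hf : IsLinearOn Q M' N' f) :
    TensorProduct.map t f ∈ traceIdeal Q (M ⊗ M') (N ⊗ N') := by
  refine IsLinearOn.map_mem_traces (M := homRep M N) (N := homRep (M ⊗ M') (N ⊗ N'))
    (f := (TensorProduct.mapBilinear (.id k) M.V M'.V N.V N'.V).flip f) (fun g hg t => ?_) ht
  refine TensorProduct.ext' fun x y => ?_
  change TensorProduct.tmul k (N.ρ g (t (M.ρ g⁻¹ x))) (f y) =
    TensorProduct.tmul k (N.ρ g (t (M.ρ g⁻¹ x))) (N'.ρ g (f (M'.ρ g⁻¹ y)))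
  rw [← hf g hg, M'.ρ.self_inv_apply]

theorem dual_mem_traceIdeal {t : M.V →ₗ[k] N.V} (ht : t ∈ traceIdeal Q M N) :
    Module.Dual.transpose (R := k) t ∈ traceIdeal Q (dualObj N) (dualObj M) := by
  refine IsLinearOn.map_mem_traces (M := homRep M N) (N := homRep (dualObj N) (dualObj M))
    (f := Module.Dual.transpose (R := k)) (fun g hg t => ?_) ht
  ext φ m
  change φ (N.ρ g (t (M.ρ g⁻¹ m))) = φ (N.ρ g⁻¹⁻¹ (t (M.ρ g⁻¹ m)))
  rw [inv_inv]

variable {p : ℕ} [Fact p.Prime] [CharP k p]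

/-- The trace form is invariant under conjugation, so it carries proper traces of endomorphisms to
proper traces in the trivial module, and these are zero. -/
theorem linearMapTrace_eq_zero_of_mem_traceIdeal [Module.Finite k M.V] (hQ : IsPGroup p Q)
    {t : M.V →ₗ[k] M.V} (ht : t ∈ traceIdeal Q M M) : LinearMap.trace k M.V t = 0 := by
  have h : LinearMap.trace k M.V t ∈ traces (Rep.trivial k G k) Q := by
    refine IsLinearOn.map_mem_traces (M := homRep M M) (N := Rep.trivial k G k)
      (f := LinearMap.trace k M.V) (fun g hg t => ?_) ht
    change LinearMap.trace k M.V (M.ρ g ∘ₗ t ∘ₗ M.ρ g⁻¹) = LinearMap.trace k M.V t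
    rw [LinearMap.trace_comp_comm', LinearMap.comp_assoc]
    congr 1
    ext m
    simp
  rwa [traces_eq_bot hQ fun _ _ _ => rfl, Submodule.mem_bot] at h

end traceIdeal

end Rep

/-! ### Permutation modules modulo proper traces -/

namespace Rep

variable {k : Type u} [Field k] {G : Type v} [Group G]

section permutation

variable {M : Rep.{u} k G} {Q : Subgroup G} {X : Type} [MulAction Q X] (b : Module.Basis X k M.V)

/-- The projection onto the line spanned by the basis vector `b x`. -/
def basisProj (x : X) : M.V →ₗ[k] M.V := (b.coord x).smulRight (b x)

theorem basisProj_basis [DecidableEq X] (x y : X) :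
    basisProj b x (b y) = if x = y then b x else 0 := by
  rw [basisProj, LinearMap.smulRight_apply, b.coord_apply, b.repr_self, Finsupp.single_apply]
  by_cases h : x = y
  · rw [if_pos h, if_pos h.symm, one_smul]
  · rw [if_neg h, if_neg (Ne.symm h), zero_smul]

variable {b} (hb : ∀ (h : Q) (x : X), M.ρ h (b x) = b (h • x))
include hb

theorem conj_basisProj (g : Q) (x : X) :
    (homRep M M).ρ g (basisProj b x) = basisProj b (g • x) := by
  classical
  refine b.ext fun y => ?_
  change M.ρ g (basisProj b x (M.ρ (g : G)⁻¹ (b y))) = _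
  have h : M.ρ (g : G)⁻¹ (b y) = b (g⁻¹ • y) := hb g⁻¹ y
  rw [h, basisProj_basis, basisProj_basis]
  by_cases hx : x = g⁻¹ • y
  · rw [if_pos hx, if_pos (by rw [hx, smul_inv_smul]), hb]
  · rw [if_neg hx, if_neg (fun h' => hx (by rw [← h', inv_smul_smul])), map_zero]

variable [Finite G]

/-- The projection onto the line of `b x` is invariant under the stabilizer `R` of `x`, and its
conjugates are the projections for the other points of the orbit. So the orbit sum is the trace from
`R`, which is proper because `x` is not fixed. -/
theorem sum_orbit_basisProj_mem_traceIdeal [Fintype X] [DecidableEq X] (x : X)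
    (hx : x ∉ MulAction.fixedPoints Q X) [DecidablePred (· ∈ MulAction.orbit Q x)] :
    ∑ y with y ∈ MulAction.orbit Q x, basisProj b y ∈ traceIdeal Q M M := by
  set S := MulAction.stabilizer Q x with hS
  set R : Subgroup G := S.map Q.subtype with hR
  have hRS : ∀ q, q ∈ R.subgroupOf Q ↔ q • x = x := fun q => by
    rw [hR, Subgroup.subgroupOf, Subgroup.comap_map_eq_self_of_injective Q.subtype_injective, hS,
      MulAction.mem_stabilizer_iff]
  have hlt : R < Q := by
    refine lt_of_le_of_ne (Subgroup.map_subtype_le S) fun h => hx fun g => ?_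
    have : g ∈ R.subgroupOf Q := by
      rw [h]
      exact g.2
    exact (hRS g).1 this
  have hfix : basisProj b x ∈ fixedPoints (homRep M M) R := by
    rw [mem_fixedPoints]
    rintro _ ⟨g, hg, rfl⟩
    have := conj_basisProj hb g x
    rw [show g • x = x from hg] at this
    exact this
  suffices h : ∑ y with y ∈ MulAction.orbit Q x, basisProj b y =
      traceSum (homRep M M) R Q (basisProj b x) by
    rw [h]
    exact traceSum_mem_traces hlt hfix
  let _ := Fintype.ofFinite (Q ⧸ R.subgroupOf Q)
  rw [traceSum_apply]
  symm
  refine Finset.sum_bij (fun c _ => c.out • x) (fun c _ => by simp) ?_ ?_ ?_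
  · intro c _ c' _ h
    rw [← Quotient.out_eq c, ← Quotient.out_eq c']
    refine QuotientGroup.eq.2 ?_
    rw [hRS, mul_smul, ← h, inv_smul_smul]
  · intro y hy
    obtain ⟨g, rfl⟩ := (Finset.mem_filter.1 hy).2
    refine ⟨QuotientGroup.mk g, Finset.mem_univ _, ?_⟩
    obtain ⟨s, hs⟩ := QuotientGroup.mk_out_eq_mul (R.subgroupOf Q) g
    have hs' : (s : Q) • x = x := (hRS s).1 s.2
    change (QuotientGroup.mk g : Q ⧸ R.subgroupOf Q).out • x = g • x
    rw [hs, mul_smul, hs']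
  · intro c _
    exact conj_basisProj hb _ _

theorem sum_basisProj_mem_traceIdeal [Fintype X]
    [DecidablePred (· ∉ MulAction.fixedPoints Q X)] :
    ∑ x with x ∉ MulAction.fixedPoints Q X, basisProj b x ∈ traceIdeal Q M M := by
  classical
  -- The non-fixed basis elements are grouped by orbits; the orbit of a fixed point contributes an
  -- empty sum.
  rw [← Finset.sum_fiberwise _ (fun x => (Quotient.mk'' x : MulAction.orbitRel.Quotient Q X))]
  refine Submodule.sum_mem _ fun ω _ => ?_
  induction ω using Quotient.inductionOn' with
  | h x =>
    by_cases hx : x ∈ MulAction.fixedPoints Q X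
    · rw [Finset.sum_eq_zero]
      · exact Submodule.zero_mem _
      · intro y hy
        simp only [Finset.mem_filter, Finset.mem_univ, true_and] at hy
        exfalso
        obtain ⟨g, hg⟩ : y ∈ MulAction.orbit Q x := Quotient.eq''.1 hy.2
        refine hy.1 ?_
        rw [← show x = y from (hx g).symm.trans hg]
        exact hx
    · convert sum_orbit_basisProj_mem_traceIdeal hb x hx using 2
      ext y
      simp only [Finset.mem_filter, Finset.mem_univ, true_and]
      rw [Quotient.eq'', MulAction.orbitRel_apply, and_iff_right_iff_imp]
      rintro ⟨g, rfl⟩ hy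
      refine hx ?_
      have : x = g • x := by
        conv_lhs => rw [← inv_smul_smul g x]
        exact hy g⁻¹
      rw [this]
      exact hy

end permutation

variable [Finite G]

/-- A `p`-permutation module splits over a `p`-subgroup `Q` as the sum of its Brauer construction,
with trivial action, and of a module whose identity is a sum of proper traces. -/
theorem exists_brauer_splitting {p : ℕ} [Fact p.Prime] [CharP k p] {M : Rep.{u} k G}
    {Q : Subgroup G} (hQ : IsPGroup p Q)
    (hM : Representation.IsPermutationModule (M.ρ.comp Q.subtype)) :
    ∃ (i : (brauerObj M Q).V →ₗ[k] M.V) (r : M.V →ₗ[k] (brauerObj M Q).V),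
      (∀ g ∈ Q, ∀ x, M.ρ g (i x) = i x) ∧ (∀ g ∈ Q, ∀ m, r (M.ρ g m) = r m) ∧
      r ∘ₗ i = LinearMap.id ∧ LinearMap.id - i ∘ₗ r ∈ traceIdeal Q M M ∧
      ∀ m : fixedPoints M Q, r m = Submodule.Quotient.mk m := by
  classical
  obtain ⟨X, _, _, b, hb⟩ := hM
  have hb' : ∀ (h : Q) (x : X), M.ρ h (b x) = b (h • x) := hb
  let _ := Fintype.ofFinite X
  -- `E` projects onto the span of the fixed basis vectors, where `Q` acts trivially; `1 - E` is the
  -- sum of the remaining basis projections.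
  let E : M.V →ₗ[k] M.V := ∑ x with x ∈ MulAction.fixedPoints Q X, basisProj b x
  have hE : LinearMap.id - E ∈ traceIdeal Q M M := by
    convert sum_basisProj_mem_traceIdeal hb' using 1
    rw [sub_eq_iff_eq_add', Finset.sum_filter_add_sum_filter_not]
    refine b.ext fun y => ?_
    simp [LinearMap.sum_apply, basisProj_basis]
  have hEb : ∀ y, E (b y) = if y ∈ MulAction.fixedPoints Q X then b y else 0 := by
    intro y
    simp only [E, LinearMap.sum_apply, basisProj_basis]
    rw [Finset.sum_ite_eq' _ y]
    simp
  have hgE : ∀ g ∈ Q, ∀ m, M.ρ g (E m) = E m := by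
    intro g hg m
    suffices M.ρ g ∘ₗ E = E from LinearMap.congr_fun this m
    refine b.ext fun y => ?_
    rw [LinearMap.comp_apply, hEb]
    split_ifs with h
    · rw [hb' ⟨g, hg⟩, h ⟨g, hg⟩]
    · rw [map_zero]
  have hEl : IsLinearOn Q M M E := by
    have := (IsLinearOn.id (Q := Q) (M := M)).sub (isLinearOn_of_mem_traceIdeal hE)
    rwa [sub_sub_cancel] at this
  have hEg : ∀ g ∈ Q, ∀ m, E (M.ρ g m) = E m := fun g hg m => by rw [hEl g hg, hgE g hg]
  have hEfix : ∀ m, E m ∈ fixedPoints M Q := fun m => mem_fixedPoints.2 fun g hg => hgE g hg m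
  have hEtr : properTraces M Q ≤ LinearMap.ker (E ∘ₗ (fixedPoints M Q).subtype) := by
    intro m hm
    rw [LinearMap.mem_ker]
    -- `E` is also `Q`-linear into the trivial module on the same space, where proper traces vanish;
    -- hence `E` factors through the Brauer quotient.
    have h := IsLinearOn.map_mem_traces (N := Rep.trivial k G M.V) (f := E)
      (fun g hg m => hEg g hg m) (mem_properTraces_iff.1 hm)
    rw [traces_eq_bot hQ (fun _ _ _ => rfl)] at h
    exact (Submodule.mem_bot k).1 h
  have hmk : ∀ m : fixedPoints M Q, (Submodule.Quotient.mk ⟨E m, hEfix m⟩ :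
      (brauerObj M Q).V) = Submodule.Quotient.mk m := by
    intro m
    symm
    refine (Submodule.Quotient.eq _).2 (mem_properTraces_iff.2 ?_)
    exact apply_mem_traces hE m.2
  refine ⟨(properTraces M Q).liftQ _ hEtr, (properTraces M Q).mkQ ∘ₗ E.codRestrict _ hEfix,
    ?_, ?_, ?_, ?_, hmk⟩
  · intro g hg x
    obtain ⟨m, rfl⟩ := Submodule.Quotient.mk_surjective _ x
    exact hgE g hg m
  · intro g hg m
    exact congrArg (Submodule.Quotient.mk (p := properTraces M Q)) (Subtype.ext (hEg g hg m))
  · ext m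
    exact hmk ⟨E m, hEfix m⟩ |>.trans (hmk m)
  · convert hE using 2
    refine b.ext fun y => ?_
    change E (E (b y)) = E (b y)
    rw [hEb]
    split_ifs with h
    · rw [hEb, if_pos h]
    · rw [map_zero]

end Rep

/-! ### Graded differential modules and null-homotopies over subgroups -/

namespace Rep

variable {k : Type u} [Field k] {G : Type v} [Group G]

/-- The total module of a bounded chain complex of `kG`-modules: a `kG`-module with a differential
and the projections `P n` onto its homogeneous components. -/
structure GradedDifferential (V : Rep.{u} k G) where
  /-- the differential -/
  d : Module.End k V.V
  /-- the projection onto the component of degree `n` -/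
  P : ℤ → Module.End k V.V
  /-- a finite set containing all degrees of nonzero components -/
  S : Finset ℤ
  linear_d : IsLinearOn ⊤ V V d
  linear_P : ∀ n, IsLinearOn ⊤ V V (P n)
  d_sq : d * d = 0
  P_d : ∀ n, P n * d = d * P (n + 1)
  P_sq : ∀ n, P n * P n = P n
  P_ne : ∀ m n, m ≠ n → P m * P n = 0
  sum_P : ∑ n ∈ S, P n = 1

namespace GradedDifferential

variable {V : Rep.{u} k G} (D : GradedDifferential V)

theorem d_P (n : ℤ) : D.d * D.P n = D.P (n - 1) * D.d := by
  rw [D.P_d, sub_add_cancel]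

theorem P_eq_zero {n : ℤ} (hn : n ∉ D.S) : D.P n = 0 := by
  rw [← mul_one (D.P n), ← D.sum_P, Finset.mul_sum]
  exact Finset.sum_eq_zero fun m hm => D.P_ne n m (fun h => hn (h ▸ hm))

/-- The homogeneous part of degree zero of a map. -/
def part (f : Module.End k V.V) : Module.End k V.V := ∑ n ∈ D.S, D.P n * f * D.P n

theorem P_part (n : ℤ) (f : Module.End k V.V) : D.P n * D.part f = D.part f * D.P n := by
  rw [part, Finset.mul_sum, Finset.sum_mul]
  refine Finset.sum_congr rfl fun m _ => ?_
  by_cases h : m = n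
  · subst h
    rw [← mul_assoc, ← mul_assoc, D.P_sq, mul_assoc _ (D.P m) (D.P m), D.P_sq]
  · rw [← mul_assoc, ← mul_assoc, D.P_ne n m (Ne.symm h), mul_assoc _ (D.P m) (D.P n),
      D.P_ne m n h]
    simp

theorem part_eq_self {f : Module.End k V.V} (hf : ∀ n, D.P n * f = f * D.P n) :
    D.part f = f := by
  rw [part, Finset.sum_congr rfl fun n _ => by rw [hf n, mul_assoc, D.P_sq], ← Finset.mul_sum,
    D.sum_P, mul_one]

theorem part_sub (f g : Module.End k V.V) : D.part (f - g) = D.part f - D.part g := by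
  simp only [part, mul_sub, sub_mul, Finset.sum_sub_distrib]

theorem part_add (f g : Module.End k V.V) : D.part (f + g) = D.part f + D.part g := by
  simp only [part, mul_add, add_mul, Finset.sum_add_distrib]

/-- The homogeneous part of degree one of a map. -/
def part₁ (f : Module.End k V.V) : Module.End k V.V :=
  -- Both `S` and its shift are included, so that `part₁ f * d` and `d * part₁ f` each compare with
  -- `part` by adding zero terms.
  ∑ n ∈ D.S ∪ D.S.image (· + 1), D.P n * f * D.P (n - 1)

theorem part₁_mul_d (f : Module.End k V.V) : D.part₁ f * D.d = D.part (f * D.d) := by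
  rw [part₁, Finset.sum_mul, part]
  symm
  refine Finset.sum_subset_zero_on_sdiff Finset.subset_union_left (fun n hn => ?_)
    (fun n _ => ?_)
  · rw [D.P_eq_zero (Finset.mem_sdiff.1 hn).2, zero_mul, zero_mul, zero_mul]
  · rw [mul_assoc _ (D.P (n - 1)), ← D.d_P, mul_assoc, mul_assoc, mul_assoc]

theorem d_mul_part₁ (f : Module.End k V.V) : D.d * D.part₁ f = D.part (D.d * f) := by
  rw [part₁, Finset.mul_sum, part]
  have h : ∑ n ∈ D.S, D.P n * (D.d * f) * D.P n =
      ∑ n ∈ D.S.image (· + 1), D.P (n - 1) * (D.d * f) * D.P (n - 1) := by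
    rw [Finset.sum_image fun _ _ _ _ h => add_right_cancel h]
    simp
  rw [h]
  symm
  refine Finset.sum_subset_zero_on_sdiff Finset.subset_union_right (fun n hn => ?_)
    (fun n _ => ?_)
  · have : n - 1 ∉ D.S := fun h => (Finset.mem_sdiff.1 hn).2
      (Finset.mem_image.2 ⟨n - 1, h, by ring⟩)
    rw [D.P_eq_zero this, mul_zero, mul_zero]
  · rw [← mul_assoc, ← mul_assoc, ← mul_assoc, D.d_P]

theorem linear_part₁ {Q : Subgroup G} {f : Module.End k V.V} (hf : IsLinearOn Q V V f) :
    IsLinearOn Q V V (D.part₁ f) :=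
  IsLinearOn.sum _ fun n _ => (((D.linear_P n).mono le_top).comp hf).comp
    ((D.linear_P (n - 1)).mono le_top)

/-- `f` is null-homotopic by a `Q`-linear homotopy. -/
def IsNullOn (Q : Subgroup G) (f : Module.End k V.V) : Prop :=
  ∃ s : Module.End k V.V, IsLinearOn Q V V s ∧ f = D.d * s + s * D.d

variable [Finite G]

theorem part_mem_traceIdeal {Q : Subgroup G} {f : Module.End k V.V}
    (hf : f ∈ traceIdeal Q V V) : D.part f ∈ traceIdeal Q V V :=
  Submodule.sum_mem _ fun n _ => comp_mem_traceIdeal_left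
    (comp_mem_traceIdeal_right ((D.linear_P n).mono le_top) hf) ((D.linear_P n).mono le_top)

/-- For `u` the trace of an `R`-linear `m`, and `f = d * s + s * d` over `R`, the relation `d * v =
0` gives `f * v * m = d * (s * v * m)`. Taking the trace from `R` to `Q` of both sides gives the
claim. -/
theorem exists_lift_of_traceIdeal {Q : Subgroup G} {f : Module.End k V.V}
    (hf : ∀ R < Q, D.IsNullOn R f) (hfQ : IsLinearOn Q V V f)
    {v w : Module.End k V.V} (hv : IsLinearOn Q V V v)
    (hdv : D.d * v = 0) {u : Module.End k V.V} (hu : u ∈ traceIdeal Q V V) :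
    ∃ t : Module.End k V.V, IsLinearOn Q V V t ∧ f * v * u * w = D.d * t * w := by
  let W : Submodule k (Module.End k V.V) :=
    { carrier := {u | ∃ t, IsLinearOn Q V V t ∧ f * v * u * w = D.d * t * w}
      add_mem' := by
        rintro a b ⟨s, hs, h1⟩ ⟨t, ht, h2⟩
        exact ⟨s + t, hs.add ht, by rw [mul_add, add_mul, h1, h2, mul_add, add_mul]⟩
      zero_mem' := ⟨0, IsLinearOn.zero, by simp⟩
      smul_mem' := by
        rintro c a ⟨s, hs, h1⟩
        exact ⟨c • s, hs.smul c, by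
          rw [mul_smul_comm, smul_mul_assoc, h1, mul_smul_comm, smul_mul_assoc]⟩ }
  suffices h : traceIdeal Q V V ≤ W from h hu
  refine traces_le_iff.2 fun R hR m hm => ?_
  obtain ⟨s, hs, hfs⟩ := hf R hR
  have hm' : IsLinearOn R V V m := isLinearOn_iff_mem_fixedPoints.2 hm
  have hsm : IsLinearOn R V V (s * v * m) := (hs.comp (hv.mono hR.le)).comp hm'
  refine ⟨traceSum (homRep V V) R Q (s * v * m), isLinearOn_iff_mem_fixedPoints.2
    (traceSum_mem (isLinearOn_iff_mem_fixedPoints.1 hsm)), ?_⟩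
  congr 1
  have h1 := map_traceSum (R := R) (isLinearOn_postcomp (L := V) (hfQ.comp hv)) m
  have h2 := map_traceSum (R := R) (isLinearOn_postcomp (L := V) (D.linear_d.mono
    (le_top (a := Q)))) (s * v * m)
  refine h1.trans (Eq.trans ?_ h2.symm)
  congr 1
  change f * v * m = D.d * (s * v * m)
  rw [hfs]
  calc (D.d * s + s * D.d) * v * m = D.d * (s * v * m) + s * (D.d * v) * m := by noncomm_ring
    _ = _ := by rw [hdv]; simp

/-- An idempotent chain endomorphism which is null-homotopic over all proper subgroups of `Q` and
`Q`-homotopic to a sum of proper traces is null-homotopic over `Q`. -/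
theorem isNullOn_of_lt {Q : Subgroup G} {e : Module.End k V.V} (he : IsLinearOn ⊤ V V e)
    (hde : D.d * e = e * D.d) (hee : e * e = e) (hPe : ∀ n, D.P n * e = e * D.P n)
    (ih : ∀ R < Q, D.IsNullOn R e)
    {u σ : Module.End k V.V} (hu : u ∈ traceIdeal Q V V) (hσ : IsLinearOn Q V V σ)
    (huσ : u = e - (D.d * σ + σ * D.d)) : D.IsNullOn Q e := by
  have heQ : IsLinearOn Q V V e := he.mono le_top
  have hdQ : IsLinearOn Q V V D.d := D.linear_d.mono le_top
  -- Since `e` and `d` are homogeneous, `u` and `σ` may be replaced by their parts of degree zero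
  -- and one.
  wlog hPu : ∀ n, D.P n * u = u * D.P n generalizing u σ
  · refine this (D.part_mem_traceIdeal hu) (D.linear_part₁ hσ) ?_ fun n => D.P_part n u
    rw [D.d_mul_part₁, D.part₁_mul_d, huσ, D.part_sub, D.part_add, D.part_eq_self hPe]
  have hdd := D.d_sq
  obtain ⟨a, ha⟩ : ∃ a : ℤ, ∀ n ∈ D.S, a ≤ n := by
    obtain ⟨a, ha⟩ := D.S.bddBelow
    exact ⟨a, fun n hn => ha hn⟩
  obtain ⟨b, hb⟩ : ∃ b : ℤ, ∀ n ∈ D.S, n < b := by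
    obtain ⟨b, hb⟩ := D.S.bddAbove
    exact ⟨b + 1, fun n hn => Int.lt_add_one_of_le (hb hn)⟩
  -- The homotopy is built upwards: the remainder `e - (d * s + s * d)` is made to vanish in all
  -- degrees below `n`.
  have key : ∀ n, a ≤ n → ∃ s : Module.End k V.V, IsLinearOn Q V V s ∧
      ∀ i < n, (e - (D.d * s + s * D.d)) * D.P i = 0 := by
    intro n hn
    induction n, hn using Int.leInduction with
    | base =>
      exact ⟨0, IsLinearOn.zero, fun i hi => by
        rw [D.P_eq_zero fun h => (ha i h).not_gt hi, mul_zero]⟩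
    | succ n _ IH =>
      obtain ⟨s, hs, hsv⟩ := IH
      set v := e - (D.d * s + s * D.d) with hv
      have hvQ : IsLinearOn Q V V v := heQ.sub ((hdQ.comp hs).add (hs.comp hdQ))
      have hdv : D.d * v = v * D.d := by
        calc D.d * v = D.d * e - (D.d * D.d) * s - D.d * s * D.d := by rw [hv]; noncomm_ring
          _ = e * D.d - D.d * s * D.d - s * (D.d * D.d) := by rw [hde, hdd]; simp
          _ = v * D.d := by rw [hv]; noncomm_ring
      -- `v` is a chain map vanishing in degree `n - 1`, so it sends degree `n` into the cycles.
      have hdvP : D.d * (v * D.P n) = 0 := by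
        rw [← mul_assoc, hdv, mul_assoc, D.d_P, ← mul_assoc, hsv _ (by omega), zero_mul]
      have hPn : IsLinearOn Q V V (D.P n) := (D.linear_P n).mono le_top
      obtain ⟨t, ht, htu⟩ := D.exists_lift_of_traceIdeal ih heQ (hvQ.comp hPn) hdvP hu
      have htu' : e * v * u * D.P n = D.d * (t * D.P n) := by
        calc e * v * u * D.P n = e * v * (u * (D.P n * D.P n)) := by
              rw [D.P_sq, mul_assoc (e * v)]
          _ = e * v * ((u * D.P n) * D.P n) := by rw [mul_assoc u]
          _ = e * (v * D.P n) * u * D.P n := by rw [← hPu]; noncomm_ring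
          _ = D.d * (t * D.P n) := by rw [← mul_assoc]; exact htu
      -- By idempotence, `e * s * e` leaves the remainder `e * v * e`; the term `e * v * σ` turns it
      -- into `e * v * u`; and `t * D.P n` cancels that in degree `n` without touching lower
      -- degrees.
      refine ⟨e * s * e + e * v * σ + t * D.P n,
        (((heQ.comp hs).comp heQ).add ((heQ.comp hvQ).comp hσ)).add (ht.comp hPn), ?_⟩
      have hv' : e - (D.d * (e * s * e + e * v * σ + t * D.P n) +
          (e * s * e + e * v * σ + t * D.P n) * D.d) =
          e * v * u - D.d * (t * D.P n) - t * D.P n * D.d := by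
        have h1 : e * e * e = e := by rw [hee, hee]
        have h2 : D.d * (e * s * e) + e * s * e * D.d = e * (e - v) * e := by
          calc D.d * (e * s * e) + e * s * e * D.d = (D.d * e) * s * e + e * s * (e * D.d) := by
                noncomm_ring
            _ = (e * D.d) * s * e + e * s * (D.d * e) :=
                congrArg₂ (fun x y => x * s * e + e * s * y) hde hde.symm
            _ = e * (D.d * s + s * D.d) * e := by noncomm_ring
            _ = _ := by rw [hv]; noncomm_ring
        have h3 : D.d * (e * v * σ) + e * v * σ * D.d = e * v * (e - u) := by
          calc D.d * (e * v * σ) + e * v * σ * D.d = (D.d * e) * v * σ + e * v * (σ * D.d) := by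
                noncomm_ring
            _ = e * (D.d * v) * σ + e * v * (σ * D.d) := by rw [hde]; noncomm_ring
            _ = e * v * (D.d * σ + σ * D.d) := by rw [hdv]; noncomm_ring
            _ = _ := by rw [huσ]; noncomm_ring
        calc _ = e - (D.d * (e * s * e) + e * s * e * D.d) -
              (D.d * (e * v * σ) + e * v * σ * D.d) - D.d * (t * D.P n) - t * D.P n * D.d := by
                noncomm_ring
          _ = e - (e * e * e - e * v * e) - (e * v * e - e * v * u) - D.d * (t * D.P n)
              - t * D.P n * D.d := by rw [h2, h3]; noncomm_ring
          _ = _ := by rw [h1]; abel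
      intro i hi
      rw [hv', sub_mul, sub_mul]
      have h4 : t * D.P n * D.d * D.P i = 0 := by
        rw [mul_assoc, D.d_P, mul_assoc, ← mul_assoc (D.P n), D.P_ne n (i - 1) (by omega)]
        simp
      rw [h4, sub_zero]
      rcases eq_or_ne i n with rfl | hin
      · rw [htu', mul_assoc, mul_assoc, D.P_sq, sub_self]
      · have h5 : v * D.P i = 0 := hsv i (by omega)
        have h6 : e * v * u * D.P i = e * (v * D.P i) * u := by
          rw [mul_assoc _ u, ← hPu]
          noncomm_ring
        rw [h6, h5, mul_assoc D.d, mul_assoc t, D.P_ne n i hin.symm]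
        simp
  -- An element of `S` ensures `a ≤ b`, as `key` requires; if `S` is empty, the module is zero.
  rcases D.S.eq_empty_or_nonempty with hS | ⟨c, hc⟩
  · have h1 : (1 : Module.End k V.V) = 0 := by rw [← D.sum_P, hS, Finset.sum_empty]
    exact ⟨0, IsLinearOn.zero, by rw [← one_mul e, h1]; simp⟩
  obtain ⟨s, hs, hsv⟩ := key b ((ha c hc).trans (hb c hc).le)
  refine ⟨s, hs, sub_eq_zero.1 ?_⟩
  rw [← mul_one (e - _), ← D.sum_P, Finset.mul_sum]
  exact Finset.sum_eq_zero fun n hn => hsv n (hb n hn)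

/-- An idempotent chain endomorphism which over each `p`-subgroup is homotopic to a sum of proper
traces is null-homotopic. -/
theorem isNullOn_top {p : ℕ} [Fact p.Prime] [CharP k p]
    {e : Module.End k V.V} (he : IsLinearOn ⊤ V V e)
    (hde : D.d * e = e * D.d) (hee : e * e = e) (hPe : ∀ n, D.P n * e = e * D.P n)
    (h : ∀ Q : Subgroup G, IsPGroup p Q → ∃ u σ : Module.End k V.V, u ∈ traceIdeal Q V V ∧
      IsLinearOn Q V V σ ∧ u = e - (D.d * σ + σ * D.d)) : D.IsNullOn ⊤ e := by
  have hp : ∀ Q : Subgroup G, IsPGroup p Q → D.IsNullOn Q e := by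
    intro Q
    induction Q using WellFoundedLT.induction with
    | ind Q ih =>
      intro hQ
      obtain ⟨u, σ, hu, hσ, huσ⟩ := h Q hQ
      exact D.isNullOn_of_lt he hde hee hPe (fun R hR => ih R hR (hQ.to_le hR.le)) hu hσ huσ
  -- The index of a Sylow subgroup is invertible in `k`, so a homotopy over it can be averaged to
  -- one over `G`.
  obtain ⟨S⟩ : Nonempty (Sylow p G) := inferInstance
  obtain ⟨s, hs, hes⟩ := hp S S.isPGroup'
  set R : Subgroup G := (S : Subgroup G)
  have hc : ((R.relIndex ⊤ : ℕ) : k) ≠ 0 := by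
    rw [Subgroup.relIndex_top_right]
    intro h0
    exact S.not_dvd_index ((CharP.cast_eq_zero_iff k p _).1 h0)
  refine ⟨((R.relIndex ⊤ : ℕ) : k)⁻¹ • traceSum (homRep V V) R ⊤ s, IsLinearOn.smul _
    (isLinearOn_iff_mem_fixedPoints.2 (traceSum_mem (isLinearOn_iff_mem_fixedPoints.1 hs))), ?_⟩
  have h1 : D.d * traceSum (homRep V V) R ⊤ s = traceSum (homRep V V) R ⊤ (D.d * s) :=
    map_traceSum (R := R) (isLinearOn_postcomp (L := V) D.linear_d) s
  have h2 : traceSum (homRep V V) R ⊤ s * D.d = traceSum (homRep V V) R ⊤ (s * D.d) :=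
    map_traceSum (R := R) (isLinearOn_precomp (N := V) D.linear_d) s
  rw [mul_smul_comm, smul_mul_assoc, ← smul_add]
  have h3 : D.d * traceSum (homRep V V) R ⊤ s + traceSum (homRep V V) R ⊤ s * D.d =
      traceSum (homRep V V) R ⊤ e := by
    rw [h1, h2]
    refine Eq.trans ?_ (congrArg _ hes.symm)
    exact (map_add (traceSum (homRep V V) R ⊤) (D.d * s) (s * D.d)).symm
  rw [h3]
  refine Eq.trans ?_ (congrArg _
    (traceSum_of_mem_fixedPoints (isLinearOn_iff_mem_fixedPoints.1 he)).symm)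
  exact (inv_smul_smul₀ hc e).symm

end GradedDifferential

end Rep

/-! ### Linear algebra of differential spaces over a field -/

namespace LinearMap

variable {k F : Type*} [Field k] [AddCommGroup F] [Module k F]

/-- If the homology of a differential space `(F, d)` is spanned by the class of `w`, detected by
the cocycle `φ₀`, then `F` contracts onto the line spanned by `w`. -/
theorem exists_contraction_onto_line {d : Module.End k F} (hd : d * d = 0) {w : F}
    {φ₀ : F →ₗ[k] k} (hφ : ∀ x, φ₀ (d x) = 0)
    (h : ∀ z, d z = 0 → z - φ₀ z • w ∈ range d) :
    ∃ (s : Module.End k F) (φ : F →ₗ[k] k), (∀ z, d z = 0 → φ z = φ₀ z) ∧ (∀ x, φ (d x) = 0) ∧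
      1 - (d * s + s * d) = φ.smulRight w := by
  obtain ⟨g₀, hg₀⟩ := d.rangeRestrict.exists_rightInverse_of_surjective d.range_rangeRestrict
  obtain ⟨g, hg⟩ := LinearMap.exists_extend g₀
  have hdg : ∀ b ∈ range d, d (g b) = b := fun b hb => by
    have h1 : g b = g₀ ⟨b, hb⟩ := LinearMap.congr_fun hg ⟨b, hb⟩
    rw [h1]
    exact congrArg Subtype.val (LinearMap.congr_fun hg₀ ⟨b, hb⟩)
  have hdd : ∀ x, d (d x) = 0 := fun x => LinearMap.congr_fun hd x
  have hdgd : ∀ x, d (g (d x)) = d x := fun x => hdg _ ⟨x, rfl⟩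
  -- As `g` is a section of `d` over its range, `1 - g * d` projects onto the cycles. Subtracting
  -- from a cycle its `φ₀`-multiple of `w` leaves a boundary, which `g` lifts.
  refine ⟨g * (1 - g * d - (φ₀ ∘ₗ (1 - g * d)).smulRight w), φ₀ ∘ₗ (1 - g * d), ?_, ?_, ?_⟩
  · intro z hz
    simp [hz]
  · intro x
    simp [hdd, hφ]
  · ext x
    have h1 : d (g (x - g (d x) - φ₀ (x - g (d x)) • w)) =
        x - g (d x) - φ₀ (x - g (d x)) • w :=
      hdg _ (h _ (by rw [map_sub, hdgd, sub_self]))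
    have h2 : φ₀ (d x - g (d (d x))) = 0 := by rw [hdd, map_zero, sub_zero, hφ]
    simp only [sub_apply, add_apply, Module.End.mul_apply, Module.End.one_apply, smulRight_apply,
      comp_apply] at h1 h2 ⊢
    rw [h1, h2, hdd, map_zero, zero_smul, sub_zero, sub_zero]
    abel

/-- Two vectors which are linearly independent modulo `B` have dual functionals vanishing
on `B`. -/
theorem exists_dual_pair (B : Submodule k F) {x y : F} (hx : x ∉ B)
    (hy : ∀ c : k, y - c • x ∉ B) :
    ∃ φ ψ : F →ₗ[k] k, (∀ b ∈ B, φ b = 0) ∧ (∀ b ∈ B, ψ b = 0) ∧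
      φ x = 1 ∧ φ y = 0 ∧ ψ x = 0 ∧ ψ y = 1 := by
  have aux : ∀ a b : F, a ∉ B ⊔ Submodule.span k {b} → ∃ φ : F →ₗ[k] k,
      (∀ c ∈ B, φ c = 0) ∧ φ a = 1 ∧ φ b = 0 := by
    intro a b hab
    obtain ⟨f, hfa, hf⟩ := Submodule.exists_le_ker_of_notMem hab
    refine ⟨(f a)⁻¹ • f, fun c hc => ?_, ?_, ?_⟩
    · rw [smul_apply, mem_ker.1 (hf (Submodule.mem_sup_left hc)), smul_zero]
    · rw [smul_apply, smul_eq_mul, inv_mul_cancel₀ hfa]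
    · rw [smul_apply, mem_ker.1 (hf (Submodule.mem_sup_right
        (Submodule.mem_span_singleton_self b))), smul_zero]
  have hxy : x ∉ B ⊔ Submodule.span k {y} := by
    intro h
    obtain ⟨b, hb, z, hz, hbz⟩ := Submodule.mem_sup.1 h
    obtain ⟨c, rfl⟩ := Submodule.mem_span_singleton.1 hz
    by_cases hc : c = 0
    · refine hx ?_
      rwa [← hbz, hc, zero_smul, add_zero]
    · refine hy c⁻¹ ?_
      rw [← hbz, smul_add, smul_smul, inv_mul_cancel₀ hc, one_smul]
      have := B.smul_mem (-c⁻¹) hb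
      convert this using 1
      module
  have hyx : y ∉ B ⊔ Submodule.span k {x} := by
    intro h
    obtain ⟨b, hb, z, hz, hbz⟩ := Submodule.mem_sup.1 h
    obtain ⟨c, rfl⟩ := Submodule.mem_span_singleton.1 hz
    refine hy c ?_
    rwa [← hbz, add_sub_cancel_right]
  obtain ⟨φ, h1, h2, h3⟩ := aux x y hxy
  obtain ⟨ψ, h4, h5, h6⟩ := aux y x hyx
  exact ⟨φ, ψ, h1, h4, h2, h3, h6, h5⟩

end LinearMap

/-! ### Total modules of complexes and their homology -/

namespace Rep

variable {k : Type u} [Field k] {G : Type v} [Group G]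

/-- The additive map from morphisms of `kG`-modules to `k`-linear maps. -/
def toLinearMapHom (M N : Rep.{u} k G) : (M ⟶ N) →+ (M.V →ₗ[k] N.V) where
  toFun f := f.hom.toLinearMap
  map_zero' := rfl
  map_add' _ _ := rfl

/-- A total module `V` of a chain complex of `kG`-modules with finitely many nonzero terms. -/
structure Totalization (C : ChainComplex (Rep.{u} k G) ℤ) where
  /-- the total module -/
  V : Rep.{u} k G
  /-- the inclusion of the term of degree `n` -/
  inc : ∀ n, C.X n ⟶ V
  /-- the projection to the term of degree `n` -/
  prj : ∀ n, V ⟶ C.X n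
  /-- a finite set containing the degrees of all nonzero terms -/
  S : Finset ℤ
  inc_prj_self : ∀ n, inc n ≫ prj n = 𝟙 (C.X n)
  inc_prj_ne : ∀ m n, m ≠ n → inc m ≫ prj n = 0
  sum_prj_inc : ∑ n ∈ S, prj n ≫ inc n = 𝟙 V

theorem exists_totalization (C : ChainComplex (Rep.{u} k G) ℤ) (S : Finset ℤ)
    (hS : ∀ n ∉ S, Limits.IsZero (C.X n)) : ∃ T : Totalization C, T.S = S := by
  classical
  have : Limits.HasFiniteBiproducts (Rep.{u} k G) := Abelian.hasFiniteBiproducts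
  let f : S → Rep.{u} k G := fun n => C.X n
  refine ⟨⟨⨁ f, fun n => if h : n ∈ S then Limits.biproduct.ι f ⟨n, h⟩ else 0,
    fun n => if h : n ∈ S then Limits.biproduct.π f ⟨n, h⟩ else 0, S, ?_, ?_, ?_⟩, rfl⟩
  · intro n
    by_cases h : n ∈ S
    · rw [dif_pos h, dif_pos h]
      exact Limits.biproduct.ι_π_self f ⟨n, h⟩
    · exact (hS n h).eq_of_src _ _
  · intro m n hmn
    by_cases hm : m ∈ S
    · by_cases hn : n ∈ S
      · rw [dif_pos hm, dif_pos hn]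
        exact Limits.biproduct.ι_π_ne f fun h => hmn (congrArg Subtype.val h)
      · exact (hS n hn).eq_of_tgt _ _
    · exact (hS m hm).eq_of_src _ _
  · rw [← Limits.biproduct.total (f := f), ← Finset.sum_coe_sort]
    refine Finset.sum_congr rfl fun n _ => ?_
    rw [dif_pos n.2, dif_pos n.2]

namespace Totalization

variable {C : ChainComplex (Rep.{u} k G) ℤ} (T : Totalization C)

theorem inc_prj_self_assoc (n : ℤ) {Z : Rep.{u} k G} (f : C.X n ⟶ Z) :
    T.inc n ≫ T.prj n ≫ f = f := by
  rw [← Category.assoc, T.inc_prj_self, Category.id_comp]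

theorem inc_prj_ne_assoc (m n : ℤ) (h : m ≠ n) {Z : Rep.{u} k G} (f : C.X n ⟶ Z) :
    T.inc m ≫ T.prj n ≫ f = 0 := by
  rw [← Category.assoc, T.inc_prj_ne m n h, Limits.zero_comp]

theorem hom_ext_inc {X : Rep.{u} k G} {f g : T.V ⟶ X} (h : ∀ n, T.inc n ≫ f = T.inc n ≫ g) :
    f = g := by
  rw [← Category.id_comp f, ← Category.id_comp g, ← T.sum_prj_inc, Preadditive.sum_comp,
    Preadditive.sum_comp]
  exact Finset.sum_congr rfl fun n _ => by rw [Category.assoc, h, Category.assoc]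

theorem inc_eq_zero {n : ℤ} (hn : n ∉ T.S) : T.inc n = 0 := by
  rw [← Category.comp_id (T.inc n), ← T.sum_prj_inc, Preadditive.comp_sum]
  exact Finset.sum_eq_zero fun m hm => by
    rw [T.inc_prj_ne_assoc n m (fun h => hn (h ▸ hm))]

/-- A morphism out of the total module is determined by a family of morphisms. -/
def desc {X : Rep.{u} k G} (f : ∀ n, C.X n ⟶ X) : T.V ⟶ X := ∑ n ∈ T.S, T.prj n ≫ f n

theorem inc_desc {X : Rep.{u} k G} (f : ∀ n, C.X n ⟶ X) (n : ℤ) : T.inc n ≫ T.desc f = f n := by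
  rw [desc, Preadditive.comp_sum]
  by_cases hn : n ∈ T.S
  · rw [Finset.sum_eq_single n, T.inc_prj_self_assoc]
    · exact fun m _ hm => by rw [T.inc_prj_ne_assoc n m hm.symm]
    · exact fun h => absurd hn h
  · rw [T.inc_eq_zero hn]
    have : f n = 0 := by
      rw [← Category.id_comp (f n), ← T.inc_prj_self n, T.inc_eq_zero hn, Limits.zero_comp,
        Limits.zero_comp]
    rw [this]
    simp

theorem inc_desc_assoc {X Y : Rep.{u} k G} (f : ∀ n, C.X n ⟶ X) (n : ℤ) (g : X ⟶ Y) :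
    T.inc n ≫ T.desc f ≫ g = f n ≫ g := by
  rw [← Category.assoc, T.inc_desc]

/-- The differential of the total module. -/
def d : T.V ⟶ T.V := T.desc fun n => C.d n (n - 1) ≫ T.inc (n - 1)

theorem inc_d (n : ℤ) : T.inc n ≫ T.d = C.d n (n - 1) ≫ T.inc (n - 1) := T.inc_desc _ n

theorem inc_d_assoc (n : ℤ) {X : Rep.{u} k G} (f : T.V ⟶ X) :
    T.inc n ≫ T.d ≫ f = C.d n (n - 1) ≫ T.inc (n - 1) ≫ f := by
  rw [← Category.assoc, T.inc_d, Category.assoc]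

theorem d_prj (n : ℤ) : T.d ≫ T.prj n = T.prj (n + 1) ≫ C.d (n + 1) n := by
  refine T.hom_ext_inc fun m => ?_
  rw [T.inc_d_assoc]
  by_cases h : m = n + 1
  · subst h
    rw [T.inc_prj_self_assoc, add_sub_cancel_right, T.inc_prj_self, Category.comp_id]
  · rw [T.inc_prj_ne_assoc _ _ h, T.inc_prj_ne _ _ (fun h' => h (by omega)), Limits.comp_zero]

theorem d_prj_assoc (n : ℤ) {X : Rep.{u} k G} (f : C.X n ⟶ X) :
    T.d ≫ T.prj n ≫ f = T.prj (n + 1) ≫ C.d (n + 1) n ≫ f := by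
  rw [← Category.assoc, T.d_prj, Category.assoc]

theorem d_d : T.d ≫ T.d = 0 := T.hom_ext_inc fun n => by
  rw [T.inc_d_assoc, T.inc_d, C.d_comp_d_assoc, Limits.zero_comp, Limits.comp_zero]

/-- The total module as a module with differential and grading. -/
def graded : GradedDifferential T.V where
  d := T.d.hom.toLinearMap
  P n := (T.prj n ≫ T.inc n).hom.toLinearMap
  S := T.S
  linear_d := IsLinearOn.of_hom _
  linear_P _ := IsLinearOn.of_hom _
  d_sq := congrArg (fun f : T.V ⟶ T.V => f.hom.toLinearMap) T.d_d
  P_d n := by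
    have : T.d ≫ T.prj n ≫ T.inc n = (T.prj (n + 1) ≫ T.inc (n + 1)) ≫ T.d := by
      rw [T.d_prj_assoc, Category.assoc, T.inc_d, add_sub_cancel_right]
    exact congrArg (fun f : T.V ⟶ T.V => f.hom.toLinearMap) this
  P_sq n := by
    have : (T.prj n ≫ T.inc n) ≫ T.prj n ≫ T.inc n = T.prj n ≫ T.inc n := by
      rw [Category.assoc, T.inc_prj_self_assoc]
    exact congrArg (fun f : T.V ⟶ T.V => f.hom.toLinearMap) this
  P_ne m n hmn := by
    have : (T.prj n ≫ T.inc n) ≫ T.prj m ≫ T.inc m = 0 := by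
      rw [Category.assoc, T.inc_prj_ne_assoc n m hmn.symm, Limits.comp_zero]
    exact congrArg (fun f : T.V ⟶ T.V => f.hom.toLinearMap) this
  sum_P := by
    have := congrArg (toLinearMapHom T.V T.V) T.sum_prj_inc
    rwa [map_sum] at this

@[simp]
theorem graded_d_inc (n : ℤ) (x : (C.X n).V) :
    T.graded.d ((T.inc n).hom x) = (T.inc (n - 1)).hom ((C.d n (n - 1)).hom x) :=
  congrArg (fun f : C.X n ⟶ T.V => f.hom x) (T.inc_d n)

theorem prj_graded_d (n : ℤ) (x : T.V.V) :
    (T.prj n).hom (T.graded.d x) = (C.d (n + 1) n).hom ((T.prj (n + 1)).hom x) :=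
  congrArg (fun f : T.V ⟶ C.X n => f.hom x) (T.d_prj n)

theorem prj_inc_self (n : ℤ) (x : (C.X n).V) : (T.prj n).hom ((T.inc n).hom x) = x :=
  congrArg (fun f : C.X n ⟶ C.X n => f.hom x) (T.inc_prj_self n)

theorem prj_inc_ne {m n : ℤ} (h : m ≠ n) (x : (C.X m).V) : (T.prj n).hom ((T.inc m).hom x) = 0 :=
  congrArg (fun f : C.X m ⟶ C.X n => f.hom x) (T.inc_prj_ne m n h)

theorem sum_inc_prj (x : T.V.V) : ∑ n ∈ T.S, (T.inc n).hom ((T.prj n).hom x) = x := by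
  have := LinearMap.congr_fun T.graded.sum_P x
  rwa [LinearMap.sum_apply] at this

theorem prj_eq_zero {n : ℤ} (hn : n ∉ T.S) (x : T.V.V) : (T.prj n).hom x = 0 := by
  rw [← T.prj_inc_self n ((T.prj n).hom x), T.inc_eq_zero hn]
  exact map_zero (T.prj n).hom

theorem ext_prj {x y : T.V.V} (h : ∀ n, (T.prj n).hom x = (T.prj n).hom y) : x = y := by
  rw [← T.sum_inc_prj x, ← T.sum_inc_prj y]
  exact Finset.sum_congr rfl fun n _ => by rw [h]

end Totalization

theorem _root_.CategoryTheory.ShortComplex.exists_moduleCat_homology_presentation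
    (L : ShortComplex (ModuleCat.{u} k)) {H : ModuleCat.{u} k} (e : L.homology ≅ H) :
    ∃ q : LinearMap.ker L.g.hom →ₗ[k] H,
      Function.Surjective q ∧ ∀ z, q z = 0 ↔ ∃ y, L.f.hom y = z.1 := by
  let e' : (LinearMap.ker L.g.hom ⧸ LinearMap.range L.moduleCatToCycles) ≃ₗ[k] H :=
    (L.moduleCatHomologyIso.symm ≪≫ e).toLinearEquiv
  refine ⟨e'.toLinearMap ∘ₗ (LinearMap.range L.moduleCatToCycles).mkQ,
    e'.surjective.comp (Submodule.mkQ_surjective _), fun z => ?_⟩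
  refine e'.map_eq_zero_iff.trans ((Submodule.Quotient.mk_eq_zero _).trans ⟨?_, ?_⟩)
  · rintro ⟨y, hy⟩
    exact ⟨y, congrArg Subtype.val hy⟩
  · rintro ⟨y, hy⟩
    exact ⟨y, Subtype.ext hy⟩

/-- The homology of a complex of `kG`-modules as a quotient of the cycles. -/
theorem exists_homology_presentation (C : ChainComplex (Rep.{u} k G) ℤ) (j : ℤ) :
    ∃ q : LinearMap.ker (C.d j (j - 1)).hom.toLinearMap →ₗ[k] (C.homology j).V,
      Function.Surjective q ∧ ∀ z, q z = 0 ↔ ∃ y, (C.d (j + 1) j).hom y = z.1 := by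
  let F := forget₂ (Rep.{u} k G) (ModuleCat.{u} k)
  let S := C.sc' (j + 1) j (j - 1)
  let e₁ : C.homology j ≅ S.homology := ShortComplex.homologyMapIso
    (C.isoSc' (j + 1) j (j - 1) (by simp) (by simp))
  -- The forgetful functor to `k`-modules preserves homology, so cycles modulo boundaries can be
  -- taken there.
  exact (S.map F).exists_moduleCat_homology_presentation
    (S.mapHomologyIso F ≪≫ F.mapIso e₁.symm)

variable {E : ChainComplex (Rep.{u} k G) ℤ} (T : Totalization E)

/-- If the homology of a complex is a line, it is spanned by a homogeneous cycle and detected by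
a cocycle on the total module. -/
theorem Totalization.exists_generator {i : ℤ} (hi : Module.finrank k (E.homology i).V = 1)
    (hE : ∀ j, j ≠ i → Limits.IsZero (E.homology j)) :
    ∃ (w : (E.X i).V) (φ : T.V.V →ₗ[k] k), (∀ x, φ (T.graded.d x) = 0) ∧
      T.graded.d ((T.inc i).hom w) = 0 ∧ φ ((T.inc i).hom w) = 1 ∧
      ∀ z, T.graded.d z = 0 → z - φ z • (T.inc i).hom w ∈ LinearMap.range T.graded.d := by
  obtain ⟨q, hq, hq0⟩ := exists_homology_presentation E i
  obtain ⟨v, hv0, hv⟩ := finrank_eq_one_iff'.1 hi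
  obtain ⟨w, rfl⟩ := hq v
  have hdw : (E.d i (i - 1)).hom w.1 = 0 := w.2
  have hdw' : T.graded.d ((T.inc i).hom w.1) = 0 := by
    rw [T.graded_d_inc, hdw]
    exact map_zero _
  have hw : (T.inc i).hom w.1 ∉ LinearMap.range T.graded.d := by
    rintro ⟨y, hy⟩
    refine hv0 ((hq0 w).2 ⟨(T.prj (i + 1)).hom y, ?_⟩)
    rw [← T.prj_graded_d, hy, T.prj_inc_self]
  obtain ⟨φ, hφw, hφ⟩ := Submodule.exists_le_ker_of_notMem hw
  -- Each homogeneous component of a cycle is a cycle: in degree `i` it is a multiple of `w` modulo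
  -- boundaries, elsewhere it is a boundary.
  have hcyc : ∀ z, T.graded.d z = 0 → ∃ c : k,
      z - c • (T.inc i).hom w.1 ∈ LinearMap.range T.graded.d := by
    intro z hz
    have hzn : ∀ n, (E.d n (n - 1)).hom ((T.prj n).hom z) = 0 := by
      intro n
      have h1 := T.prj_graded_d (n - 1) z
      rw [hz] at h1
      have h2 : ∀ m, m = n → (E.d m (n - 1)).hom ((T.prj m).hom z) = 0 →
          (E.d n (n - 1)).hom ((T.prj n).hom z) = 0 := by
        rintro m rfl h
        exact h
      exact h2 _ (sub_add_cancel n 1) (h1.symm.trans (map_zero _))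
    have hmem : ∀ (n : ℤ) (x : (E.X n).V), (∃ y, (E.d (n + 1) n).hom y = x) →
        (T.inc n).hom x ∈ LinearMap.range T.graded.d := by
      rintro n _ ⟨y, rfl⟩
      refine ⟨(T.inc (n + 1)).hom y, T.ext_prj fun m => ?_⟩
      rw [T.prj_graded_d]
      by_cases h : m = n
      · subst h
        rw [T.prj_inc_self, T.prj_inc_self]
      · rw [T.prj_inc_ne (fun h' => h (by omega)), T.prj_inc_ne (Ne.symm h), map_zero]
    obtain ⟨c, hc⟩ := hv (q ⟨(T.prj i).hom z, hzn i⟩)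
    have hj : ∀ j, j ≠ i → (T.inc j).hom ((T.prj j).hom z) ∈ LinearMap.range T.graded.d := by
      intro j hj
      obtain ⟨q', -, hq'⟩ := exists_homology_presentation E j
      have := (isZero_iff k G _).1 (hE j hj)
      exact hmem j _ ((hq' ⟨(T.prj j).hom z, hzn j⟩).1 (Subsingleton.elim _ _))
    have hi' : (T.inc i).hom ((T.prj i).hom z) - c • (T.inc i).hom w.1 ∈
        LinearMap.range T.graded.d := by
      have := hmem i ((T.prj i).hom z - c • w.1) ((hq0 (⟨(T.prj i).hom z, hzn i⟩ - c • w)).1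
        (by rw [map_sub, map_smul, hc, sub_self]))
      rwa [map_sub, map_smul] at this
    refine ⟨c, ?_⟩
    have hsum : z = (T.inc i).hom ((T.prj i).hom z) +
        ∑ n ∈ T.S.erase i, (T.inc n).hom ((T.prj n).hom z) := by
      conv_lhs => rw [← T.sum_inc_prj z]
      by_cases h : i ∈ T.S
      · exact (Finset.add_sum_erase T.S (fun n => (T.inc n).hom ((T.prj n).hom z)) h).symm
      · rw [Finset.erase_eq_of_notMem h, T.inc_eq_zero h]
        exact (zero_add _).symm
    have h3 := Submodule.add_mem _ hi' (Submodule.sum_mem (LinearMap.range T.graded.d)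
      (t := T.S.erase i) fun n hn => hj n (Finset.ne_of_mem_erase hn))
    rwa [sub_add_eq_add_sub, ← hsum] at h3
  have hφd : ∀ x, φ (T.graded.d x) = 0 := fun x => LinearMap.mem_ker.1 (hφ ⟨x, rfl⟩)
  refine ⟨w.1, (φ ((T.inc i).hom w.1))⁻¹ • φ, fun x => ?_, hdw', ?_, fun z hz => ?_⟩
  · rw [LinearMap.smul_apply, hφd, smul_zero]
  · rw [LinearMap.smul_apply, smul_eq_mul, inv_mul_cancel₀ hφw]
  · obtain ⟨c, y, hc⟩ := hcyc z hz
    have h4 : φ z = c * φ ((T.inc i).hom w.1) := by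
      have := hφd y
      rw [hc, map_sub, map_smul, sub_eq_zero, smul_eq_mul] at this
      exact this
    rw [LinearMap.smul_apply, smul_eq_mul, h4, mul_comm c, inv_mul_cancel_left₀ hφw]
    exact ⟨y, hc⟩

/-- If the total module of a complex is not contractible and its homology does not contain two
linearly independent classes, then the homology is a line. -/
theorem Totalization.exists_finrank_homology_eq_one
    (h₁ : ∀ s : Module.End k T.V.V, 1 ≠ T.graded.d * s + s * T.graded.d)
    (h₂ : ∀ (x y : T.V.V) (φ ψ : T.V.V →ₗ[k] k), T.graded.d x = 0 → T.graded.d y = 0 →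
      (∀ v, φ (T.graded.d v) = 0) → (∀ v, ψ (T.graded.d v) = 0) →
      φ x = 1 → φ y = 0 → ψ x = 0 → ψ y ≠ 1) :
    ∃ i, Module.finrank k (E.homology i).V = 1 ∧
      ∀ j, j ≠ i → Limits.IsZero (E.homology j) := by
  have hdep : ∀ x y, T.graded.d x = 0 → T.graded.d y = 0 → x ∉ LinearMap.range T.graded.d →
      ∃ c : k, y - c • x ∈ LinearMap.range T.graded.d := by
    intro x y hx hy hxB
    by_contra! hc
    obtain ⟨φ, ψ, hφ, hψ, h3, h4, h5, h6⟩ := LinearMap.exists_dual_pair _ hxB hc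
    exact h₂ x y φ ψ hx hy (fun v => hφ _ ⟨v, rfl⟩) (fun v => hψ _ ⟨v, rfl⟩) h3 h4 h5 h6
  obtain ⟨x, hx, hxB⟩ : ∃ x, T.graded.d x = 0 ∧ x ∉ LinearMap.range T.graded.d := by
    by_contra! hc
    -- If all cycles were boundaries, the contraction with zero vector and zero functional would
    -- contradict `h₁`.
    obtain ⟨s, φ, -, -, hs⟩ := LinearMap.exists_contraction_onto_line T.graded.d_sq (w := 0)
      (φ₀ := 0) (fun _ => rfl) (fun z hz => by simpa using hc z hz)
    refine h₁ s (sub_eq_zero.1 (hs.trans ?_))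
    ext v
    simp
  have hcyc : ∀ n, (E.d n (n - 1)).hom ((T.prj n).hom x) = 0 := by
    intro n
    have h1 := T.prj_graded_d (n - 1) x
    rw [hx] at h1
    have h2 : ∀ m, m = n → (E.d m (n - 1)).hom ((T.prj m).hom x) = 0 →
        (E.d n (n - 1)).hom ((T.prj n).hom x) = 0 := by
      rintro m rfl h
      exact h
    exact h2 _ (sub_add_cancel n 1) (h1.symm.trans (map_zero _))
  have hinc : ∀ (n : ℤ) (z : (E.X n).V), (E.d n (n - 1)).hom z = 0 →
      T.graded.d ((T.inc n).hom z) = 0 := by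
    intro n z hz
    rw [T.graded_d_inc, hz]
    exact map_zero _
  -- Some homogeneous component of `x` is not a boundary; its degree is where the homology is
  -- concentrated.
  obtain ⟨i, hi⟩ : ∃ i, (T.inc i).hom ((T.prj i).hom x) ∉ LinearMap.range T.graded.d := by
    by_contra! hc
    refine hxB ?_
    rw [← T.sum_inc_prj x]
    exact Submodule.sum_mem _ fun n _ => hc n
  set w : (E.X i).V := (T.prj i).hom x
  have hexact : ∀ (n : ℤ) (z : (E.X n).V), (T.inc n).hom z ∈ LinearMap.range T.graded.d →
      ∃ y, (E.d (n + 1) n).hom y = z := by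
    rintro n z ⟨y, hy⟩
    exact ⟨(T.prj (n + 1)).hom y, by rw [← T.prj_graded_d, hy, T.prj_inc_self]⟩
  have hmem : ∀ (n : ℤ) (z : (E.X n).V), (∃ y, (E.d (n + 1) n).hom y = z) →
      (T.inc n).hom z ∈ LinearMap.range T.graded.d := by
    rintro n _ ⟨y, rfl⟩
    refine ⟨(T.inc (n + 1)).hom y, T.ext_prj fun m => ?_⟩
    rw [T.prj_graded_d]
    by_cases h : m = n
    · subst h
      rw [T.prj_inc_self, T.prj_inc_self]
    · rw [T.prj_inc_ne (fun h' => h (by omega)), T.prj_inc_ne (Ne.symm h), map_zero]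
  refine ⟨i, ?_, fun j hji => ?_⟩
  · obtain ⟨q, hq, hq0⟩ := exists_homology_presentation E i
    refine finrank_eq_one_iff'.2 ⟨q ⟨w, hcyc i⟩, fun h => hi (hmem i _ ((hq0 _).1 h)), fun v => ?_⟩
    obtain ⟨z, rfl⟩ := hq v
    obtain ⟨c, hc⟩ := hdep _ _ (hinc i w (hcyc i)) (hinc i z.1 z.2) hi
    rw [← map_smul, ← map_sub] at hc
    refine ⟨c, ?_⟩
    have := (hq0 (z - c • ⟨w, hcyc i⟩)).2 (hexact i _ hc)
    rw [map_sub, map_smul, sub_eq_zero] at this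
    exact this.symm
  · obtain ⟨q, hq, hq0⟩ := exists_homology_presentation E j
    refine (isZero_iff k G _).2 ⟨fun a b => ?_⟩
    have hzero : ∀ v : (E.homology j).V, v = 0 := by
      intro v
      obtain ⟨z, rfl⟩ := hq v
      obtain ⟨c, y, hc⟩ := hdep _ _ (hinc i w (hcyc i)) (hinc j z.1 z.2) hi
      -- A cycle of degree `j` is a multiple of `w` modulo boundaries, and projecting to degree `j ≠
      -- i` kills that multiple.
      refine (hq0 z).2 ⟨(T.prj (j + 1)).hom y, ?_⟩
      rw [← T.prj_graded_d, hc, map_sub, map_smul, T.prj_inc_self, T.prj_inc_ne hji.symm,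
        smul_zero, sub_zero]
    rw [hzero a, hzero b]

end Rep

/-! ### Signs, evaluation and coevaluation on `M* ⊗ M` -/

namespace Rep

variable {k : Type u} [Field k] {G : Type v} [Group G]

namespace GradedDifferential

variable {M : Rep.{u} k G} (D : GradedDifferential M)

/-- The grading automorphism, which is multiplication by `(-1)^n` in degree `n`. -/
def sign : Module.End k M.V := ∑ n ∈ D.S, ((n.negOnePow : ℤ) : k) • D.P n

theorem sign_mul_P (n : ℤ) : D.sign * D.P n = ((n.negOnePow : ℤ) : k) • D.P n := by
  rw [sign, Finset.sum_mul]
  by_cases hn : n ∈ D.S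
  · rw [Finset.sum_eq_single n, smul_mul_assoc, D.P_sq]
    · exact fun m _ hm => by rw [smul_mul_assoc, D.P_ne m n hm, smul_zero]
    · exact fun h => absurd hn h
  · rw [D.P_eq_zero hn, smul_zero]
    simp

theorem P_mul_sign (n : ℤ) : D.P n * D.sign = ((n.negOnePow : ℤ) : k) • D.P n := by
  rw [sign, Finset.mul_sum]
  by_cases hn : n ∈ D.S
  · rw [Finset.sum_eq_single n, mul_smul_comm, D.P_sq]
    · exact fun m _ hm => by rw [mul_smul_comm, D.P_ne n m hm.symm, smul_zero]
    · exact fun h => absurd hn h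
  · rw [D.P_eq_zero hn, smul_zero]
    simp

theorem ext_mul_P {f g : Module.End k M.V} (h : ∀ n, f * D.P n = g * D.P n) : f = g := by
  rw [← mul_one f, ← mul_one g, ← D.sum_P, Finset.mul_sum, Finset.mul_sum]
  exact Finset.sum_congr rfl fun n _ => h n

theorem negOnePow_cast_mul_self (n : ℤ) :
    ((n.negOnePow : ℤ) : k) * ((n.negOnePow : ℤ) : k) = 1 := by
  rw [← Int.cast_mul, ← Units.val_mul, Int.units_mul_self, Units.val_one, Int.cast_one]

theorem negOnePow_cast_sub_one (n : ℤ) :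
    (((n - 1).negOnePow : ℤ) : k) = -((n.negOnePow : ℤ) : k) := by
  rw [Int.negOnePow_sub, Int.negOnePow_one]
  simp

theorem sign_sq : D.sign * D.sign = 1 := D.ext_mul_P fun n => by
  rw [mul_assoc, sign_mul_P, mul_smul_comm, sign_mul_P, smul_smul, negOnePow_cast_mul_self,
    one_smul, one_mul]

theorem sign_mul_d : D.sign * D.d = -(D.d * D.sign) := D.ext_mul_P fun n => by
  rw [mul_assoc, d_P, ← mul_assoc, sign_mul_P, neg_mul, mul_assoc, sign_mul_P,
    negOnePow_cast_sub_one, smul_mul_assoc, mul_smul_comm, d_P, neg_smul]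

theorem sign_mul_part₁ (f : Module.End k M.V) :
    D.sign * D.part₁ f = -(D.part₁ f * D.sign) := by
  rw [part₁, Finset.mul_sum, Finset.sum_mul, ← Finset.sum_neg_distrib]
  refine Finset.sum_congr rfl fun n _ => ?_
  rw [← mul_assoc, ← mul_assoc, sign_mul_P, mul_assoc _ (D.P (n - 1)), P_mul_sign,
    negOnePow_cast_sub_one, smul_mul_assoc, smul_mul_assoc, mul_smul_comm, neg_smul, neg_neg]

theorem linear_sign : IsLinearOn ⊤ M M D.sign :=
  IsLinearOn.sum _ fun n _ => (D.linear_P n).smul _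

end GradedDifferential

/-- The transpose of an endomorphism. -/
abbrev dualEnd {V : Type*} [AddCommGroup V] [Module k V] (f : Module.End k V) :
    Module.End k (Module.Dual k V) := Module.Dual.transpose (R := k) f

theorem dualEnd_mul {V : Type*} [AddCommGroup V] [Module k V] (f g : Module.End k V) :
    dualEnd f * dualEnd g = dualEnd (g * f) := rfl

/-- Operators on `V* ⊗ V` become two-sided multiplications on `End V`, where identities about `coev`
are checked. -/
theorem dualTensorHom_map {V : Type*} [AddCommGroup V] [Module k V] (f g : Module.End k V)
    (x : TensorProduct k (Module.Dual k V) V) :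
    dualTensorHom k V V (TensorProduct.map (dualEnd f) g x) = g * dualTensorHom k V V x * f := by
  induction x using TensorProduct.induction_on with
  | zero => simp
  | add x y hx hy => simp only [map_add, hx, hy, mul_add, add_mul]
  | tmul φ v =>
    ext w
    simp [dualTensorHom_apply, Module.Dual.transpose_apply]

/-- The `kG`-module `M* ⊗ M`. -/
abbrev dualTensor (M : Rep.{u} k G) : Rep.{u} k G := dualObj M ⊗ M

theorem isLinearOn_contractLeft (M : Rep.{u} k G) (Q : Subgroup G) :
    IsLinearOn Q (dualTensor M) (Rep.trivial k G k) (contractLeft k M.V) := fun g hg x => by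
  induction x using TensorProduct.induction_on with
  | zero => simp
  | add x y hx hy => simp only [map_add, hx, hy]
  | tmul φ v =>
    change φ (M.ρ g⁻¹ (M.ρ g v)) = φ v
    rw [M.ρ.inv_self_apply]

namespace GradedDifferential

theorem dualTensorHom_injective {M : Rep.{u} k G} [Module.Finite k M.V] :
    Function.Injective (dualTensorHom k M.V M.V) := (dualTensorHomEquiv k M.V M.V).injective

variable {M : Rep.{u} k G} (D : GradedDifferential M)

/-- The differential of `M* ⊗ M`. -/
def tensorD : Module.End k (dualTensor M).V :=
  TensorProduct.map (dualEnd (D.d * D.sign)) 1 + TensorProduct.map (dualEnd D.sign) D.d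

theorem sign_mul_d_mul_sign : D.sign * D.d * D.sign = -D.d := by
  rw [sign_mul_d, neg_mul, mul_assoc, sign_sq, mul_one]

theorem contractLeft_tensorD (x : (dualTensor M).V) : contractLeft k M.V (D.tensorD x) = 0 := by
  induction x using TensorProduct.induction_on with
  | zero => simp
  | add x y hx hy => rw [map_add, map_add, hx, hy, add_zero]
  | tmul φ v =>
    have h : φ (D.d (D.sign v)) + φ (D.sign (D.d v)) = 0 := by
      have := LinearMap.congr_fun D.sign_mul_d v
      rw [← map_add]
      change φ (D.d (D.sign v) + (D.sign * D.d) v) = 0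
      rw [this]
      simp
    exact (map_add (contractLeft k M.V) _ _).trans h

theorem linear_tensorD : IsLinearOn ⊤ (dualTensor M) (dualTensor M) D.tensorD :=
  ((IsLinearOn.dual (D.linear_d.comp D.linear_sign)).tensor IsLinearOn.id).add
    ((IsLinearOn.dual D.linear_sign).tensor D.linear_d)

section

variable [Module.Finite k M.V]

/-- The element of `M* ⊗ M` corresponding to the grading automorphism of `M`. -/
def coev : (dualTensor M).V := (dualTensorHomEquiv k M.V M.V).symm D.sign

theorem dualTensorHom_coev : dualTensorHom k M.V M.V D.coev = D.sign :=
  (dualTensorHomEquiv k M.V M.V).apply_symm_apply D.sign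

/-- On `End M` the differential reads `f ↦ f * d * sign + d * f * sign`. At `f = sign` the two terms
are `-d` and `d`; this is why `coev` is the grading automorphism and not the identity. -/
theorem tensorD_coev : D.tensorD D.coev = 0 := by
  apply dualTensorHom_injective
  rw [tensorD, LinearMap.add_apply, map_add, dualTensorHom_map, dualTensorHom_map,
    dualTensorHom_coev, map_zero, one_mul, ← mul_assoc, sign_mul_d_mul_sign, mul_assoc, sign_sq,
    mul_one, neg_add_cancel]

theorem coev_mem_fixedPoints (Q : Subgroup G) : D.coev ∈ fixedPoints (dualTensor M) Q := by
  refine mem_fixedPoints.2 fun g hg => dualTensorHom_injective ?_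
  have h : (dualTensor M).ρ g D.coev =
      TensorProduct.map (dualEnd (M.ρ g⁻¹)) (M.ρ g) D.coev := rfl
  rw [h, dualTensorHom_map, dualTensorHom_coev]
  ext m
  change M.ρ g (D.sign (M.ρ g⁻¹ m)) = D.sign m
  rw [← D.linear_sign g (Subgroup.mem_top g), M.ρ.self_inv_apply]

/-- This scalar is the supertrace of the identity. When its square is one, evaluation and
coevaluation split off a copy of `k`. -/
theorem contractLeft_coev : contractLeft k M.V D.coev = LinearMap.trace k M.V D.sign := by
  rw [← LinearMap.trace_eq_contract_apply, dualTensorHom_coev]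

/-- The complement of the evaluation-coevaluation idempotent of `M* ⊗ M`. -/
def evCompl : Module.End k (dualTensor M).V :=
  1 - LinearMap.trace k M.V D.sign • (contractLeft k M.V).smulRight D.coev

theorem evCompl_apply (x : (dualTensor M).V) : D.evCompl x =
    x - (LinearMap.trace k M.V D.sign * contractLeft k M.V x) • D.coev := by
  rw [mul_smul]
  rfl

theorem linear_evCompl : IsLinearOn ⊤ (dualTensor M) (dualTensor M) D.evCompl := fun g hg x => by
  rw [evCompl_apply, evCompl_apply, map_sub, map_smul,
    mem_fixedPoints.1 (D.coev_mem_fixedPoints ⊤) g hg, isLinearOn_contractLeft M ⊤ g hg]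
  rfl

theorem tensorD_mul_evCompl : D.tensorD * D.evCompl = D.evCompl * D.tensorD := by
  ext1 x
  rw [Module.End.mul_apply, Module.End.mul_apply, evCompl_apply, evCompl_apply,
    contractLeft_tensorD, map_sub, map_smul, tensorD_coev]
  simp

theorem evCompl_sq (hs : LinearMap.trace k M.V D.sign * LinearMap.trace k M.V D.sign = 1) :
    D.evCompl * D.evCompl = D.evCompl := by
  ext1 x
  rw [Module.End.mul_apply, evCompl_apply (x := D.evCompl x), evCompl_apply, map_sub, map_smul,
    contractLeft_coev, smul_eq_mul]
  have h : LinearMap.trace k M.V D.sign * (contractLeft k M.V x -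
      LinearMap.trace k M.V D.sign * contractLeft k M.V x * LinearMap.trace k M.V D.sign) = 0 := by
    linear_combination (- LinearMap.trace k M.V D.sign * contractLeft k M.V x) * hs
  rw [h, zero_smul, sub_zero]

end

/-- A homotopy on the second factor acquires the Koszul sign of `M*`. The cross terms cancel because
`sign` anticommutes with `d`. -/
theorem one_sub_map_right {f h : Module.End k M.V} (hf : f = 1 - (D.d * h + h * D.d)) :
    1 - (TensorProduct.map 1 f : Module.End k (dualTensor M).V) =
      D.tensorD * TensorProduct.map (dualEnd D.sign) h +
        TensorProduct.map (dualEnd D.sign) h * D.tensorD := by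
  have h1 : dualEnd (D.d * D.sign) * dualEnd D.sign +
      dualEnd D.sign * dualEnd (D.d * D.sign) = 0 := by
    rw [dualEnd_mul, dualEnd_mul, mul_assoc, sign_sq, mul_one, ← mul_assoc, sign_mul_d_mul_sign]
    simp [dualEnd]
  rw [tensorD, add_mul, mul_add, ← TensorProduct.map_mul, ← TensorProduct.map_mul,
    ← TensorProduct.map_mul, ← TensorProduct.map_mul, one_mul, mul_one, dualEnd_mul D.sign D.sign,
    sign_sq]
  have h2 : (TensorProduct.map (dualEnd (D.d * D.sign) * dualEnd D.sign) h :
      Module.End k (dualTensor M).V) +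
      TensorProduct.map (dualEnd D.sign * dualEnd (D.d * D.sign)) h = 0 := by
    rw [← TensorProduct.map_add_left, h1, TensorProduct.map_zero_left]
  have h3 : (1 : Module.End k (dualTensor M).V) = TensorProduct.map 1 f +
      (TensorProduct.map 1 (D.d * h) + TensorProduct.map 1 (h * D.d)) := by
    rw [← TensorProduct.map_add_right, ← TensorProduct.map_add_right, hf, sub_add_cancel,
      TensorProduct.map_one]
  have h4 : dualEnd (1 : Module.End k M.V) = 1 := rfl
  rw [h4]
  calc _ = TensorProduct.map 1 (D.d * h) + TensorProduct.map 1 (h * D.d) :=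
        sub_eq_of_eq_add' h3
    _ = (TensorProduct.map 1 (D.d * h) + TensorProduct.map 1 (h * D.d)) + 0 := (add_zero _).symm
    _ = _ := by rw [← h2]; abel

/-- Here the cross terms `± h ⊗ d` cancel only because `h` is odd, which is what passing to `part₁`
secures. -/
theorem one_sub_map_left {f h : Module.End k M.V} (hf : f = 1 - (D.d * h + h * D.d))
    (hh : D.sign * h = -(h * D.sign)) :
    1 - (TensorProduct.map (dualEnd f) 1 : Module.End k (dualTensor M).V) =
      D.tensorD * TensorProduct.map (dualEnd (D.sign * h)) 1 +
        TensorProduct.map (dualEnd (D.sign * h)) 1 * D.tensorD := by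
  have h1 : dualEnd D.sign * dualEnd (D.sign * h) + dualEnd (D.sign * h) * dualEnd D.sign = 0 := by
    have : D.sign * h * D.sign = -h := by rw [hh, neg_mul, mul_assoc, sign_sq, mul_one]
    rw [dualEnd_mul, dualEnd_mul, this, ← mul_assoc, sign_sq, one_mul]
    simp [dualEnd]
  have h5 : D.sign * h * (D.d * D.sign) = h * D.d := by
    calc D.sign * h * (D.d * D.sign) = D.sign * h * -(D.sign * D.d) := by
          rw [sign_mul_d, neg_neg]
      _ = h * (D.sign * D.sign) * D.d := by rw [hh]; noncomm_ring
      _ = h * D.d := by rw [sign_sq, mul_one]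
  have h6 : D.d * D.sign * (D.sign * h) = D.d * h := by
    rw [mul_assoc, ← mul_assoc D.sign, sign_sq, one_mul]
  rw [tensorD, add_mul, mul_add, ← TensorProduct.map_mul, ← TensorProduct.map_mul,
    ← TensorProduct.map_mul, ← TensorProduct.map_mul, one_mul, mul_one, one_mul,
    dualEnd_mul (D.d * D.sign), dualEnd_mul _ (D.d * D.sign), h5, h6]
  have h2 : (TensorProduct.map (dualEnd D.sign * dualEnd (D.sign * h)) D.d :
      Module.End k (dualTensor M).V) +
      TensorProduct.map (dualEnd (D.sign * h) * dualEnd D.sign) D.d = 0 := by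
    rw [← TensorProduct.map_add_left, h1, TensorProduct.map_zero_left]
  have h3 : (1 : Module.End k (dualTensor M).V) = TensorProduct.map (dualEnd f) 1 +
      (TensorProduct.map (dualEnd (D.d * h)) 1 + TensorProduct.map (dualEnd (h * D.d)) 1) := by
    have h7 : dualEnd f + (dualEnd (D.d * h) + dualEnd (h * D.d)) = 1 := by
      rw [← map_add, ← map_add, hf, sub_add_cancel]
      rfl
    rw [← TensorProduct.map_add_left, ← TensorProduct.map_add_left, h7, TensorProduct.map_one]
  calc _ = TensorProduct.map (dualEnd (D.d * h)) 1 + TensorProduct.map (dualEnd (h * D.d)) 1 :=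
        sub_eq_of_eq_add' h3
    _ = (TensorProduct.map (dualEnd (D.d * h)) 1 + TensorProduct.map (dualEnd (h * D.d)) 1) + 0 :=
        (add_zero _).symm
    _ = _ := by rw [← h2]; abel

end GradedDifferential

end Rep

/-! ### Homotopies on `M* ⊗ M` modulo proper traces -/

namespace Rep

variable {k : Type u} [Field k] {G : Type v} [Group G]

namespace GradedDifferential

variable {M : Rep.{u} k G} (D : GradedDifferential M)

theorem commute_of_homotopy {V : Rep.{u} k G} {d f h : Module.End k V.V} (hd : d * d = 0)
    (hf : 1 - f = d * h + h * d) : d * f = f * d := by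
  have h1 : d * (1 - f) = (1 - f) * d := by
    rw [hf]
    calc d * (d * h + h * d) = (d * d) * h + d * h * d := by noncomm_ring
      _ = d * h * d + h * (d * d) := by rw [hd]; simp
      _ = _ := by noncomm_ring
  rw [mul_sub, sub_mul, mul_one, one_mul] at h1
  exact sub_right_inj.1 h1

theorem isLinearOn_smulRight {Q : Subgroup G} {φ : M.V →ₗ[k] k}
    (hφ : IsLinearOn Q M (Rep.trivial k G k) φ) {w : M.V} (hw : w ∈ fixedPoints M Q) :
    IsLinearOn Q M M (φ.smulRight w) := fun g hg m => by
  have h : φ (M.ρ g m) = φ m := hφ g hg m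
  rw [LinearMap.smulRight_apply, LinearMap.smulRight_apply, h, map_smul,
    mem_fixedPoints.1 hw g hg]

theorem contractLeft_map (f g : Module.End k M.V) (x : (dualTensor M).V) :
    contractLeft k M.V (TensorProduct.map (dualEnd f) g x) =
      contractLeft k M.V (TensorProduct.map 1 (f * g) x) := by
  induction x using TensorProduct.induction_on with
  | zero => simp
  | add x y hx hy => simp only [map_add, hx, hy]
  | tmul φ v => rfl

variable [Finite G] {p : ℕ} [Fact p.Prime] [CharP k p] {Q : Subgroup G}

/-- If `f` is homotopic to `1`, and equal to the rank one map `φ ⊗ w` modulo proper traces, then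
the supertrace of the identity is the parity of `w`. -/
theorem trace_sign_eq [Module.Finite k M.V] (hQ : IsPGroup p Q) {f h : Module.End k M.V}
    (hf : f = 1 - (D.d * h + h * D.d)) {w : M.V} {φ : M.V →ₗ[k] k}
    (hfw : f - φ.smulRight w ∈ traceIdeal Q M M) (hφw : φ w = 1) {c : k} (hc : D.sign w = c • w) :
    LinearMap.trace k M.V D.sign = c := by
  -- The supertrace vanishes on proper traces and on homotopy boundaries, so only the rank one term
  -- counts.
  have h1 : LinearMap.trace k M.V (D.sign * (f - φ.smulRight w)) = 0 :=
    linearMapTrace_eq_zero_of_mem_traceIdeal hQ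
      (comp_mem_traceIdeal_right (D.linear_sign.mono le_top) hfw)
  have h2 : LinearMap.trace k M.V (D.sign * φ.smulRight w) = c := by
    have : D.sign * φ.smulRight w = φ.smulRight (c • w) := by
      ext x
      rw [Module.End.mul_apply, LinearMap.smulRight_apply, map_smul, hc,
        LinearMap.smulRight_apply]
    rw [this, LinearMap.trace_smulRight, map_smul, hφw, smul_eq_mul, mul_one]
  have h3 : LinearMap.trace k M.V (D.sign * (D.d * h + h * D.d)) = 0 := by
    rw [mul_add, map_add, ← mul_assoc D.sign h, LinearMap.trace_mul_comm k (D.sign * h),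
      ← mul_assoc D.d, ← mul_assoc, sign_mul_d, neg_mul, map_neg, neg_add_cancel]
  have h4 : D.sign = D.sign * (f - φ.smulRight w) + D.sign * φ.smulRight w +
      D.sign * (D.d * h + h * D.d) := by
    rw [hf]
    noncomm_ring
  rw [h4, map_add, map_add, h1, h2, h3, zero_add, add_zero]

/-- If `1` is homotopic on `M` to a map which is of rank one modulo proper traces, then the
complement of the evaluation-coevaluation idempotent of `M* ⊗ M` is homotopic to a sum of proper
traces. -/
theorem exists_evCompl_homotopy [Module.Finite k M.V] (hQ : IsPGroup p Q)
    (hdd : D.tensorD * D.tensorD = 0) {f h : Module.End k M.V}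
    (hf : f = 1 - (D.d * h + h * D.d)) (hh : IsLinearOn Q M M h)
    (hodd : D.sign * h = -(h * D.sign)) {w : M.V} (hw : w ∈ fixedPoints M Q) {φ : M.V →ₗ[k] k}
    (hφ : ∀ g ∈ Q, ∀ m, φ (M.ρ g m) = φ m) (hfw : f - φ.smulRight w ∈ traceIdeal Q M M)
    (hφw : φ w = 1) {c : k} (hc : D.sign w = c • w) (hcc : c * c = 1) :
    ∃ u σ : Module.End k (dualTensor M).V, u ∈ traceIdeal Q (dualTensor M) (dualTensor M) ∧
      IsLinearOn Q (dualTensor M) (dualTensor M) σ ∧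
      u = D.evCompl - (D.tensorD * σ + σ * D.tensorD) := by
  have hs := D.trace_sign_eq hQ hf hfw hφw hc
  have hdQ : IsLinearOn Q M M D.d := D.linear_d.mono le_top
  have hsQ : IsLinearOn Q M M D.sign := D.linear_sign.mono le_top
  have heQ : IsLinearOn Q (dualTensor M) (dualTensor M) D.evCompl :=
    D.linear_evCompl.mono le_top
  have hfQ : IsLinearOn Q M M f := by
    rw [hf]
    exact IsLinearOn.id.sub ((hdQ.comp hh).add (hh.comp hdQ))
  have hrQ : IsLinearOn Q M M (φ.smulRight w) := fun g hg m => by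
    rw [LinearMap.smulRight_apply, LinearMap.smulRight_apply, hφ g hg, map_smul,
      mem_fixedPoints.1 hw g hg]
  -- `A` and `B` are `f` acting on either factor, both homotopic to `1`, so `evCompl` is homotopic
  -- to `A * evCompl * B`. Modulo proper traces they may be replaced by their rank one versions `A'`
  -- and `B'`.
  let A : Module.End k (dualTensor M).V := TensorProduct.map (dualEnd f) 1
  let B : Module.End k (dualTensor M).V := TensorProduct.map 1 f
  let A' : Module.End k (dualTensor M).V := TensorProduct.map (dualEnd (φ.smulRight w)) 1
  let B' : Module.End k (dualTensor M).V := TensorProduct.map 1 (φ.smulRight w)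
  let X : Module.End k (dualTensor M).V := TensorProduct.map (dualEnd (D.sign * h)) 1
  let Y : Module.End k (dualTensor M).V := TensorProduct.map (dualEnd D.sign) h
  have hA : 1 - A = D.tensorD * X + X * D.tensorD := D.one_sub_map_left hf hodd
  have hB : 1 - B = D.tensorD * Y + Y * D.tensorD := D.one_sub_map_right hf
  have hBd : D.tensorD * B = B * D.tensorD := commute_of_homotopy (V := dualTensor M) hdd hB
  have hed := D.tensorD_mul_evCompl
  have hAQ : IsLinearOn Q (dualTensor M) (dualTensor M) A' := hrQ.dual.tensor IsLinearOn.id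
  have hBQ : IsLinearOn Q (dualTensor M) (dualTensor M) B := IsLinearOn.id.tensor hfQ
  have hXQ : IsLinearOn Q (dualTensor M) (dualTensor M) X :=
    (hsQ.comp hh).dual.tensor IsLinearOn.id
  have hYQ : IsLinearOn Q (dualTensor M) (dualTensor M) Y := hsQ.dual.tensor hh
  have hAA : A - A' ∈ traceIdeal Q (dualTensor M) (dualTensor M) := by
    have : A - A' = TensorProduct.map (dualEnd (f - φ.smulRight w)) 1 := by
      rw [sub_eq_iff_eq_add, ← TensorProduct.map_add_left, ← map_add, sub_add_cancel]
    rw [this]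
    exact map_mem_traceIdeal_left (dual_mem_traceIdeal hfw) IsLinearOn.id
  have hBB : B - B' ∈ traceIdeal Q (dualTensor M) (dualTensor M) := by
    have : B - B' = TensorProduct.map 1 (f - φ.smulRight w) := by
      rw [sub_eq_iff_eq_add, ← TensorProduct.map_add_right, sub_add_cancel]
    rw [this]
    exact map_mem_traceIdeal_right IsLinearOn.id hfw
  have hcoev : A' D.coev = c • TensorProduct.tmul k φ w := by
    apply dualTensorHom_injective
    rw [dualTensorHom_map, dualTensorHom_coev, map_smul]
    ext m
    simp [dualTensorHom_apply, hc, smul_smul, mul_comm]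
  -- `B'` lands in `M* ⊗ w`, and `A'` sends `ψ ⊗ w` to `ψ w • (φ ⊗ w)`. The correction by `coev`
  -- contributes the same vector multiplied by `c * c = 1`.
  have hzero : A' * D.evCompl * B' = 0 := by
    refine TensorProduct.ext' fun ψ m => ?_
    change A' (D.evCompl (B' (TensorProduct.tmul k ψ m))) = 0
    have h1 : B' (TensorProduct.tmul k ψ m) = TensorProduct.tmul k ψ (φ m • w) := rfl
    rw [h1, evCompl_apply, map_sub, map_smul, hcoev, hs]
    have h2 : A' (TensorProduct.tmul k ψ (φ m • w)) =
        TensorProduct.tmul k (ψ w • φ) (φ m • w) := by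
      have : dualEnd (φ.smulRight w) ψ = ψ w • φ := by
        ext x
        simp [dualEnd, Module.Dual.transpose_apply, mul_comm]
      rw [← this]
      rfl
    have h3 : contractLeft k M.V (TensorProduct.tmul k ψ (φ m • w)) = φ m * ψ w := by
      rw [contractLeft_apply, map_smul, smul_eq_mul]
    rw [h2, h3, smul_smul, TensorProduct.tmul_smul, ← TensorProduct.smul_tmul', smul_smul,
      sub_eq_zero]
    congr 1
    linear_combination (- φ m * ψ w) * hcc
  refine ⟨A * D.evCompl * B, D.evCompl * Y + X * D.evCompl * B, ?_,
    (heQ.comp hYQ).add ((hXQ.comp heQ).comp hBQ), ?_⟩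
  · have h1 : A * D.evCompl * B = (A - A') * (D.evCompl * B) + A' * D.evCompl * (B - B') := by
      rw [mul_sub, hzero]
      noncomm_ring
    rw [h1]
    exact Submodule.add_mem _ (comp_mem_traceIdeal_left hAA (heQ.comp hBQ))
      (comp_mem_traceIdeal_right (hAQ.comp heQ) hBB)
  · have h1 : D.tensorD * (D.evCompl * Y) + D.evCompl * Y * D.tensorD = D.evCompl * (1 - B) := by
      rw [hB, ← mul_assoc, hed]
      noncomm_ring
    have h2 : D.tensorD * (X * D.evCompl * B) + X * D.evCompl * B * D.tensorD =
        (1 - A) * D.evCompl * B := by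
      have h4 : X * D.evCompl * B * D.tensorD = X * (D.tensorD * D.evCompl) * B := by
        rw [mul_assoc, ← hBd, hed]
        noncomm_ring
      rw [h4, hA]
      noncomm_ring
    have h3 : D.tensorD * (D.evCompl * Y + X * D.evCompl * B) +
        (D.evCompl * Y + X * D.evCompl * B) * D.tensorD =
        D.evCompl * (1 - B) + (1 - A) * D.evCompl * B := by
      rw [← h1, ← h2]
      noncomm_ring
    rw [h3]
    noncomm_ring

/-- If `1` is homotopic on `M` to a sum of proper traces, then every cocycle vanishes on every
cycle of `M* ⊗ M`, if both are fixed by `Q`. -/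
theorem cocycle_apply_eq_zero (hQ : IsPGroup p Q) {h : Module.End k M.V}
    (hf : 1 - (D.d * h + h * D.d) ∈ traceIdeal Q M M) {α : (dualTensor M).V}
    (hα : α ∈ fixedPoints (dualTensor M) Q) (hdα : D.tensorD α = 0)
    {β : (dualTensor M).V →ₗ[k] k} (hβ : IsLinearOn Q (dualTensor M) (Rep.trivial k G k) β)
    (hβd : ∀ x, β (D.tensorD x) = 0) : β α = 0 := by
  -- Pairing this homotopy with the cycle `α` and the cocycle `β` leaves `β α = β ((1 ⊗ f) α)`,
  -- which is a proper trace in the trivial module.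
  have h1 := LinearMap.congr_fun (D.one_sub_map_right (f := 1 - (D.d * h + h * D.d)) rfl) α
  have h2 := congrArg β h1
  simp only [LinearMap.sub_apply, LinearMap.add_apply, Module.End.mul_apply, map_sub, hdα,
    map_zero, hβd, Module.End.one_apply, add_zero] at h2
  have h3 := apply_mem_traces (comp_mem_traceIdeal_right hβ
    (map_mem_traceIdeal_right (IsLinearOn.id (Q := Q) (M := dualObj M)) hf)) hα
  rw [traces_eq_bot hQ fun _ _ _ => rfl] at h3
  have h4 : β ((TensorProduct.map 1 (1 - (D.d * h + h * D.d)) :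
      Module.End k (dualTensor M).V) α) = 0 := h3
  rw [h4] at h2
  exact sub_eq_zero.1 h2

theorem smulRight_mem_traceIdeal_of_mem_traces {φ : M.V →ₗ[k] k}
    (hφ : IsLinearOn Q M (Rep.trivial k G k) φ) {w : M.V} (hw : w ∈ traces M Q) :
    φ.smulRight w ∈ traceIdeal Q M M := by
  refine IsLinearOn.map_mem_traces (M := M) (N := homRep M M)
    (f := LinearMap.smulRightₗ φ) (fun g hg m => ?_) hw
  ext x
  have h : φ (M.ρ g⁻¹ x) = φ x := hφ _ (inv_mem hg) x
  change φ x • M.ρ g m = M.ρ g (φ (M.ρ g⁻¹ x) • m)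
  rw [h, map_smul]

theorem smulRight_mem_traceIdeal {φ : M.V →ₗ[k] k}
    (hφ : φ ∈ traceIdeal Q M (Rep.trivial k G k)) {w : M.V} (hw : w ∈ fixedPoints M Q) :
    φ.smulRight w ∈ traceIdeal Q M M := by
  refine comp_mem_traceIdeal_right (M := Rep.trivial k G k)
    (g := (LinearMap.toSpanSingleton k M.V w)) (fun g hg c => ?_) hφ
  change c • w = M.ρ g (c • w)
  rw [map_smul, mem_fixedPoints.1 hw g hg]

/-- A class and a dual class of the Brauer construction are closed only modulo traces. Each of the
two terms of the differential is a `Q`-linear image of one of these trace elements. -/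
theorem tensorD_tmul_mem_traces {w : M.V} (hw : w ∈ fixedPoints M Q) (hdw : D.d w ∈ traces M Q)
    {φ : M.V →ₗ[k] k} (hφ : IsLinearOn Q M (Rep.trivial k G k) φ)
    (hφd : φ ∘ₗ D.d ∈ traceIdeal Q M (Rep.trivial k G k)) :
    D.tensorD (TensorProduct.tmul k φ w) ∈ traces (dualTensor M) Q := by
  have hs : ∀ g ∈ Q, ∀ m, D.sign (M.ρ g m) = M.ρ g (D.sign m) := D.linear_sign.mono le_top
  refine Submodule.add_mem _ (x := TensorProduct.tmul k ((φ ∘ₗ D.d) ∘ₗ D.sign) w)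
    (y := TensorProduct.tmul k (φ ∘ₗ D.sign) (D.d w)) ?_ ?_
  · refine IsLinearOn.map_mem_traces (M := homRep M (Rep.trivial k G k)) (N := dualTensor M)
      (f := ((TensorProduct.mk k (Module.Dual k M.V) M.V).flip w) ∘ₗ dualEnd D.sign)
      (fun g hg f => ?_) hφd
    change TensorProduct.tmul k ((f ∘ₗ M.ρ g⁻¹) ∘ₗ D.sign) w =
      TensorProduct.tmul k ((f ∘ₗ D.sign) ∘ₗ M.ρ g⁻¹) (M.ρ g w)
    rw [mem_fixedPoints.1 hw g hg]
    congr 1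
    ext m
    exact congrArg f (hs _ (inv_mem hg) m).symm
  · refine IsLinearOn.map_mem_traces (M := M) (N := dualTensor M)
      (f := TensorProduct.mk k (Module.Dual k M.V) M.V (φ ∘ₗ D.sign)) (fun g hg m => ?_) hdw
    change TensorProduct.tmul k (φ ∘ₗ D.sign) (M.ρ g m) =
      TensorProduct.tmul k ((φ ∘ₗ D.sign) ∘ₗ M.ρ g⁻¹) (M.ρ g m)
    congr 1
    ext m
    exact (hφ _ (inv_mem hg) _).symm.trans (congrArg φ (hs _ (inv_mem hg) m).symm)

/-- If `1` is homotopic to the rank one map `β ⊗ α` on `M* ⊗ M`, then the pairing of classes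
`φ ⊗ w` of the Brauer construction has rank one. -/
theorem pairing_eq (hQ : IsPGroup p Q) {S : Module.End k (dualTensor M).V}
    (hS : IsLinearOn Q (dualTensor M) (dualTensor M) S) {α : (dualTensor M).V}
    {β : (dualTensor M).V →ₗ[k] k}
    (hαβ : 1 - β.smulRight α = D.tensorD * S + S * D.tensorD)
    {w w' : M.V} (hw : w ∈ fixedPoints M Q) (hw' : w' ∈ fixedPoints M Q)
    (hdw : D.d w ∈ traces M Q) (hdw' : D.d w' ∈ traces M Q) {φ φ' : M.V →ₗ[k] k}
    (hφ : IsLinearOn Q M (Rep.trivial k G k) φ) (hφ' : IsLinearOn Q M (Rep.trivial k G k) φ')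
    (hφd : φ ∘ₗ D.d ∈ traceIdeal Q M (Rep.trivial k G k))
    (hφd' : φ' ∘ₗ D.d ∈ traceIdeal Q M (Rep.trivial k G k)) :
    φ w' * φ' w = β (TensorProduct.tmul k φ w) *
      contractLeft k M.V (TensorProduct.map (1 : Module.End k (Module.Dual k M.V))
        (φ'.smulRight w') α) := by
  set r : Module.End k M.V := φ'.smulRight w' with hr
  have hdQ : IsLinearOn Q M M D.d := D.linear_d.mono le_top
  have hsQ : IsLinearOn Q M M D.sign := D.linear_sign.mono le_top
  have hrQ : IsLinearOn Q M M r := isLinearOn_smulRight hφ' hw'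
  -- `q` is an invariant form, and a cocycle modulo traces; `φ ⊗ w` is a cycle modulo traces. Both
  -- homotopy terms therefore vanish under `q`, leaving `q (φ ⊗ w) = β (φ ⊗ w) * q α`.
  let q : (dualTensor M).V →ₗ[k] k := contractLeft k M.V ∘ₗ
    TensorProduct.map (1 : Module.End k (Module.Dual k M.V)) r
  have hq : IsLinearOn Q (dualTensor M) (Rep.trivial k G k) q :=
    (isLinearOn_contractLeft M Q).comp (IsLinearOn.id.tensor hrQ)
  let x : (dualTensor M).V := TensorProduct.tmul k φ w
  have hx : x ∈ fixedPoints (dualTensor M) Q := by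
    refine mem_fixedPoints.2 fun g hg => ?_
    change TensorProduct.tmul k (φ ∘ₗ M.ρ g⁻¹) (M.ρ g w) = TensorProduct.tmul k φ w
    rw [mem_fixedPoints.1 hw g hg]
    congr 1
    ext m
    exact hφ _ (inv_mem hg) m
  have htriv : traces (Rep.trivial k G k) Q = ⊥ := traces_eq_bot hQ fun _ _ _ => rfl
  have h1 : q (S (D.tensorD x)) = 0 := by
    have := (hq.comp hS).map_mem_traces (D.tensorD_tmul_mem_traces hw hdw hφ hφd)
    rw [htriv] at this
    exact this
  have h2 : q (D.tensorD (S x)) = 0 := by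
    have ht : r * (D.d * D.sign) ∈ traceIdeal Q M M :=
      comp_mem_traceIdeal_left (smulRight_mem_traceIdeal hφd' hw') hsQ
    have ht₁ : D.d * D.sign * r ∈ traceIdeal Q M M := by
      have : D.d * D.sign * r = -(D.sign * φ'.smulRight (D.d w')) := by
        have h3 : φ'.smulRight (D.d w') = D.d * r := by
          ext m
          simp [hr]
        rw [h3, ← mul_assoc, sign_mul_d, neg_mul, neg_neg]
      rw [this]
      exact Submodule.neg_mem _ (comp_mem_traceIdeal_right hsQ
        (smulRight_mem_traceIdeal_of_mem_traces hφ' hdw'))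
    have ht₂ : D.sign * (r * D.d) ∈ traceIdeal Q M M :=
      comp_mem_traceIdeal_right hsQ (smulRight_mem_traceIdeal hφd' hw')
    have h3 : q (D.tensorD (S x)) = contractLeft k M.V
        ((TensorProduct.map 1 (D.d * D.sign * r + D.sign * (r * D.d)) :
          Module.End k (dualTensor M).V) (S x)) := by
      rw [TensorProduct.map_add_right, LinearMap.add_apply, map_add, ← contractLeft_map,
        ← contractLeft_map, ← map_add]
      refine congrArg (contractLeft k M.V) ?_
      have h4 : (TensorProduct.map 1 r : Module.End k (dualTensor M).V) * D.tensorD =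
          TensorProduct.map (dualEnd (D.d * D.sign)) r +
            TensorProduct.map (dualEnd D.sign) (r * D.d) := by
        rw [tensorD, mul_add, ← TensorProduct.map_mul, ← TensorProduct.map_mul, mul_one, one_mul,
          one_mul]
      exact LinearMap.congr_fun h4 (S x)
    have h5 := apply_mem_traces (comp_mem_traceIdeal_right (isLinearOn_contractLeft M Q)
      (map_mem_traceIdeal_right (IsLinearOn.id (Q := Q) (M := dualObj M))
        (Submodule.add_mem _ ht₁ ht₂))) (hS.map_mem_fixedPoints hx)
    rw [htriv] at h5
    exact h3.trans h5
  have h3 := congrArg q (LinearMap.congr_fun hαβ x)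
  simp only [LinearMap.sub_apply, LinearMap.add_apply, Module.End.mul_apply, map_sub, map_add, h1,
    h2, Module.End.one_apply, LinearMap.smulRight_apply, map_smul, smul_eq_mul, add_zero] at h3
  rw [sub_eq_zero] at h3
  refine Eq.trans ?_ h3
  change _ = φ (φ' w • w')
  rw [map_smul, smul_eq_mul, mul_comm]

/-- If `1` is homotopic to a map of rank one on `M* ⊗ M`, then the homology of the Brauer
construction does not contain two linearly independent classes. -/
theorem false_of_dual_pair (hQ : IsPGroup p Q) {S : Module.End k (dualTensor M).V}
    (hS : IsLinearOn Q (dualTensor M) (dualTensor M) S) {α : (dualTensor M).V}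
    {β : (dualTensor M).V →ₗ[k] k}
    (hαβ : 1 - β.smulRight α = D.tensorD * S + S * D.tensorD)
    {x y : M.V} (hx : x ∈ fixedPoints M Q) (hy : y ∈ fixedPoints M Q)
    (hdx : D.d x ∈ traces M Q) (hdy : D.d y ∈ traces M Q) {φ ψ : M.V →ₗ[k] k}
    (hφ : IsLinearOn Q M (Rep.trivial k G k) φ) (hψ : IsLinearOn Q M (Rep.trivial k G k) ψ)
    (hφd : φ ∘ₗ D.d ∈ traceIdeal Q M (Rep.trivial k G k))
    (hψd : ψ ∘ₗ D.d ∈ traceIdeal Q M (Rep.trivial k G k))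
    (hφx : φ x = 1) (hφy : φ y = 0) (hψy : ψ y = 1) : False := by
  -- Writing the right side of `pairing_eq` as `b (φ, w) * c (φ', w')`, the three instances say `b
  -- (φ, x) * c (φ, x) = 1`, `b (φ, y) * c (ψ, x) = 1` and `b (φ, y) * c (φ, x) = 0`.
  have h1 := D.pairing_eq hQ hS hαβ hx hx hdx hdx hφ hφ hφd hφd
  have h2 := D.pairing_eq hQ hS hαβ hy hx hdy hdx hφ hψ hφd hψd
  have h3 := D.pairing_eq hQ hS hαβ hy hx hdy hdx hφ hφ hφd hφd
  rw [hφx, mul_one] at h1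
  rw [hφx, hψy, mul_one] at h2
  rw [hφy, mul_zero] at h3
  rcases mul_eq_zero.1 h3.symm with h | h
  · rw [h, zero_mul] at h2
    exact one_ne_zero h2
  · rw [h, mul_zero] at h1
    exact one_ne_zero h1

end GradedDifferential

end Rep

/-! ### Splitting the Brauer construction off the total module -/

namespace Rep

variable {k : Type u} [Field k] {G : Type v} [Group G] [Finite G] {p : ℕ} [Fact p.Prime]
  [CharP k p] {Q : Subgroup G}

/-- A splitting of the differential module `M` over a subgroup `Q`, up to proper traces, onto a
differential space `F` with trivial action. -/
structure BrauerSplitting (Q : Subgroup G) {M : Rep.{u} k G} (D : GradedDifferential M)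
    {F : Type u} [AddCommGroup F] [Module k F] (dF : Module.End k F) where
  /-- the inclusion -/
  i : F →ₗ[k] M.V
  /-- the retraction -/
  r : M.V →ₗ[k] F
  linear_i : IsLinearOn Q (Rep.trivial k G F) M i
  linear_r : IsLinearOn Q M (Rep.trivial k G F) r
  r_i : r ∘ₗ i = LinearMap.id
  sub_mem : LinearMap.id - i ∘ₗ r ∈ traceIdeal Q M M
  r_d_i : r ∘ₗ D.d ∘ₗ i = dF

namespace BrauerSplitting

variable {M : Rep.{u} k G} {D : GradedDifferential M} {F : Type u} [AddCommGroup F] [Module k F]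
  {dF : Module.End k F} (B : BrauerSplitting Q D dF)

include B

/-- The inclusion is a chain map only modulo proper traces: the defect is `1 - i ∘ r`, which lies in
the ideal, applied to `d ∘ i`. -/
theorem d_i_sub_mem : D.d ∘ₗ B.i - B.i ∘ₗ dF ∈ traceIdeal Q (Rep.trivial k G F) M := by
  have h : D.d ∘ₗ B.i - B.i ∘ₗ dF = (LinearMap.id - B.i ∘ₗ B.r) ∘ₗ (D.d ∘ₗ B.i) := by
    ext x
    have hx : B.r (D.d (B.i x)) = dF x := LinearMap.congr_fun B.r_d_i x
    simp [hx]
  rw [h]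
  exact comp_mem_traceIdeal_left B.sub_mem ((D.linear_d.mono le_top).comp B.linear_i)

theorem r_d_sub_mem : B.r ∘ₗ D.d - dF ∘ₗ B.r ∈ traceIdeal Q M (Rep.trivial k G F) := by
  have h : B.r ∘ₗ D.d - dF ∘ₗ B.r = (B.r ∘ₗ D.d) ∘ₗ (LinearMap.id - B.i ∘ₗ B.r) := by
    ext x
    have hx : B.r (D.d (B.i (B.r x))) = dF (B.r x) := LinearMap.congr_fun B.r_d_i (B.r x)
    simp [hx]
  rw [h]
  exact comp_mem_traceIdeal_right (B.linear_r.comp (D.linear_d.mono le_top)) B.sub_mem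

theorem i_mem_fixedPoints (x : F) : B.i x ∈ fixedPoints M Q :=
  mem_fixedPoints.2 fun g hg => (B.linear_i g hg x).symm

theorem d_i_mem_traces {x : F} (hx : dF x = 0) : D.d (B.i x) ∈ traces M Q := by
  have h := apply_mem_traces (m := x) B.d_i_sub_mem (mem_fixedPoints.2 fun _ _ => rfl)
  have h2 : (D.d ∘ₗ B.i - B.i ∘ₗ dF) x = D.d (B.i x) := by
    rw [LinearMap.sub_apply, LinearMap.comp_apply, LinearMap.comp_apply, hx, map_zero, sub_zero]
  rwa [h2] at h

theorem linear_comp_r (φ : F →ₗ[k] k) : IsLinearOn Q M (Rep.trivial k G k) (φ ∘ₗ B.r) :=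
  fun g hg m => congrArg φ (B.linear_r g hg m)

theorem comp_r_d_mem {φ : F →ₗ[k] k} (hφ : ∀ x, φ (dF x) = 0) :
    (φ ∘ₗ B.r) ∘ₗ D.d ∈ traceIdeal Q M (Rep.trivial k G k) := by
  have h : (φ ∘ₗ B.r) ∘ₗ D.d = φ ∘ₗ (B.r ∘ₗ D.d - dF ∘ₗ B.r) := by
    ext m
    simp [hφ]
  rw [h]
  exact comp_mem_traceIdeal_right (M := Rep.trivial k G F) (fun _ _ _ => rfl) B.r_d_sub_mem

theorem linear_lift (h : Module.End k F) : IsLinearOn Q M M (B.i ∘ₗ h ∘ₗ B.r) :=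
  B.linear_i.comp (IsLinearOn.comp (M := Rep.trivial k G F) (fun _ _ _ => rfl) B.linear_r)

/-- Since `i` and `r` are chain maps modulo proper traces and `i ∘ r` is the identity modulo them, a
homotopy on `F` transports to `M` with an error in the ideal. -/
theorem lift_homotopy_sub_mem (h : Module.End k F) :
    1 - (D.d * (B.i ∘ₗ h ∘ₗ B.r) + (B.i ∘ₗ h ∘ₗ B.r) * D.d) -
      B.i ∘ₗ (1 - (dF * h + h * dF)) ∘ₗ B.r ∈ traceIdeal Q M M := by
  have h0 : 1 - (D.d * (B.i ∘ₗ h ∘ₗ B.r) + (B.i ∘ₗ h ∘ₗ B.r) * D.d) -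
      B.i ∘ₗ (1 - (dF * h + h * dF)) ∘ₗ B.r = (LinearMap.id - B.i ∘ₗ B.r) -
      (D.d ∘ₗ B.i - B.i ∘ₗ dF) ∘ₗ (h ∘ₗ B.r) - (B.i ∘ₗ h) ∘ₗ (B.r ∘ₗ D.d - dF ∘ₗ B.r) := by
    ext m
    simp only [LinearMap.sub_apply, LinearMap.add_apply, Module.End.mul_apply,
      Module.End.one_apply, LinearMap.comp_apply, LinearMap.id_apply, map_sub, map_add]
    abel
  rw [h0]
  exact Submodule.sub_mem _ (Submodule.sub_mem _ B.sub_mem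
    (comp_mem_traceIdeal_left B.d_i_sub_mem
      (IsLinearOn.comp (M := Rep.trivial k G F) (fun _ _ _ => rfl) B.linear_r)))
    (comp_mem_traceIdeal_right (B.linear_i.comp (L := Rep.trivial k G F) (f := h)
      (fun _ _ _ => rfl))
      B.r_d_sub_mem)

end BrauerSplitting

/-- The Brauer construction of a complex of `p`-permutation modules splits off its total module up
to proper traces. -/
theorem exists_brauerSplitting (hQ : IsPGroup p Q) {C : ChainComplex (Rep.{u} k G) ℤ}
    (hC : ∀ i, IsPPermutation p (C.X i)) (T : Totalization C)
    (E : Totalization (brauerComplex C Q)) (hS : E.S = T.S) :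
    ∃ B : BrauerSplitting Q T.graded E.graded.d,
      ∀ (n : ℤ) (x : ((brauerComplex C Q).X n).V),
        ∃ y, B.i ((E.inc n).hom x) = (T.inc n).hom y := by
  choose i r hi hr hri hir hmk using fun n => exists_brauer_splitting hQ ((hC n).2 Q hQ)
  let I : E.V.V →ₗ[k] T.V.V := ∑ n ∈ T.S,
    (T.inc n).hom.toLinearMap ∘ₗ i n ∘ₗ (E.prj n).hom.toLinearMap
  let R : T.V.V →ₗ[k] E.V.V := ∑ n ∈ T.S,
    (E.inc n).hom.toLinearMap ∘ₗ r n ∘ₗ (T.prj n).hom.toLinearMap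
  have hzero : ∀ n ∉ T.S, ∀ x : (C.X n).V, x = 0 := fun n hn x => by
    rw [← T.prj_inc_self n x]
    exact T.prj_eq_zero hn _
  have hzero' : ∀ n ∉ T.S, ∀ x : ((brauerComplex C Q).X n).V, x = 0 := fun n hn x => by
    rw [← E.prj_inc_self n x]
    exact E.prj_eq_zero (by rwa [hS]) _
  have hIinc : ∀ (n : ℤ) (x : ((brauerComplex C Q).X n).V),
      I ((E.inc n).hom x) = (T.inc n).hom (i n x) := by
    intro n x
    by_cases hn : n ∈ T.S
    · rw [LinearMap.sum_apply, Finset.sum_eq_single n]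
      · exact congrArg (fun y => (T.inc n).hom (i n y)) (E.prj_inc_self n x)
      · intro m _ hm
        refine (congrArg (fun y => (T.inc m).hom (i m y)) (E.prj_inc_ne hm.symm x)).trans ?_
        exact (congrArg (T.inc m).hom (map_zero (i m))).trans (map_zero (T.inc m).hom)
      · exact fun h => absurd hn h
    · rw [hzero' n hn x, map_zero, map_zero]
      exact ((congrArg (T.inc n).hom (map_zero (i n))).trans (map_zero (T.inc n).hom)).symm
  have hRinc : ∀ (n : ℤ) (x : (C.X n).V), R ((T.inc n).hom x) = (E.inc n).hom (r n x) := by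
    intro n x
    by_cases hn : n ∈ T.S
    · rw [LinearMap.sum_apply, Finset.sum_eq_single n]
      · exact congrArg (fun y => (E.inc n).hom (r n y)) (T.prj_inc_self n x)
      · intro m _ hm
        refine (congrArg (fun y => (E.inc m).hom (r m y)) (T.prj_inc_ne hm.symm x)).trans ?_
        exact (congrArg (E.inc m).hom (map_zero (r m))).trans (map_zero (E.inc m).hom)
      · exact fun h => absurd hn h
    · rw [hzero n hn x, map_zero, map_zero]
      exact ((congrArg (E.inc n).hom (map_zero (r n))).trans (map_zero (E.inc n).hom)).symm
  have hext : ∀ {W : Type u} [AddCommGroup W] [Module k W] {f g : E.V.V →ₗ[k] W},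
      (∀ n x, f ((E.inc n).hom x) = g ((E.inc n).hom x)) → f = g := by
    intro W _ _ f g h
    ext x
    rw [← E.sum_inc_prj x, map_sum, map_sum]
    exact Finset.sum_congr rfl fun n _ => h n _
  have hTsum : ∑ n ∈ T.S, (T.inc n).hom.toLinearMap ∘ₗ (T.prj n).hom.toLinearMap =
      LinearMap.id := T.graded.sum_P
  refine ⟨⟨I, R, ?_, ?_, ?_, ?_, ?_⟩, fun n x => ⟨i n x, hIinc n x⟩⟩
  · refine IsLinearOn.sum _ fun n _ => (IsLinearOn.of_hom (T.inc n)).comp fun g hg x => ?_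
    exact (hi n g hg _).symm
  · refine IsLinearOn.sum _ fun n _ g hg m => ?_
    change (E.inc n).hom (r n ((T.prj n).hom (T.V.ρ g m))) = (E.inc n).hom (r n ((T.prj n).hom m))
    rw [hom_comm_apply, hr n g hg]
  · refine hext fun n x => ?_
    rw [LinearMap.comp_apply, hIinc, hRinc]
    exact congrArg (E.inc n).hom (LinearMap.congr_fun (hri n) x)
  · have h : LinearMap.id - I ∘ₗ R = ∑ n ∈ T.S, (T.inc n).hom.toLinearMap ∘ₗ
        (LinearMap.id - i n ∘ₗ r n) ∘ₗ (T.prj n).hom.toLinearMap := by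
      simp only [LinearMap.comp_sub, LinearMap.sub_comp, Finset.sum_sub_distrib,
        LinearMap.id_comp]
      rw [hTsum]
      congr 1
      ext m
      simp only [R, LinearMap.comp_apply, LinearMap.sum_apply, map_sum]
      exact Finset.sum_congr rfl fun n _ => hIinc n _
    rw [h]
    exact Submodule.sum_mem _ fun n _ => comp_mem_traceIdeal_right (IsLinearOn.of_hom (T.inc n))
      (comp_mem_traceIdeal_left (hir n) (IsLinearOn.of_hom (T.prj n)))
  · refine hext fun n x => ?_
    rw [LinearMap.comp_apply, LinearMap.comp_apply, hIinc, T.graded_d_inc, hRinc, E.graded_d_inc]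
    refine congrArg (E.inc (n - 1)).hom ?_
    -- `i n x` is a fixed vector representing the class `x`, and the differential of the Brauer
    -- construction is computed on representatives.
    have hix : i n x ∈ fixedPoints (C.X n) Q := mem_fixedPoints.2 fun g hg => hi n g hg x
    have h1 : (Submodule.Quotient.mk ⟨i n x, hix⟩ : (brauerObj (C.X n) Q).V) = x := by
      rw [← hmk n ⟨i n x, hix⟩]
      exact LinearMap.congr_fun (hri n) x
    refine (hmk (n - 1) (fixedPointsMap (C.d n (n - 1)) Q ⟨i n x, hix⟩)).trans ?_
    conv_rhs => rw [← h1]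
    rfl

variable {C : ChainComplex (Rep.{u} k G) ℤ}

/-- If the homology of the Brauer construction is a line, then the complement of the
evaluation-coevaluation idempotent is homotopic to a sum of proper traces. -/
theorem exists_evCompl_homotopy_of_homology (hQ : IsPGroup p Q)
    (hC : ∀ i, IsPPermutation p (C.X i)) (T : Totalization C) [Module.Finite k T.V.V]
    (E : Totalization (brauerComplex C Q)) (hS : E.S = T.S)
    (hdd : T.graded.tensorD * T.graded.tensorD = 0) {j : ℤ}
    (hj : Module.finrank k ((brauerComplex C Q).homology j).V = 1)
    (hE : ∀ n, n ≠ j → Limits.IsZero ((brauerComplex C Q).homology n)) :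
    LinearMap.trace k T.V.V T.graded.sign = ((j.negOnePow : ℤ) : k) ∧
    ∃ u σ : Module.End k (dualTensor T.V).V,
      u ∈ traceIdeal Q (dualTensor T.V) (dualTensor T.V) ∧
      IsLinearOn Q (dualTensor T.V) (dualTensor T.V) σ ∧
      u = T.graded.evCompl - (T.graded.tensorD * σ + σ * T.graded.tensorD) := by
  obtain ⟨B, hB⟩ := exists_brauerSplitting hQ hC T E hS
  obtain ⟨w, φ₀, hφ₀d, hdw, hφ₀w, hgen⟩ := E.exists_generator hj hE
  obtain ⟨s, φ, hφ₀, hφd, hs⟩ := LinearMap.exists_contraction_onto_line E.graded.d_sq hφ₀d hgen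
  obtain ⟨y, hy⟩ := hB j w
  set x : T.V.V := B.i ((E.inc j).hom w) with hx
  have hPx : ∀ n, T.graded.P n x = if n = j then x else 0 := by
    intro n
    rw [hy]
    split_ifs with h
    · subst h
      exact congrArg (T.inc n).hom (T.prj_inc_self n y)
    · exact (congrArg (T.inc n).hom (T.prj_inc_ne (Ne.symm h) y)).trans (map_zero _)
  have hxfix : x ∈ fixedPoints T.V Q := B.i_mem_fixedPoints _
  have hφx : φ (B.r x) = 1 := by
    rw [show B.r x = (E.inc j).hom w from LinearMap.congr_fun B.r_i _, hφ₀ _ hdw, hφ₀w]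
  have hsign : T.graded.sign x = ((j.negOnePow : ℤ) : k) • x := by
    have := LinearMap.congr_fun (T.graded.sign_mul_P j) x
    rwa [Module.End.mul_apply, LinearMap.smul_apply, hPx, if_pos rfl] at this
  -- The lifted homotopy need not be homogeneous. Its degree one part is odd, as required for
  -- tensoring with `M*`, and cutting `φ ∘ r` down to degree `j` gives the degree zero part of the
  -- rank one map.
  set h₀ : Module.End k T.V.V := B.i ∘ₗ s ∘ₗ B.r with hh₀
  set ψ : T.V.V →ₗ[k] k := (φ ∘ₗ B.r) ∘ₗ T.graded.P j with hψ
  have hf : T.graded.part (1 - (T.graded.d * h₀ + h₀ * T.graded.d)) =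
      1 - (T.graded.d * T.graded.part₁ h₀ + T.graded.part₁ h₀ * T.graded.d) := by
    rw [T.graded.part_sub, T.graded.part_add, T.graded.d_mul_part₁, T.graded.part₁_mul_d,
      T.graded.part_eq_self fun n => by simp]
  have hrank : T.graded.part (B.i ∘ₗ (1 - (E.graded.d * s + s * E.graded.d)) ∘ₗ B.r) =
      ψ.smulRight x := by
    rw [hs]
    ext m
    have : ∀ n, (T.graded.P n * (B.i ∘ₗ (φ.smulRight ((E.inc j).hom w)) ∘ₗ B.r) * T.graded.P n) m =
        if n = j then ψ m • x else 0 := by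
      intro n
      have h1 : (T.graded.P n * (B.i ∘ₗ (φ.smulRight ((E.inc j).hom w)) ∘ₗ B.r) * T.graded.P n) m =
          T.graded.P n (B.i (φ (B.r (T.graded.P n m)) • (E.inc j).hom w)) := rfl
      rw [h1, map_smul, map_smul, ← hx, hPx]
      split_ifs with h
      · subst h
        rfl
      · rw [smul_zero]
    rw [GradedDifferential.part, LinearMap.sum_apply, Finset.sum_congr rfl fun n _ => this n,
      Finset.sum_ite_eq', LinearMap.smulRight_apply]
    split_ifs with h
    · rfl
    · have h2 : ψ m = 0 := by
        rw [hψ, T.graded.P_eq_zero h]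
        simp
      rw [h2, zero_smul]
  have hmem := T.graded.part_mem_traceIdeal (B.lift_homotopy_sub_mem s)
  rw [T.graded.part_sub, hf, hrank] at hmem
  have hψx : ψ x = 1 := by
    rw [hψ, LinearMap.comp_apply, hPx, if_pos rfl]
    exact hφx
  have hψQ : ∀ g ∈ Q, ∀ m, ψ (T.V.ρ g m) = ψ m :=
    (B.linear_comp_r φ).comp ((T.graded.linear_P j).mono le_top)
  exact ⟨T.graded.trace_sign_eq hQ rfl hmem hψx hsign, T.graded.exists_evCompl_homotopy hQ hdd rfl
    (T.graded.linear_part₁ (B.linear_lift s)) (T.graded.sign_mul_part₁ h₀) hxfix hψQ hmem hψx hsign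
    (GradedDifferential.negOnePow_cast_mul_self j)⟩

/-- If `1` is homotopic to a map of rank one on the total module of `C* ⊗ C`, then the homology
of the Brauer construction is a line. -/
theorem exists_finrank_homology_brauerComplex_eq_one (hQ : IsPGroup p Q)
    (hC : ∀ i, IsPPermutation p (C.X i)) (T : Totalization C)
    (E : Totalization (brauerComplex C Q)) (hS : E.S = T.S)
    {S : Module.End k (dualTensor T.V).V} (hSQ : IsLinearOn Q (dualTensor T.V) (dualTensor T.V) S)
    {α : (dualTensor T.V).V} (hα : α ∈ fixedPoints (dualTensor T.V) Q)
    (hdα : T.graded.tensorD α = 0)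
    {β : (dualTensor T.V).V →ₗ[k] k}
    (hβ : IsLinearOn Q (dualTensor T.V) (Rep.trivial k G k) β)
    (hβd : ∀ x, β (T.graded.tensorD x) = 0) (hβα : β α = 1)
    (hαβ : 1 - β.smulRight α = T.graded.tensorD * S + S * T.graded.tensorD) :
    ∃ i : ℤ, Module.finrank k ((brauerComplex C Q).homology i).V = 1 ∧
      ∀ j : ℤ, j ≠ i → Limits.IsZero ((brauerComplex C Q).homology j) := by
  obtain ⟨B, -⟩ := exists_brauerSplitting hQ hC T E hS
  refine E.exists_finrank_homology_eq_one (fun s hs => ?_) ?_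
  · have h := B.lift_homotopy_sub_mem s
    rw [← hs, sub_self, LinearMap.zero_comp, LinearMap.comp_zero, sub_zero] at h
    exact one_ne_zero (hβα.symm.trans (T.graded.cocycle_apply_eq_zero hQ h hα hdα hβ hβd))
  · intro x y φ ψ hx hy hφ hψ hφx hφy _ hψy
    have hri : ∀ z, B.r (B.i z) = z := fun z => LinearMap.congr_fun B.r_i z
    exact T.graded.false_of_dual_pair hQ hSQ hαβ (B.i_mem_fixedPoints x) (B.i_mem_fixedPoints y)
      (B.d_i_mem_traces hx) (B.d_i_mem_traces hy) (B.linear_comp_r φ) (B.linear_comp_r ψ)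
      (B.comp_r_d_mem hφ) (B.comp_r_d_mem hψ) (by rw [LinearMap.comp_apply, hri, hφx])
      (by rw [LinearMap.comp_apply, hri, hφy]) (by rw [LinearMap.comp_apply, hri, hψy])

end Rep

/-! ### Total modules of duals and tensor products -/

namespace Rep

variable {k : Type u} [Field k] {G : Type v} [Group G]

theorem dualMap_id (M : Rep.{u} k G) : dualMap (𝟙 M) = 𝟙 (dualObj M) := rfl

theorem dualMap_comp {L M N : Rep.{u} k G} (f : L ⟶ M) (g : M ⟶ N) :
    dualMap g ≫ dualMap f = dualMap (f ≫ g) := rfl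

theorem dualMap_zero (M N : Rep.{u} k G) : dualMap (0 : M ⟶ N) = 0 := by
  ext φ m
  exact map_zero φ

theorem dualMap_add {M N : Rep.{u} k G} (f g : M ⟶ N) :
    dualMap (f + g) = dualMap f + dualMap g := by
  ext φ m
  exact map_add φ _ _

theorem dualMap_sum {M N : Rep.{u} k G} {ι : Type*} (s : Finset ι) (f : ι → (M ⟶ N)) :
    dualMap (∑ i ∈ s, f i) = ∑ i ∈ s, dualMap (f i) :=
  map_sum (AddMonoidHom.mk' (dualMap (M := M) (N := N)) dualMap_add) f s

theorem units_smul_hom_apply {M N : Rep.{u} k G} (a : ℤˣ) (f : M ⟶ N) (x : M.V) :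
    (a • f).hom x = ((a : ℤ) : k) • f.hom x := by
  rcases Int.units_eq_one_or a with rfl | rfl
  · simp
  · rw [Units.val_neg, Units.val_one, Int.cast_neg, Int.cast_one, Units.neg_smul, one_smul,
      neg_smul, one_smul]
    rfl

/-- A linear map which commutes with the action, as a morphism. -/
def homOfIsLinearOn {M N : Rep.{u} k G} {f : M.V →ₗ[k] N.V}
    (hf : IsLinearOn ⊤ M N f) : M ⟶ N :=
  Rep.ofHom ⟨f, fun g => LinearMap.ext fun m => hf g (Subgroup.mem_top g) m⟩

namespace Totalization

variable {K L : ChainComplex (Rep.{u} k G) ℤ} (T : Totalization K) (U : Totalization L)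

/-- The inclusion of the term of degree `n` of `K ⊗ L` into the tensor product of the total
modules. -/
def tensorInc (n : ℤ) : (HomologicalComplex.tensorObj K L).X n ⟶ T.V ⊗ U.V :=
  HomologicalComplex.mapBifunctorDesc fun i j _ => T.inc i ⊗ₘ U.inc j

theorem ι_tensorInc (i j n : ℤ) (h : i + j = n) :
    HomologicalComplex.ιTensorObj K L i j n h ≫ T.tensorInc U n = T.inc i ⊗ₘ U.inc j :=
  HomologicalComplex.ι_mapBifunctorDesc _ i j h

/-- The projection of the tensor product of the total modules onto the term of degree `n` of
`K ⊗ L`. -/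
def tensorPrj (n : ℤ) : T.V ⊗ U.V ⟶ (HomologicalComplex.tensorObj K L).X n :=
  ∑ j ∈ U.S, (T.prj (n - j) ⊗ₘ U.prj j) ≫
    HomologicalComplex.ιTensorObj K L (n - j) j n (sub_add_cancel n j)

theorem tensorInc_tensorPrj_self (n : ℤ) : T.tensorInc U n ≫ T.tensorPrj U n = 𝟙 _ := by
  refine HomologicalComplex.mapBifunctor.hom_ext fun i j h => ?_
  obtain rfl : i = n - j := eq_sub_of_add_eq h
  refine ((Category.assoc _ _ _).symm.trans (congrArg (· ≫ T.tensorPrj U n)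
    (T.ι_tensorInc U (n - j) j n h))).trans ?_
  change _ = HomologicalComplex.ιTensorObj K L (n - j) j n h ≫ 𝟙 _
  rw [Category.comp_id, tensorPrj, Preadditive.comp_sum]
  by_cases hj : j ∈ U.S
  · rw [Finset.sum_eq_single j]
    · rw [← Category.assoc, tensorHom_comp_tensorHom, T.inc_prj_self, U.inc_prj_self]
      exact (congrArg (· ≫ _) (id_tensorHom_id _ _)).trans (Category.id_comp _)
    · intro m _ hm
      rw [← Category.assoc, tensorHom_comp_tensorHom, U.inc_prj_ne _ _ hm.symm]
      simp
    · exact fun h => absurd hj h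
  · have h0 : 𝟙 (L.X j) = 0 := by rw [← U.inc_prj_self, U.inc_eq_zero hj, Limits.zero_comp]
    have h1 : 𝟙 (K.X (n - j) ⊗ L.X j) = 0 := by
      rw [← id_tensorHom_id, h0]
      simp
    rw [U.inc_eq_zero hj]
    exact Eq.trans (by simp) ((Category.id_comp _).symm.trans (congrArg (· ≫ _) h1)).symm

theorem tensorInc_tensorPrj_ne (m n : ℤ) (hmn : m ≠ n) :
    T.tensorInc U m ≫ T.tensorPrj U n = 0 := by
  refine HomologicalComplex.mapBifunctor.hom_ext fun i j h => ?_
  obtain rfl : i = m - j := eq_sub_of_add_eq h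
  refine ((Category.assoc _ _ _).symm.trans (congrArg (· ≫ T.tensorPrj U n)
    (T.ι_tensorInc U (m - j) j m h))).trans ?_
  rw [Limits.comp_zero, tensorPrj, Preadditive.comp_sum]
  refine Finset.sum_eq_zero fun l _ => ?_
  rw [← Category.assoc, tensorHom_comp_tensorHom]
  by_cases hl : j = l
  · subst hl
    rw [T.inc_prj_ne _ _ (by omega)]
    simp
  · rw [U.inc_prj_ne _ _ hl]
    simp

theorem tensorPrj_tensorInc (n : ℤ) : T.tensorPrj U n ≫ T.tensorInc U n =
    ∑ j ∈ U.S, ((T.prj (n - j) ≫ T.inc (n - j)) ⊗ₘ (U.prj j ≫ U.inc j)) := by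
  rw [tensorPrj, Preadditive.sum_comp]
  refine Finset.sum_congr rfl fun j _ => ?_
  rw [Category.assoc, T.ι_tensorInc U (n - j) j n (sub_add_cancel n j), tensorHom_comp_tensorHom]

/-- The tensor product of the total modules of `K` and `L` is the total module of `K ⊗ L`. -/
def tensor : Totalization (HomologicalComplex.tensorObj K L) where
  V := T.V ⊗ U.V
  inc := T.tensorInc U
  prj := T.tensorPrj U
  S := Finset.image₂ (· + ·) T.S U.S
  inc_prj_self := T.tensorInc_tensorPrj_self U
  inc_prj_ne := T.tensorInc_tensorPrj_ne U
  sum_prj_inc := by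
    have hp : ∀ m ∉ T.S, T.prj m ≫ T.inc m = 0 := fun m hm => by
      rw [T.inc_eq_zero hm, Limits.comp_zero]
    simp only [tensorPrj_tensorInc]
    rw [Finset.sum_comm]
    have h : ∀ j ∈ U.S, ∑ n ∈ Finset.image₂ (· + ·) T.S U.S,
        ((T.prj (n - j) ≫ T.inc (n - j)) ⊗ₘ (U.prj j ≫ U.inc j)) =
        𝟙 T.V ⊗ₘ (U.prj j ≫ U.inc j) := by
      intro j hj
      rw [← sum_tensor, ← T.sum_prj_inc]
      congr 1
      have h1 : ∑ m ∈ T.S, T.prj m ≫ T.inc m = ∑ n ∈ T.S.image (fun m => m + j),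
          T.prj (n - j) ≫ T.inc (n - j) := by
        rw [Finset.sum_image fun _ _ _ _ h => add_left_injective j h]
        exact Finset.sum_congr rfl fun m _ => by rw [add_sub_cancel_right]
      rw [h1]
      symm
      refine Finset.sum_subset ?_ fun n _ hn => hp _ fun h => hn ?_
      · intro n hn
        obtain ⟨m, hm, rfl⟩ := Finset.mem_image.1 hn
        exact Finset.mem_image₂_of_mem hm hj
      · exact Finset.mem_image.2 ⟨_, h, by ring⟩
    rw [Finset.sum_congr rfl h, ← tensor_sum, U.sum_prj_inc]
    exact id_tensorHom_id _ _

theorem ι_d_tensorInc (i j n : ℤ) (h : i + j = n) :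
    HomologicalComplex.ιTensorObj K L i j n h ≫
        (HomologicalComplex.tensorObj K L).d n (n - 1) ≫ T.tensorInc U (n - 1) =
      ((K.d i (i - 1) ≫ T.inc (i - 1)) ⊗ₘ U.inc j) +
        i.negOnePow • (T.inc i ⊗ₘ (L.d j (j - 1) ≫ U.inc (j - 1))) := by
  rw [HomologicalComplex.mapBifunctor.d_eq, Preadditive.add_comp, Preadditive.comp_add]
  congr 1
  · refine (HomologicalComplex.mapBifunctor.ι_D₁_assoc _ _ _ _ _ _ _ _ h _).trans ?_
    rw [HomologicalComplex.mapBifunctor.d₁_eq K L (curriedTensor (Rep.{u} k G))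
      (ComplexShape.down ℤ) (i₁ := i) (i₁' := i - 1) (by simp) j (n - 1)
      (show i - 1 + j = n - 1 by omega)]
    have h2 : ComplexShape.ε₁ (ComplexShape.down ℤ) (ComplexShape.down ℤ) (ComplexShape.down ℤ)
      (i, j) = 1 := rfl
    rw [h2, one_smul, Category.assoc]
    refine (congrArg (_ ≫ ·) (T.ι_tensorInc U (i - 1) j (n - 1) (by omega))).trans ?_
    change (K.d i (i - 1) ▷ L.X j) ≫ (T.inc (i - 1) ⊗ₘ U.inc j) = _
    rw [← tensorHom_id, tensorHom_comp_tensorHom, Category.id_comp]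
  · refine (HomologicalComplex.mapBifunctor.ι_D₂_assoc _ _ _ _ _ _ _ _ h _).trans ?_
    rw [HomologicalComplex.mapBifunctor.d₂_eq K L (curriedTensor (Rep.{u} k G))
      (ComplexShape.down ℤ) i (i₂ := j) (i₂' := j - 1) (by simp) (n - 1)
      (show i + (j - 1) = n - 1 by omega)]
    have h2 : ComplexShape.ε₂ (ComplexShape.down ℤ) (ComplexShape.down ℤ) (ComplexShape.down ℤ)
      (i, j) = i.negOnePow := rfl
    rw [h2, Linear.units_smul_comp, Category.assoc]
    refine congrArg (i.negOnePow • ·) ?_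
    refine (congrArg (_ ≫ ·) (T.ι_tensorInc U i (j - 1) (n - 1) (by omega))).trans ?_
    change (K.X i ◁ L.d j (j - 1)) ≫ (T.inc i ⊗ₘ U.inc (j - 1)) = _
    rw [← id_tensorHom, tensorHom_comp_tensorHom, Category.id_comp]

variable {C : ChainComplex (Rep.{u} k G) ℤ} (T : Totalization C)

/-- The total module of the dual complex. -/
def dual : Totalization (dualComplex C) where
  V := dualObj T.V
  inc n := dualMap (T.prj (-n))
  prj n := dualMap (T.inc (-n))
  S := T.S.image Neg.neg
  inc_prj_self n := (dualMap_comp _ _).trans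
    ((congrArg dualMap (T.inc_prj_self (-n))).trans (dualMap_id _))
  inc_prj_ne m n hmn := (dualMap_comp _ _).trans
    ((congrArg dualMap (T.inc_prj_ne (-n) (-m) (by omega))).trans (dualMap_zero _ _))
  sum_prj_inc := by
    have h : ∀ n : ℤ, dualMap (T.inc (- -n)) ≫ dualMap (T.prj (- -n)) =
        dualMap (T.prj n ≫ T.inc n) := fun n => by
      rw [neg_neg, dualMap_comp]
    rw [Finset.sum_image fun _ _ _ _ h => neg_injective h]
    refine (Finset.sum_congr rfl fun n _ => h n).trans ?_
    rw [← dualMap_sum, T.sum_prj_inc, dualMap_id]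

theorem prj_sign (n : ℤ) (x : T.V.V) :
    (T.prj n).hom (T.graded.sign x) = ((n.negOnePow : ℤ) : k) • (T.prj n).hom x := by
  have h : (T.prj n).hom (T.graded.P n (T.graded.sign x)) =
      (T.prj n).hom (((n.negOnePow : ℤ) : k) • T.graded.P n x) :=
    congrArg (T.prj n).hom (LinearMap.congr_fun (T.graded.P_mul_sign n) x)
  rw [map_smul] at h
  exact (T.prj_inc_self n _).symm.trans (h.trans (congrArg _ (T.prj_inc_self n _)))

theorem dualEnd_sign (i : ℤ) (φ : Module.Dual k (C.X (-i)).V) :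
    dualEnd T.graded.sign ((dualMap (T.prj (-i))).hom φ) =
      ((i.negOnePow : ℤ) : k) • (dualMap (T.prj (-i))).hom φ := by
  refine LinearMap.ext fun x => ?_
  refine (congrArg φ (T.prj_sign (-i) x)).trans ?_
  rw [Int.negOnePow_neg, map_smul]
  rfl

theorem dualEnd_d_sign (i : ℤ) (φ : Module.Dual k (C.X (-i)).V) :
    dualEnd (T.graded.d * T.graded.sign) ((dualMap (T.prj (-i))).hom φ) =
      (dualMap (T.prj (-(i - 1)))).hom (((dualComplex C).d i (i - 1)).hom φ) := by
  have h : ((dualComplex C).d i (i - 1)).hom φ =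
      (((i + 1).negOnePow : ℤ) : k) • (dualMap (C.d (-(i - 1)) (-i))).hom φ :=
    units_smul_hom_apply _ _ _
  rw [h, map_smul]
  refine LinearMap.ext fun x => ?_
  have h1 := T.prj_graded_d (-i) (T.graded.sign x)
  rw [T.prj_sign, show -i + 1 = -(i - 1) by ring] at h1
  refine (congrArg φ h1).trans ?_
  rw [map_smul, map_smul, Int.negOnePow_neg, Int.negOnePow_sub, Int.negOnePow_add]
  rfl

/-- The sign conventions match: in degree `i` of the dual, the transpose of `sign` is the Koszul
sign `(-1)^i`, and the transpose of `d * sign` carries the sign `(-1)^(i+1)` of the dual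
differential. -/
theorem tensor_graded_d : (T.dual.tensor T).graded.d = T.graded.tensorD := by
  let F : dualTensor T.V ⟶ dualTensor T.V := homOfIsLinearOn T.graded.linear_tensorD
  suffices h : (T.dual.tensor T).d = F from congrArg (fun f : dualTensor T.V ⟶ dualTensor T.V =>
    f.hom.toLinearMap) h
  refine (T.dual.tensor T).hom_ext_inc fun n => ?_
  refine ((T.dual.tensor T).inc_d n).trans ?_
  refine HomologicalComplex.mapBifunctor.hom_ext fun i j h => ?_
  refine (T.dual.ι_d_tensorInc T i j n h).trans
    (Eq.trans ?_ (((Category.assoc _ _ _).symm.trans (congrArg (· ≫ F)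
      (T.dual.ι_tensorInc T i j n h))).symm))
  refine Rep.hom_ext (Representation.IntertwiningMap.toLinearMap_injective _ _ ?_)
  refine TensorProduct.ext' fun φ x => ?_
  have h1 : (i.negOnePow • (T.dual.inc i ⊗ₘ (C.d j (j - 1) ≫ T.inc (j - 1)))).hom
      (TensorProduct.tmul k φ x) = ((i.negOnePow : ℤ) : k) •
        TensorProduct.tmul k ((dualMap (T.prj (-i))).hom φ)
          ((T.inc (j - 1)).hom ((C.d j (j - 1)).hom x)) := units_smul_hom_apply _ _ _
  have h2 : F.hom ((T.dual.inc i ⊗ₘ T.inc j).hom (TensorProduct.tmul k φ x)) =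
      TensorProduct.tmul k (dualEnd (T.graded.d * T.graded.sign) ((dualMap (T.prj (-i))).hom φ))
        ((T.inc j).hom x) + TensorProduct.tmul k (dualEnd T.graded.sign
          ((dualMap (T.prj (-i))).hom φ)) (T.graded.d ((T.inc j).hom x)) := rfl
  refine Eq.trans ?_ (h2.trans (congrArg₂ (fun a b => TensorProduct.tmul k a ((T.inc j).hom x) +
    TensorProduct.tmul k b (T.graded.d ((T.inc j).hom x)))
      (T.dualEnd_d_sign i φ) (T.dualEnd_sign i φ))).symm
  rw [T.graded_d_inc]
  refine congrArg (TensorProduct.tmul k ((dualMap (T.prj (-(i - 1)))).hom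
    (((dualComplex C).d i (i - 1)).hom φ)) ((T.inc j).hom x) + ·) (h1.trans ?_)
  exact TensorProduct.smul_tmul' _ _ _

theorem tensor_graded_P_apply (n : ℤ) (x : (dualTensor T.V).V) :
    (T.dual.tensor T).graded.P n x =
      ∑ j ∈ T.S, TensorProduct.map (dualEnd (T.graded.P (-(n - j)))) (T.graded.P j) x := by
  have h := (congrArg (toLinearMapHom (T.dual.V ⊗ T.V) (T.dual.V ⊗ T.V))
    (T.dual.tensorPrj_tensorInc T n)).trans (map_sum (toLinearMapHom _ _) _ _)
  exact (LinearMap.congr_fun h x).trans (LinearMap.sum_apply _ _ _)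

end Totalization

end Rep

/-! ### Homogeneity, and homotopy equivalences with a complex in degree zero -/

namespace Rep

variable {k : Type u} [Field k] {G : Type v} [Group G]

namespace GradedDifferential

variable {M : Rep.{u} k G} (D : GradedDifferential M)
  (E : GradedDifferential (dualTensor M))

theorem contractLeft_P_zero (hE : ∀ n, n ≠ 0 → ∀ x, contractLeft k M.V (E.P n x) = 0)
    (x : (dualTensor M).V) : contractLeft k M.V (E.P 0 x) = contractLeft k M.V x := by
  have h := congrArg (contractLeft k M.V) (LinearMap.congr_fun E.sum_P x)
  rw [LinearMap.sum_apply, map_sum, Finset.sum_eq_single 0] at h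
  · exact h
  · exact fun n _ hn => hE n hn x
  · exact fun h0 => by rw [E.P_eq_zero h0, LinearMap.zero_apply, map_zero]

variable [Module.Finite k M.V]

theorem P_zero_coev (hE : ∀ n, n ≠ 0 → E.P n D.coev = 0) : E.P 0 D.coev = D.coev := by
  have h := LinearMap.congr_fun E.sum_P D.coev
  rw [LinearMap.sum_apply, Finset.sum_eq_single 0] at h
  · exact h
  · exact fun n _ hn => hE n hn
  · exact fun h0 => by rw [E.P_eq_zero h0, LinearMap.zero_apply]

/-- Evaluation and coevaluation live in degree zero, so their idempotent is homogeneous, as the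
degreewise construction of homotopies requires. -/
theorem P_mul_evCompl (h₁ : ∀ n, n ≠ 0 → ∀ x, contractLeft k M.V (E.P n x) = 0)
    (h₂ : ∀ n, n ≠ 0 → E.P n D.coev = 0) (n : ℤ) : E.P n * D.evCompl = D.evCompl * E.P n := by
  ext1 x
  rw [Module.End.mul_apply, Module.End.mul_apply, evCompl_apply, evCompl_apply, map_sub, map_smul]
  rcases eq_or_ne n 0 with rfl | hn
  · rw [D.P_zero_coev E h₂, E.contractLeft_P_zero h₁]
  · rw [h₁ n hn, h₂ n hn, mul_zero, zero_smul, smul_zero]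

end GradedDifferential

namespace Totalization

section

variable {C : ChainComplex (Rep.{u} k G) ℤ} (T : Totalization C)

theorem contractLeft_tensor_P {n : ℤ} (hn : n ≠ 0) (x : (dualTensor T.V).V) :
    contractLeft k T.V.V ((T.dual.tensor T).graded.P n x) = 0 := by
  refine ((congrArg (contractLeft k T.V.V) (T.tensor_graded_P_apply n x)).trans
    (map_sum _ _ _)).trans ?_
  refine Finset.sum_eq_zero fun j _ => ?_
  rw [GradedDifferential.contractLeft_map, T.graded.P_ne _ _ (by omega),
    TensorProduct.map_zero_right]
  simp

theorem tensor_P_coev [Module.Finite k T.V.V] {n : ℤ} (hn : n ≠ 0) :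
    (T.dual.tensor T).graded.P n T.graded.coev = 0 := by
  refine GradedDifferential.dualTensorHom_injective ?_
  refine ((congrArg (dualTensorHom k T.V.V T.V.V) (T.tensor_graded_P_apply n _)).trans
    (map_sum _ _ _)).trans (Eq.trans ?_ (map_zero _).symm)
  refine Finset.sum_eq_zero fun j _ => ?_
  rw [dualTensorHom_map, GradedDifferential.dualTensorHom_coev, T.graded.P_mul_sign,
    smul_mul_assoc, T.graded.P_ne _ _ (by omega), smul_zero]

theorem tensorD_sq : T.graded.tensorD * T.graded.tensorD = 0 := by
  rw [← tensor_graded_d]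
  exact (T.dual.tensor T).graded.d_sq

theorem finite_totalModule (hC : ∀ n, Module.Finite k (C.X n).V) : Module.Finite k T.V.V := by
  let f : (∀ n : T.S, (C.X n).V) →ₗ[k] T.V.V :=
    ∑ n : T.S, (T.inc n).hom.toLinearMap ∘ₗ LinearMap.proj n
  refine Module.Finite.of_surjective f fun x => ⟨fun n => (T.prj n).hom x, ?_⟩
  rw [LinearMap.sum_apply]
  exact (Finset.sum_coe_sort T.S fun n => (T.inc n).hom ((T.prj n).hom x)).trans (T.sum_inc_prj x)

end

variable {K : ChainComplex (Rep.{u} k G) ℤ} (U : Totalization K) {A : Rep.{u} k G}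

/-- A retraction of the total module onto `A` up to homotopy gives a homotopy equivalence. -/
theorem nonempty_homotopyEquiv_single {ε : U.V ⟶ A} {η : A ⟶ U.V} {s : U.V ⟶ U.V}
    (hε : U.d ≫ ε = 0) (hη : η ≫ U.d = 0) (hη₀ : η ≫ U.prj 0 ≫ U.inc 0 = η) (hηε : η ≫ ε = 𝟙 A)
    (hs : 𝟙 U.V - ε ≫ η = U.d ≫ s + s ≫ U.d) :
    Nonempty (HomotopyEquiv K
      ((HomologicalComplex.single (Rep.{u} k G) (ComplexShape.down ℤ) 0).obj A)) := by
  let a : K ⟶ (HomologicalComplex.single (Rep.{u} k G) (ComplexShape.down ℤ) 0).obj A :=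
    HomologicalComplex.mkHomToSingle (U.inc 0 ≫ ε) fun i hi => by
      obtain rfl : i = 1 := by simpa using hi.symm
      have := U.inc_d_assoc 1 ε
      rw [hε, Limits.comp_zero] at this
      exact this.symm
  let b : (HomologicalComplex.single (Rep.{u} k G) (ComplexShape.down ℤ) 0).obj A ⟶ K :=
    HomologicalComplex.mkHomFromSingle (η ≫ U.prj 0) fun i hi => by
      obtain rfl : i = -1 := by
        simp only [ComplexShape.down_Rel] at hi
        omega
      have := congrArg (η ≫ ·) (U.d_prj (-1))
      simp only [← Category.assoc] at this
      rw [hη, Limits.zero_comp] at this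
      exact this.symm
  have ha : a.f 0 = (U.inc 0 ≫ ε) ≫ (HomologicalComplex.singleObjXSelf _ 0 A).inv :=
    HomologicalComplex.mkHomToSingle_f _ _
  have hb : b.f 0 = (HomologicalComplex.singleObjXSelf _ 0 A).hom ≫ η ≫ U.prj 0 :=
    HomologicalComplex.mkHomFromSingle_f _ _
  have hne : ∀ n, n ≠ 0 → η ≫ U.prj n = 0 := fun n hn => by
    rw [← hη₀, Category.assoc, Category.assoc, U.inc_prj_ne 0 n hn.symm, Limits.comp_zero,
      Limits.comp_zero]
  have hab : ∀ n, (a ≫ b).f n = U.inc n ≫ ε ≫ η ≫ U.prj n := by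
    intro n
    rcases eq_or_ne n 0 with rfl | hn
    · rw [HomologicalComplex.comp_f, ha, hb]
      simp
    · rw [HomologicalComplex.comp_f, hne n hn, Limits.comp_zero, Limits.comp_zero]
      exact (congrArg (· ≫ b.f n) ((HomologicalComplex.isZero_single_obj_X _ _ _ _ hn).eq_of_tgt
        (a.f n) 0)).trans Limits.zero_comp
  -- The homotopy runs from `a ≫ b` to the identity, whereas `s` contracts the identity minus the
  -- retraction; hence the minus sign.
  refine ⟨⟨a, b, ⟨fun i j => if i + 1 = j then -(U.inc i ≫ s ≫ U.prj j) else 0, ?_, ?_⟩,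
    Homotopy.ofEq ?_⟩⟩
  · intro i j hij
    exact if_neg fun h => hij (by simpa using h)
  · intro n
    rw [dNext_eq _ (show (ComplexShape.down ℤ).Rel n (n - 1) by simp),
      prevD_eq _ (show (ComplexShape.down ℤ).Rel (n + 1) n by simp), if_pos (by ring), if_pos rfl,
      hab]
    have h1 : U.inc n ≫ (𝟙 U.V - ε ≫ η) ≫ U.prj n =
        K.d n (n - 1) ≫ U.inc (n - 1) ≫ s ≫ U.prj n +
          (U.inc n ≫ s ≫ U.prj (n + 1)) ≫ K.d (n + 1) n := by
      rw [hs, Preadditive.add_comp, Preadditive.comp_add]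
      simp only [Category.assoc]
      rw [U.inc_d_assoc, U.d_prj]
    rw [Preadditive.sub_comp, Preadditive.comp_sub, Category.id_comp, U.inc_prj_self] at h1
    rw [Preadditive.comp_neg, Preadditive.neg_comp, ← neg_add, ← h1, HomologicalComplex.id_f]
    simp only [Category.assoc]
    abel
  · refine HomologicalComplex.from_single_hom_ext ?_
    rw [HomologicalComplex.comp_f, ha, hb, HomologicalComplex.id_f]
    have h2 : (η ≫ U.prj 0) ≫ U.inc 0 ≫ ε = 𝟙 A := by
      rw [← hηε]
      conv_rhs => rw [← hη₀]
      simp only [Category.assoc]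
    have h3 : ∀ {X : Rep.{u} k G} (f : X ⟶ A) (g : A ⟶ X), f ≫ g = 𝟙 X →
        (f ≫ η ≫ U.prj 0) ≫ (U.inc 0 ≫ ε) ≫ g = 𝟙 X := fun f g hfg => by
      have := congrArg (fun t => f ≫ t ≫ g) h2
      simp only [Category.assoc, Category.id_comp] at this ⊢
      exact this.trans hfg
    exact h3 _ _ (Iso.hom_inv_id _)

/-- A homotopy equivalence onto a complex concentrated in degree zero gives a retraction of the
total module up to homotopy. -/
theorem exists_retraction_of_homotopyEquiv (e : HomotopyEquiv K
      ((HomologicalComplex.single (Rep.{u} k G) (ComplexShape.down ℤ) 0).obj A)) :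
    ∃ (ε : U.V ⟶ A) (η : A ⟶ U.V) (s : U.V ⟶ U.V), U.d ≫ ε = 0 ∧ η ≫ U.d = 0 ∧ η ≫ ε = 𝟙 A ∧
      𝟙 U.V - ε ≫ η = U.d ≫ s + s ≫ U.d := by
  let φ := HomologicalComplex.singleObjXSelf (ComplexShape.down ℤ) 0 A
  let h := e.homotopyHomInvId.hom
  have hd : ∀ i j, ((HomologicalComplex.single (Rep.{u} k G) (ComplexShape.down ℤ) 0).obj A).d i j
      = 0 := fun i j => HomologicalComplex.single_obj_d _ _ _ _ _
  -- The target has zero differentials, so a map homotopic to its identity equals it, and `η ≫ ε` is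
  -- the identity on the nose.
  have h0 : e.inv.f 0 ≫ e.hom.f 0 = 𝟙 _ := by
    have := e.homotopyInvHomId.comm 0
    rw [dNext_eq _ (show (ComplexShape.down ℤ).Rel 0 (-1) by simp),
      prevD_eq _ (show (ComplexShape.down ℤ).Rel 1 0 by simp), hd, hd, Limits.zero_comp,
      Limits.comp_zero, zero_add, zero_add] at this
    exact this
  refine ⟨U.prj 0 ≫ e.hom.f 0 ≫ φ.hom, φ.inv ≫ e.inv.f 0 ≫ U.inc 0,
    -U.desc fun n => h n (n + 1) ≫ U.inc (n + 1), ?_, ?_, ?_, ?_⟩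
  · rw [U.d_prj_assoc]
    have : K.d (0 + 1) 0 ≫ e.hom.f 0 = 0 := by rw [← e.hom.comm, hd, Limits.comp_zero]
    rw [reassoc_of% this, Limits.zero_comp, Limits.comp_zero]
  · rw [Category.assoc, Category.assoc, U.inc_d]
    have : e.inv.f 0 ≫ K.d 0 (0 - 1) = 0 := by rw [e.inv.comm, hd, Limits.zero_comp]
    rw [reassoc_of% this, Limits.zero_comp, Limits.comp_zero]
  · simp only [Category.assoc]
    rw [U.inc_prj_self_assoc, reassoc_of% h0, Iso.inv_hom_id]
  · refine U.hom_ext_inc fun n => ?_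
    have h1 : U.inc n ≫ (U.prj 0 ≫ e.hom.f 0 ≫ φ.hom) ≫ φ.inv ≫ e.inv.f 0 ≫ U.inc 0 =
        (e.hom ≫ e.inv).f n ≫ U.inc n := by
      simp only [Category.assoc, Iso.hom_inv_id_assoc, HomologicalComplex.comp_f]
      rcases eq_or_ne n 0 with rfl | hn
      · rw [U.inc_prj_self_assoc]
      · rw [U.inc_prj_ne_assoc _ _ hn, (HomologicalComplex.isZero_single_obj_X
          (ComplexShape.down ℤ) 0 A n hn).eq_of_tgt (e.hom.f n) 0, Limits.zero_comp]
    have h2 := e.homotopyHomInvId.comm n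
    rw [dNext_eq _ (show (ComplexShape.down ℤ).Rel n (n - 1) by simp),
      prevD_eq _ (show (ComplexShape.down ℤ).Rel (n + 1) n by simp), HomologicalComplex.id_f] at h2
    have h3 : ∀ m, m = n → h (n - 1) m ≫ U.inc m = h (n - 1) n ≫ U.inc n := by
      rintro m rfl
      rfl
    have h4 : ∀ m, m = n → K.d (n + 1) m ≫ U.inc m = K.d (n + 1) n ≫ U.inc n := by
      rintro m rfl
      rfl
    rw [Preadditive.comp_sub, h1, h2, Category.comp_id, Preadditive.comp_add, Preadditive.comp_neg,
      Preadditive.comp_neg, Preadditive.neg_comp, Preadditive.comp_neg, U.inc_d_assoc, U.inc_desc,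
      U.inc_desc_assoc, Category.assoc, U.inc_d, h3 _ (sub_add_cancel n 1),
      h4 _ (add_sub_cancel_right n 1)]
    simp only [Preadditive.add_comp, Category.assoc, Category.id_comp]
    abel

end Totalization

end Rep

/-! ### The two implications -/

namespace Rep

variable {k : Type u} [Field k] {G : Type v} [Group G] [Finite G]
  {C : ChainComplex (Rep.{u} k G) ℤ}

theorem exists_totalization_brauerComplex (T : Totalization C) (Q : Subgroup G) :
    ∃ E : Totalization (brauerComplex C Q), E.S = T.S := by
  refine exists_totalization _ _ fun n hn => (brauer Q).map_isZero ?_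
  exact (Limits.IsZero.iff_id_eq_zero _).2 (by
    rw [← T.inc_prj_self, T.inc_eq_zero hn, Limits.zero_comp])

variable {p : ℕ} [Fact p.Prime] [CharP k p]

theorem isEndotrivial_of_homology_brauerComplex (T : Totalization C)
    (hC : ∀ i, IsPPermutation p (C.X i))
    (h : ∀ Q : Subgroup G, IsPGroup p Q →
      ∃ i : ℤ, Module.finrank k ((brauerComplex C Q).homology i).V = 1 ∧
        ∀ j : ℤ, j ≠ i → Limits.IsZero ((brauerComplex C Q).homology j)) :
    IsEndotrivial C := by
  have := T.finite_totalModule fun n => (hC n).1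
  set D := T.graded with hD
  have key : ∀ Q : Subgroup G, IsPGroup p Q → ∃ j : ℤ,
      LinearMap.trace k T.V.V D.sign = ((j.negOnePow : ℤ) : k) ∧
      ∃ u σ : Module.End k (dualTensor T.V).V,
        u ∈ traceIdeal Q (dualTensor T.V) (dualTensor T.V) ∧
        IsLinearOn Q (dualTensor T.V) (dualTensor T.V) σ ∧
        u = D.evCompl - (D.tensorD * σ + σ * D.tensorD) := fun Q hQ => by
    obtain ⟨j, hj, hE⟩ := h Q hQ
    obtain ⟨E, hS⟩ := exists_totalization_brauerComplex T Q
    exact ⟨j, exists_evCompl_homotopy_of_homology hQ hC T E hS T.tensorD_sq hj hE⟩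
  set t := LinearMap.trace k T.V.V D.sign with ht
  have htt : t * t = 1 := by
    -- The trivial subgroup already shows that the supertrace is `±1` in `k`.
    obtain ⟨j, hj, -⟩ := key ⊥ IsPGroup.of_bot
    rw [hj, GradedDifferential.negOnePow_cast_mul_self]
  let U := T.dual.tensor T
  have hUd : U.graded.d = D.tensorD := T.tensor_graded_d
  have hnull : U.graded.IsNullOn ⊤ D.evCompl := by
    refine U.graded.isNullOn_top (p := p) D.linear_evCompl ?_ (D.evCompl_sq htt)
      (D.P_mul_evCompl U.graded (fun n hn => T.contractLeft_tensor_P hn)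
        (fun n hn => T.tensor_P_coev hn)) fun Q hQ => ?_
    · rw [hUd]
      exact D.tensorD_mul_evCompl
    · obtain ⟨-, -, h⟩ := key Q hQ
      rw [hUd]
      exact h
  obtain ⟨s, hs, hes⟩ := hnull
  rw [hUd] at hes
  let ε : U.V ⟶ Rep.trivial k G k := homOfIsLinearOn (isLinearOn_contractLeft T.V ⊤)
  -- Evaluating `coev` gives `t`, so the section of evaluation is `t • coev`, by `t * t = 1`.
  have hη : IsLinearOn ⊤ (Rep.trivial k G k) (dualTensor T.V)
      (LinearMap.toSpanSingleton k _ (t • D.coev)) := fun g hg c => by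
    change c • t • D.coev = (dualTensor T.V).ρ g (c • t • D.coev)
    rw [map_smul, map_smul, mem_fixedPoints.1 (D.coev_mem_fixedPoints ⊤) g hg]
  let η : Rep.trivial k G k ⟶ U.V := homOfIsLinearOn hη
  have hext : ∀ {X Y : Rep.{u} k G} {f g : X ⟶ Y}, (∀ x, f.hom x = g.hom x) → f = g :=
    fun h => Rep.hom_ext (Representation.IntertwiningMap.toLinearMap_injective _ _
      (LinearMap.ext h))
  have hUd' : ∀ x : (dualTensor T.V).V, U.d.hom x = D.tensorD x := fun x =>
    congrArg (fun f : Module.End k (dualTensor T.V).V => f x) hUd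
  refine U.nonempty_homotopyEquiv_single (ε := ε) (η := η) (s := homOfIsLinearOn hs)
    (hext fun x => ?_) (hext fun c => ?_) (hext fun c => ?_) (hext fun c => ?_) (hext fun x => ?_)
  · exact (congrArg (contractLeft k T.V.V) (hUd' x)).trans (D.contractLeft_tensorD x)
  · refine (hUd' (c • t • D.coev)).trans ?_
    rw [map_smul, map_smul, D.tensorD_coev, smul_zero, smul_zero]
    rfl
  · have h0 : U.graded.P 0 D.coev = D.coev :=
      D.P_zero_coev U.graded fun n hn => T.tensor_P_coev hn
    have h1 : ∀ (a b : k) (f : Module.End k (dualTensor T.V).V), f D.coev = D.coev →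
        f (a • b • D.coev) = a • b • D.coev := fun a b f hf => by rw [map_smul, map_smul, hf]
    exact h1 c t (U.graded.P 0) h0
  · change contractLeft k T.V.V (c • t • D.coev) = c
    rw [map_smul, map_smul, D.contractLeft_coev, smul_eq_mul, smul_eq_mul, ← ht, htt, mul_one]
  · have h1 : ∀ y : (dualTensor T.V).V, (𝟙 U.V - ε ≫ η).hom y = D.evCompl y := fun y => by
      rw [D.evCompl_apply, mul_comm, mul_smul]
      rfl
    refine (h1 x).trans ((congrArg (fun f : Module.End k (dualTensor T.V).V => f x) hes).trans ?_)
    rw [← hUd, add_comm]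
    rfl

theorem exists_finrank_homology_brauerComplex_of_isEndotrivial (T : Totalization C)
    (hC : ∀ i, IsPPermutation p (C.X i)) (h : IsEndotrivial C) {Q : Subgroup G}
    (hQ : IsPGroup p Q) :
    ∃ i : ℤ, Module.finrank k ((brauerComplex C Q).homology i).V = 1 ∧
      ∀ j : ℤ, j ≠ i → Limits.IsZero ((brauerComplex C Q).homology j) := by
  obtain ⟨e⟩ := h
  let U := T.dual.tensor T
  obtain ⟨ε, η, s, hε, hη, hηε, hs⟩ := U.exists_retraction_of_homotopyEquiv e
  obtain ⟨E, hS⟩ := exists_totalization_brauerComplex T Q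
  have hUd : ∀ x : (dualTensor T.V).V, U.d.hom x = T.graded.tensorD x := fun x =>
    congrArg (fun f : Module.End k (dualTensor T.V).V => f x) T.tensor_graded_d
  refine exists_finrank_homology_brauerComplex_eq_one hQ hC T E hS
    (S := s.hom.toLinearMap) (α := η.hom (1 : k)) (β := ε.hom.toLinearMap)
    (IsLinearOn.of_hom s) (mem_fixedPoints.2 fun g _ => ?_) ?_ (IsLinearOn.of_hom ε) (fun x => ?_)
    ?_ (LinearMap.ext fun (x : (dualTensor T.V).V) => ?_)
  · exact (hom_comm_apply η g (1 : k)).symm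
  · exact (hUd _).symm.trans (congrArg (fun f : Rep.trivial k G k ⟶ U.V => f.hom (1 : k)) hη)
  · exact (congrArg ε.hom (hUd x)).symm.trans
      (congrArg (fun f : U.V ⟶ Rep.trivial k G k => f.hom x) hε)
  · exact congrArg (fun f : Rep.trivial k G k ⟶ Rep.trivial k G k => f.hom (1 : k)) hηε
  · have h1 : ∀ c : k, η.hom c = c • η.hom (1 : k) := fun c =>
      (congrArg η.hom (mul_one c).symm).trans (map_smul η.hom c (1 : k))
    have h2 : (𝟙 U.V - ε ≫ η).hom x = s.hom (U.d.hom x) + U.d.hom (s.hom x) :=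
      congrArg (fun f : U.V ⟶ U.V => f.hom x) hs
    have h3 : ∀ y : U.V.V, y - (show k from ε.hom x) • η.hom (1 : k) =
        y - η.hom (ε.hom x) := fun y => congrArg (y - ·) (h1 _).symm
    refine (h3 x).trans (h2.trans ?_)
    exact (add_comm _ _).trans <| congrArg₂ (· + ·) (hUd _) (congrArg s.hom (hUd x))

end Rep

end

theorem mainTheorem2 {k : Type u} [Field k] {G : Type v} [Group G] [Finite G]
    (p : ℕ) [Fact p.Prime] [CharP k p]
    (C : ChainComplex (Rep.{u} k G) ℤ) (hbounded : Rep.IsBoundedComplex C)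
    (hperm : ∀ i : ℤ, Rep.IsPPermutation p (C.X i)) :
    Rep.IsEndotrivial C ↔
      ∀ P : Subgroup G, IsPGroup p P →
        ∃ i : ℤ, Module.finrank k ((Rep.brauerComplex C P).homology i).V = 1 ∧
          ∀ j : ℤ, j ≠ i → CategoryTheory.Limits.IsZero ((Rep.brauerComplex C P).homology j) := by
  obtain ⟨a, b, hab⟩ := hbounded
  obtain ⟨T, -⟩ := Rep.exists_totalization C (Finset.Icc a b) fun n hn => hab n (by
    rw [Finset.mem_Icc] at hn
    omega)
  exact ⟨fun h P hP =>
    Rep.exists_finrank_homology_brauerComplex_of_isEndotrivial T hperm h hP,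
    Rep.isEndotrivial_of_homology_brauerComplex T hperm⟩
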